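/- **Corollary 1.7.** Let $m\ge 2$, $n\ge 1$, $0<\epsilon<\alpha<mn$, $1\le s'<p_1,\dots,p_m<\infty$, $\frac1s+\frac1{s'}=1$ (so $1<s\le\infty$), $\frac1p=\sum_{i=1}^m\frac1{p_i}$, and suppose that $q,q_\epsilon,q_{-\epsilon}\in(0,\infty)$ satisfy $$\frac1q=\frac1p-\frac\alpha n,\qquad \frac1{q_\epsilon}=\frac1p-\frac{\alpha+\epsilon}n,\qquad \frac1{q_{-\epsilon}}=\frac1p-\frac{\alpha-\epsilon}n .$$ *Notation.* Cubes $Q\subset\mathbb R^n$ have sides parallel to the axes, and $\langle g\rangle_Q=\frac1{|Q|}\int_Q g$. For $r>1$ put $r'=\frac r{r-1}$. For measurable $\vec\omega=(\omega_1,\dots,\omega_m)$, $\omega_i:\mathbb R^n\to[0,\infty)$, let $\nu_{\vec\omega}=\prod_i\omega_i$, $\vec\omega^{t}=(\omega_1^{t},\dots,\omega_m^{t})$ and $\frac{\vec P}{t}=(\frac{p_1}{t},\dots,\frac{p_m}{t})$. For $\vec R=(r_1,\dots,r_m)$ with all $r_i>1$ and for $\kappa>0$ let $$[\vec\omega]_{A_{(\vec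 R,\kappa)}}=\sup_Q\ \langle\nu_{\vec\omega}^{\kappa}\rangle_Q\prod_{i=1}^m\langle\omega_i^{-r_i'}\rangle_Q^{\kappa/r_i'},$$ and write $\vec\omega\in A_{(\vec R,\kappa)}$ if this is finite. Let $[\sigma]_{A_\infty}=\sup_Q\frac1{\sigma(Q)}\int_Q M(\sigma\chi_Q)$, where $M$ is the Hardy–Littlewood maximal operator over cubes. Let $$\mathcal M_\beta(\vec f)(x)=\sup_{Q\ni x}\prod_{i=1}^m\frac1{|Q|^{1-\frac\beta{mn}}}\int_Q|f_i|,\qquad \mathcal I_{\Omega,\alpha}(\vec f)(x)=\int_{(\mathbb R^n)^m}\frac{\Omega(y_1,\dots,y_m)}{|(y_1,\dots,y_m)|^{mn-\alpha}}\prod_{i=1}^mf_i(x-y_i)\,d\vec y,$$ and $\mathcal I_\alpha=\mathcal I_{1,\alpha}$. The kernel $\Omega$ is a complex function on $(\mathbb R^n)^m$ such that either * $\Omega(\lambda y_1,\dots,\lambda y_m)=\Omega(y_1,\dots,y_m)$ for all $\lambda>0$, $\Omega\in L^s(S^{mn-1})$ with $S^{mn-1}$ the unit sphere of $(\mathbb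 R^n)^m$, and $\|\Omega\|_{L^s}$ is the norm there; or * $\Omega(\lambda_1y_1,\dots,\lambda_my_m)=\Omega(y_1,\dots,y_m)$ for all $\lambda_1,\dots,\lambda_m>0$, $\Omega\in L^s((S^{n-1})^m)$, and $\|\Omega\|_{L^s}$ is the norm there. **(1)** There is a constant $C$ depending only on $m,n,\alpha,\epsilon,s,p_1,\dots,p_m$ such that, for all such $\Omega$, all $\vec\omega$ with $\vec\omega^{s'}\in A_{(\frac{\vec P}{s'},\frac q{s'})}\cap A_{(\frac{\vec P}{s'},\frac{q_\epsilon}{s'})}\cap A_{(\frac{\vec P}{s'},\frac{q_{-\epsilon}}{s'})}$ and all complex $f_i\in L^{p_i}(\omega_i^{p_i})$, the integral $\mathcal I_{\Omega,\alpha}(\vec f)$ converges absolutely $\nu_{\vec\omega}^q\,dx$-almost everywhere, belongs to $L^q(\nu_{\vec\omega}^q)$, and $$\|\mathcal I_{\Omega,\alpha}(\vec f)\|_{L^q(\nu_{\vec\omega}^q)}\le C\|\Omega\|_{L^s}\Big\{[\vec\omega^{s'}]_{A_{(\frac{\vec P}{s'},\frac{q_\epsilon}{s'})}}^{\frac1{2q_\epsilon}}[\vec\omega^{s'}]_{A_{(\frac{\vec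 P}{s'},\frac{q_{-\epsilon}}{s'})}}^{\frac1{2q_{-\epsilon}}}\prod_{i=1}^m\big[\omega_i^{-s'(p_i/s')'}\big]_{A_\infty}^{\frac1{p_i}}\Big\}\prod_{i=1}^m\|f_i\|_{L^{p_i}(\omega_i^{p_i})}.$$ **(2)** Let $\Omega\equiv1$ (and $s'=1$). For $(\beta,\kappa)=(\alpha+\epsilon,q_\epsilon)$ or $(\alpha-\epsilon,q_{-\epsilon})$ call $\gamma\in\mathbb R$ *admissible for* $\mathcal M_\beta$ if there is a constant $C$ with $$\|\mathcal M_\beta(\vec f)\|_{L^\kappa(\nu_{\vec\omega}^\kappa)}\le C[\vec\omega]_{A_{(\vec P,\kappa)}}^{\gamma}\prod_{i=1}^m\|f_i\|_{L^{p_i}(\omega_i^{p_i})}$$ for all $\vec\omega\in A_{(\vec P,\kappa)}$ and all $f_i\in L^{p_i}(\omega_i^{p_i})$. If $\gamma_1$ is admissible for $\mathcal M_{\alpha+\epsilon}$ and $\gamma_2$ for $\mathcal M_{\alpha-\epsilon}$, then there is a constant $C$ such that, for all $\vec\omega\in A_{(\vec P,q)}\cap A_{(\vec P,q_\epsilon)}\cap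 A_{(\vec P,q_{-\epsilon})}$ and all $f_i\in L^{p_i}(\omega_i^{p_i})$, the integral $\mathcal I_\alpha(\vec f)$ converges absolutely $\nu_{\vec\omega}^q\,dx$-almost everywhere, belongs to $L^q(\nu_{\vec\omega}^q)$, and $$\|\mathcal I_\alpha(\vec f)\|_{L^q(\nu_{\vec\omega}^q)}\le C\Big\{[\vec\omega]_{A_{(\vec P,q_\epsilon)}}^{\gamma_1}[\vec\omega]_{A_{(\vec P,q_{-\epsilon})}}^{\gamma_2}\Big\}^{1/2}\prod_{i=1}^m\|f_i\|_{L^{p_i}(\omega_i^{p_i})}.$$ Moreover, the best powers are bounded as follows: every admissible $\gamma_1$ satisfies $\gamma_1\ge\frac{mp}{q_\epsilon(mp-1)}\big(1-\frac{\alpha+\epsilon}{mn}\big)$, every admissible $\gamma_2$ satisfies $\gamma_2\ge\frac{mp}{q_{-\epsilon}(mp-1)}\big(1-\frac{\alpha-\epsilon}{mn}\big)$, and the values $$\gamma_1=\tfrac1{q_\epsilon}\big(1-\tfrac{\alpha+\epsilon}{mn}\big)\max\{p_1',\dots,p_m'\},\qquad \gamma_2=\tfrac1{q_{-\epsilon}}\big(1-\tfrac{\alpha-\epsilon}{mn}\big)\max\{p_1',\dots,p_m'\}$$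 are admissible. In particular, if $p_1=\dots=p_m=r$, then the least admissible powers are exactly $\gamma_1=\frac{r'}{q_\epsilon}\big(1-\frac{\alpha+\epsilon}{mn}\big)$ and $\gamma_2=\frac{r'}{q_{-\epsilon}}\big(1-\frac{\alpha-\epsilon}{mn}\big)$. -/

import Mathlib

open MeasureTheory
open scoped ENNReal NNReal

noncomputable section

namespace RoughFractional

/-- Euclidean space `ℝⁿ`. -/
abbrev E (n : ℕ) : Type := EuclideanSpace ℝ (Fin n)

variable {m n : ℕ}

/-- The closed cube with sides parallel to the axes, lower corner `a` and side length `l`. -/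
def cube (a : E n) (l : ℝ) : Set (E n) := {y | ∀ j, y j ∈ Set.Icc (a j) (a j + l)}

/-- The average of `g` over `Q`. -/
def avg (Q : Set (E n)) (g : E n → ℝ≥0∞) : ℝ≥0∞ := (∫⁻ y in Q, g y) / volume Q

/-- The uncentred Hardy-Littlewood maximal function over cubes. -/
def hardyLittlewood (g : E n → ℝ≥0∞) (x : E n) : ℝ≥0∞ :=
  ⨆ (a : E n) (l : ℝ) (_ : 0 < l) (_ : x ∈ cube a l), avg (cube a l) g

/-- The (Fujii-Wilson) constant `[σ]_{A_∞} = sup_Q (1 / σ(Q)) ∫_Q M(σ χ_Q)`. -/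
def aInfty (σ : E n → ℝ≥0∞) : ℝ≥0∞ :=
  ⨆ (a : E n) (l : ℝ) (_ : 0 < l),
    (∫⁻ x in cube a l, hardyLittlewood ((cube a l).indicator σ) x) / ∫⁻ x in cube a l, σ x

/-- The characteristic
`[W]_{A_(P,q)} = sup_Q (avg_Q (∏ Wᵢ)^q) ∏ (avg_Q Wᵢ^(-Pᵢ'))^(q / Pᵢ')`. Weights take values in
`[0, ∞]`, so that a negative power of `0` is `∞`. -/
def apqConst (P : Fin m → ℝ) (q : ℝ) (W : Fin m → E n → ℝ≥0∞) : ℝ≥0∞ :=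
  ⨆ (a : E n) (l : ℝ) (_ : 0 < l),
    avg (cube a l) (fun y => (∏ i, W i y) ^ q) *
      ∏ i, avg (cube a l) (fun y => (W i y) ^ (-(P i).conjExponent)) ^ (q / (P i).conjExponent)

/-- The vector weight `(ω₁ ^ t, …, ω_m ^ t)`, with values in `[0, ∞]`. -/
def wpow (ω : Fin m → E n → ℝ≥0) (t : ℝ) : Fin m → E n → ℝ≥0∞ :=
  fun i x => (ω i x : ℝ≥0∞) ^ t

/-- The class `A_(P,q)`. -/
def InApq (P : Fin m → ℝ) (q : ℝ) (W : Fin m → E n → ℝ≥0∞) : Prop :=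
  apqConst P q W < ∞

/-- The measure `ν^q dx` with `ν = ∏ ωᵢ`. -/
def nuMeasure (ω : Fin m → E n → ℝ≥0) (q : ℝ) : Measure (E n) :=
  volume.withDensity fun x => (∏ i, (ω i x : ℝ≥0∞)) ^ q

/-- The measure `w^r dx` for a single weight `w`. -/
def wMeasure (w : E n → ℝ≥0) (r : ℝ) : Measure (E n) :=
  volume.withDensity fun x => (w x : ℝ≥0∞) ^ r

/-- `fᵢ ∈ L^{Pᵢ}(ωᵢ^{Pᵢ})` for every `i`. -/
def MemWeighted (P : Fin m → ℝ) (ω : Fin m → E n → ℝ≥0) (f : Fin m → E n → ℂ) : Prop :=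
  ∀ i, MemLp (f i) (ENNReal.ofReal (P i)) (wMeasure (ω i) (P i))

/-- `∏ᵢ ‖fᵢ‖_{L^{Pᵢ}(ωᵢ^{Pᵢ})}`. -/
def prodNorm (P : Fin m → ℝ) (ω : Fin m → E n → ℝ≥0) (f : Fin m → E n → ℂ) : ℝ≥0∞ :=
  ∏ i, eLpNorm (f i) (ENNReal.ofReal (P i)) (wMeasure (ω i) (P i))

/-- The multilinear fractional maximal function
`sup_{Q ∋ x} ∏ᵢ |Q|^{-(1 - β/(mn))} ∫_Q |fᵢ|`. -/
def fracMaximal (β : ℝ) (f : Fin m → E n → ℂ) (x : E n) : ℝ≥0∞ :=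
  ⨆ (a : E n) (l : ℝ) (_ : 0 < l) (_ : x ∈ cube a l),
    ∏ i, (∫⁻ y in cube a l, ‖f i y‖ₑ) / volume (cube a l) ^ (1 - β / (m * n))

/-- The Euclidean norm `|(y₁, …, y_m)|` on `(ℝⁿ)^m`. -/
def jointNorm (y : Fin m → E n) : ℝ := Real.sqrt (∑ i, ‖y i‖ ^ 2)

/-- The integrand `Ω(y) |y|^{-(mn - α)} ∏ᵢ fᵢ(x - yᵢ)`. -/
def fracIntegrand (Ω : (Fin m → E n) → ℂ) (α : ℝ) (f : Fin m → E n → ℂ) (x : E n)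
    (y : Fin m → E n) : ℂ :=
  Ω y / ((jointNorm y ^ ((m : ℝ) * n - α) : ℝ) : ℂ) * ∏ i, f i (x - y i)

/-- The rough multilinear fractional integral `I_{Ω,α}`. -/
def fracIntegral (Ω : (Fin m → E n) → ℂ) (α : ℝ) (f : Fin m → E n → ℂ) (x : E n) : ℂ :=
  ∫ y : Fin m → E n, fracIntegrand Ω α f x y

/-- `I_{Ω,α}(f)` converges absolutely almost everywhere with respect to `ν^q dx`, lies in
`L^q(ν^q)`, and its norm there is at most `B`. -/
def FracIntegralBound (Ω : (Fin m → E n) → ℂ) (α q : ℝ) (ω : Fin m → E n → ℝ≥0)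
    (f : Fin m → E n → ℂ) (B : ℝ≥0∞) : Prop :=
  (∀ᵐ x ∂(nuMeasure ω q), Integrable (fracIntegrand Ω α f x)) ∧
    MemLp (fracIntegral Ω α f) (ENNReal.ofReal q) (nuMeasure ω q) ∧
    eLpNorm (fracIntegral Ω α f) (ENNReal.ofReal q) (nuMeasure ω q) ≤ B

/-- The identification of `ℝ^{m × n}` with `(ℝⁿ)^m`. -/
def unflatten (z : EuclideanSpace ℝ (Fin m × Fin n)) : Fin m → E n :=
  fun i => WithLp.toLp 2 fun j => z (i, j)

/-- The restriction of `Ω` to the unit sphere `S^{mn-1}` of `(ℝⁿ)^m`. -/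
def jointTrace (Ω : (Fin m → E n) → ℂ)
    (θ : Metric.sphere (0 : EuclideanSpace ℝ (Fin m × Fin n)) 1) : ℂ :=
  Ω (unflatten (θ : EuclideanSpace ℝ (Fin m × Fin n)))

/-- The restriction of `Ω` to the product of spheres `(S^{n-1})^m`. -/
def productTrace (Ω : (Fin m → E n) → ℂ) (θ : Fin m → Metric.sphere (0 : E n) 1) : ℂ :=
  Ω fun i => (θ i : E n)

/-- `Ω` is jointly homogeneous of degree zero and lies in `L^s(S^{mn-1})` (surface measure),
with norm `N`. -/
def IsJointKernel (Ω : (Fin m → E n) → ℂ) (s N : ℝ≥0∞) : Prop :=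
  (∀ c : ℝ, 0 < c → ∀ y : Fin m → E n, Ω (fun i => c • y i) = Ω y) ∧
    MemLp (jointTrace Ω) s
      (volume : Measure (EuclideanSpace ℝ (Fin m × Fin n))).toSphere ∧
    N = eLpNorm (jointTrace Ω) s
      (volume : Measure (EuclideanSpace ℝ (Fin m × Fin n))).toSphere

/-- `Ω` is homogeneous of degree zero in each of its `m` variables and lies in
`L^s((S^{n-1})^m)` (product of the surface measures), with norm `N`. -/
def IsProductKernel (Ω : (Fin m → E n) → ℂ) (s N : ℝ≥0∞) : Prop :=
  (∀ c : Fin m → ℝ, (∀ i, 0 < c i) → ∀ y : Fin m → E n, Ω (fun i => c i • y i) = Ω y) ∧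
    MemLp (productTrace Ω) s
      (Measure.pi fun _ : Fin m => (volume : Measure (E n)).toSphere) ∧
    N = eLpNorm (productTrace Ω) s
      (Measure.pi fun _ : Fin m => (volume : Measure (E n)).toSphere)

/-- `γ` is an admissible power in the weighted inequality for the multilinear fractional maximal
operator of order `β`:
`‖M_β(f)‖_{L^q(ν^q)} ≤ C [ω]_{A_(P,q)}^γ ∏ ‖fᵢ‖_{L^{Pᵢ}(ωᵢ^{Pᵢ})}`
for all `ω ∈ A_(P,q)` and all `f`, with `C` independent of `ω` and `f`. -/
def MaximalPower (n : ℕ) (P : Fin m → ℝ) (β q γ : ℝ) : Prop :=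
  ∃ C : ℝ≥0, ∀ ω : Fin m → E n → ℝ≥0, (∀ i, AEMeasurable (ω i)) → InApq P q (wpow ω 1) →
    ∀ f : Fin m → E n → ℂ, MemWeighted P ω f →
      eLpNorm (fracMaximal β f) (ENNReal.ofReal q) (nuMeasure ω q) ≤
        C * apqConst P q (wpow ω 1) ^ γ * prodNorm P ω f

/-- The lower bound `mp / (q (mp - 1)) · (1 - β/(mn))`. -/
def lowerPower (m n : ℕ) (p q β : ℝ) : ℝ :=
  m * p / (q * (m * p - 1)) * (1 - β / (m * n))

/-- The upper bound `(1/q) (1 - β/(mn)) max {P₁', …, P_m'}`. -/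
def upperPower (n : ℕ) (P : Fin m → ℝ) (q β : ℝ) : ℝ :=
  1 / q * (1 - β / (m * n)) * ⨆ i, (P i).conjExponent

end RoughFractional

end

open RoughFractional

/-! The fractional integral is controlled pointwise by two fractional maximal functions; the rest is
a weighted theory of those maximal functions.

Welland's inequality (`exists_welland`). Cut (ℝⁿ)^m into shells |y| ~ e^k. On a ball of radius r the
L^s norm of Ω is at most a constant times ‖Ω‖ r^(mn/s) (`exists_kernelBound`), so Hölder with
exponents s, s' bounds the k-th shell both by e^(-kε) times a maximal function of |f|^s' of order
s'(α+ε) and by e^(kε) times one of order s'(α-ε), each to the power 1/s'. Using the better bound for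
each k and summing gives the geometric mean of the two (`tsum_le_sqrt_mul`). Since 1/q is the
average of 1/q_ε and 1/q_{-ε}, Hölder turns this into a norm inequality (`lintegral_geom_mean_le`,
`exists_fracIntegralBound`). Passing to ω^s', P/s', κ/s' reduces the weighted bounds to s' = 1.

Upper bounds for the maximal function. Each cube lies in a comparable cell of one of 2^n shifted
dyadic grids, and by monotone convergence finite families of cells suffice. Cells whose normalized
integrals grow by a factor 2^m form a sparse family: half of each is free of smaller members, and
these free parts, the cores, are disjoint (`Laminar.exists_sparse`). The norm becomes a sum over
sparse cells. One inequality per cell brings in the weight characteristic, Hölder for sums separates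
the m functions, and the Carleson embedding theorem estimates each resulting sum. With dual weight
masses of whole cells as coefficients, the packing condition is supplied by the A_∞ constants and
the result is the mixed bound (`DualWeights.mixed_bound_finset`). With masses of cores the packing
is trivial, at the price of a higher power of the characteristic; balancing the exponents gives the
power with max p_i' (`DualWeights.upper_bound_finset`, `FracExponents.exists_split`).

Lower bound (`lowerPower_le`). Take power weights whose dual weights are all |x|^(η-n), and test on
that same function cut off to the unit ball. As η tends to 0 both sides grow like powers of 1/η, and
comparing the exponents bounds every admissible power from below. For equal p_i one has mp = r, and
the upper and lower bounds coincide. -/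

noncomputable section

/-! ### Laminar families and the selection of principal members. -/

namespace RoughFractional

/-- Every finite subset of a partial order has a subset on which no element is `r`-dominated by a
larger one, and such that every other element is `r`-dominated by a larger selected one. -/
theorem exists_principal {α : Type*} [PartialOrder α] (r : α → α → Prop) (F : Finset α) :
    ∃ S ⊆ F, (∀ Q ∈ S, ∀ R ∈ S, Q < R → ¬ r Q R) ∧
      ∀ Q ∈ F, Q ∈ S ∨ ∃ R ∈ S, Q < R ∧ r Q R := by
  classical
  induction F using Finset.strongInduction with
  | H F IH =>
    rcases F.eq_empty_or_nonempty with rfl | hne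
    · exact ⟨∅, by simp, by simp, by simp⟩
    obtain ⟨Q₀, hQ₀⟩ := F.exists_minimal hne
    obtain ⟨S, hSF, h1, h2⟩ := IH (F.erase Q₀) (Finset.erase_ssubset hQ₀.1)
    have hSF' : S ⊆ F := hSF.trans (Finset.erase_subset _ _)
    -- The removed element is minimal, so putting it back never creates a pair in which it is the
    -- larger member.
    have hmin : ∀ R ∈ F, ¬ R < Q₀ := fun R hR hlt => hQ₀.not_lt hR hlt
    by_cases h : ∃ R ∈ S, Q₀ < R ∧ r Q₀ R
    · refine ⟨S, hSF', h1, fun Q hQ => ?_⟩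
      by_cases hQQ : Q = Q₀
      · subst hQQ; exact Or.inr h
      · exact h2 Q (Finset.mem_erase.2 ⟨hQQ, hQ⟩)
    · refine ⟨insert Q₀ S, Finset.insert_subset hQ₀.1 hSF', ?_, fun Q hQ => ?_⟩
      · intro Q hQ R hR hlt hr
        rcases Finset.mem_insert.1 hR with hR1 | hR1 <;> rcases Finset.mem_insert.1 hQ with hQ1 | hQ1
        · exact absurd (hQ1.trans hR1.symm) hlt.ne
        · exact hmin Q (hSF' hQ1) (hR1 ▸ hlt)
        · exact h ⟨R, hR1, hQ1 ▸ hlt, hQ1 ▸ hr⟩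
        · exact h1 Q hQ1 R hR1 hlt hr
      · by_cases hQQ : Q = Q₀
        · subst hQQ; exact Or.inl (Finset.mem_insert_self _ _)
        · rcases h2 Q (Finset.mem_erase.2 ⟨hQQ, hQ⟩) with h3 | ⟨R, hR, h3⟩
          · exact Or.inl (Finset.mem_insert_of_mem h3)
          · exact Or.inr ⟨R, Finset.mem_insert_of_mem hR, h3⟩

/-- A family of sets any two of which are nested or disjoint. -/
def Laminar {X : Type*} (F : Set (Set X)) : Prop :=
  ∀ Q ∈ F, ∀ R ∈ F, Q ⊆ R ∨ R ⊆ Q ∨ Disjoint Q R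

theorem Laminar.mono {X : Type*} {F G : Set (Set X)} (hG : Laminar G) (h : F ⊆ G) : Laminar F :=
  fun Q hQ R hR => hG Q (h hQ) R (h hR)

/-- The maximal members do this: two nested ones would be equal. -/
theorem Laminar.exists_disjoint_cover {X : Type*} {T : Finset (Set X)}
    (hT : Laminar (T : Set (Set X))) :
    ∃ T' ⊆ T, (T' : Set (Set X)).PairwiseDisjoint id ∧ ∀ Q ∈ T, ∃ R ∈ T', Q ⊆ R := by
  classical
  refine ⟨T.filter fun Q => Maximal (· ∈ T) Q, Finset.filter_subset _ _, ?_, fun Q hQ => ?_⟩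
  · intro Q hQ R hR hne
    have hQ' := (Finset.mem_filter.1 hQ)
    have hR' := (Finset.mem_filter.1 hR)
    rcases hT Q hQ'.1 R hR'.1 with h | h | h
    · exact absurd (hQ'.2.eq_of_le hR'.1 h) hne
    · exact absurd (hR'.2.eq_of_le hQ'.1 h).symm hne
    · exact h
  · obtain ⟨R, hQR, hR⟩ := T.exists_le_maximal hQ
    exact ⟨R, Finset.mem_filter.2 ⟨hR.1, hR⟩, hQR⟩

/-- Hölder's inequality for finite sums of products. -/
theorem sum_prod_rpow_le {α ι : Type*} (T : Finset α) (s : Finset ι) (f : ι → α → ℝ≥0∞)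
    {p : ι → ℝ} (hp : ∑ i ∈ s, p i = 1) (hp0 : ∀ i ∈ s, 0 ≤ p i) :
    ∑ a ∈ T, ∏ i ∈ s, f i a ^ p i ≤ ∏ i ∈ s, (∑ a ∈ T, f i a) ^ p i := by
  -- The sum is an integral against a sum of Dirac masses, and the discrete σ-algebra removes
  -- measurability questions.
  let _ : MeasurableSpace α := ⊤
  have h := ENNReal.lintegral_prod_norm_pow_le (μ := ∑ a ∈ T, Measure.dirac a) s (f := f)
    (fun i _ => measurable_from_top.aemeasurable) hp hp0
  simpa [lintegral_finsetSum_measure] using h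

/-- The part of `R` not covered by smaller members of `S`. -/
def core {X : Type*} (S : Finset (Set X)) (R : Set X) : Set X :=
  R \ ⋃ Q ∈ S, ⋃ _ : Q ⊂ R, Q

theorem core_subset {X : Type*} (S : Finset (Set X)) (R : Set X) : core S R ⊆ R :=
  Set.sdiff_subset

theorem measurableSet_core {X : Type*} [MeasurableSpace X] {S : Finset (Set X)}
    (hS : ∀ Q ∈ S, MeasurableSet Q) {R : Set X} (hR : R ∈ S) : MeasurableSet (core S R) :=
  (hS R hR).diff (Finset.measurableSet_biUnion S fun Q hQ => MeasurableSet.iUnion fun _ => hS Q hQ)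

theorem Laminar.core_disjoint {X : Type*} {S : Finset (Set X)} (hS : Laminar (S : Set (Set X))) :
    (S : Set (Set X)).PairwiseDisjoint (core S) := by
  intro Q hQ R hR hne
  rw [Function.onFun, Set.disjoint_left]
  rintro x ⟨hxQ, hxQ'⟩ ⟨hxR, hxR'⟩
  simp only [Set.mem_iUnion, not_exists] at hxQ' hxR'
  rcases hS Q hQ R hR with h | h | h
  · exact hxR' Q hQ (h.ssubset_of_ne hne) hxQ
  · exact hxQ' R hR (h.ssubset_of_ne hne.symm) hxR
  · exact Set.disjoint_left.1 h hxQ hxR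

/-! ### Sparseness of families with growing normalized integrals. -/

section Sparse
variable {X : Type*} [MeasurableSpace X] {μ : Measure X} {ι : Type*} [Fintype ι]

/-- The product of the normalized integrals over a set. -/
def setValue (μ : Measure X) (θ : ℝ) (f : ι → X → ℝ≥0∞) (Q : Set X) : ℝ≥0∞ :=
  ∏ i, (∫⁻ y in Q, f i y ∂μ) / μ Q ^ θ

theorem sum_setLIntegral_le {T : Finset (Set X)} (hT : (T : Set (Set X)).PairwiseDisjoint id)
    (hm : ∀ Q ∈ T, MeasurableSet Q) {R : Set X} (hTR : ∀ Q ∈ T, Q ⊆ R) (f : X → ℝ≥0∞) :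
    ∑ Q ∈ T, ∫⁻ y in Q, f y ∂μ ≤ ∫⁻ y in R, f y ∂μ := by
  refine (lintegral_biUnion_finset (t := id) hT hm f).symm.le.trans ?_
  exact lintegral_mono_set (Set.iUnion₂_subset hTR)

/-- The root collects the m denominators into a single μ(Q)^θ and leaves a geometric mean of
integrals, to which Hölder for sums applies with all exponents 1/m. -/
theorem setValue_rpow [Nonempty ι] {θ : ℝ} (hθ : 0 < θ) (f : ι → X → ℝ≥0∞) (Q : Set X) :
    setValue μ θ f Q ^ (1 / (Fintype.card ι : ℝ)) =
      (∏ i, (∫⁻ y in Q, f i y ∂μ) ^ (1 / (Fintype.card ι : ℝ))) / μ Q ^ θ := by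
  have hc : (0 : ℝ) < Fintype.card ι := by exact_mod_cast Fintype.card_pos
  rw [setValue, ← ENNReal.prod_rpow_of_nonneg (by positivity)]
  simp_rw [div_eq_mul_inv, ENNReal.mul_rpow_of_nonneg _ _ (show (0:ℝ) ≤ 1 * (Fintype.card ι : ℝ)⁻¹ by positivity)]
  rw [Finset.prod_mul_distrib]
  congr 1
  rw [Finset.prod_const, ← ENNReal.rpow_neg, ← ENNReal.rpow_natCast, ← ENNReal.rpow_mul,
    ← ENNReal.rpow_mul]
  congr 1
  simp only [Finset.card_univ]
  field_simp

/-- If the normalized integrals grow by the factor `2 ^ m` along the members of a finite laminar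
family, then at least half of each member is not covered by the smaller members. -/
theorem Laminar.measure_le_two_mul_core [Nonempty ι] {S : Finset (Set X)}
    (hS : Laminar (S : Set (Set X)))
    (hm : ∀ Q ∈ S, MeasurableSet Q) (h0 : ∀ Q ∈ S, μ Q ≠ 0) (ht : ∀ Q ∈ S, μ Q ≠ ∞)
    {θ : ℝ} (hθ : 0 < θ) (hθ1 : θ ≤ 1) (f : ι → X → ℝ≥0∞)
    (hgrow : ∀ Q ∈ S, ∀ R ∈ S, Q ⊂ R → 2 ^ Fintype.card ι * setValue μ θ f R < setValue μ θ f Q)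
    {R : Set X} (hR : R ∈ S) : μ R ≤ 2 * μ (core S R) := by
  classical
  have hc : (0 : ℝ) < Fintype.card ι := by exact_mod_cast Fintype.card_pos
  set c : ℝ := 1 / (Fintype.card ι : ℝ) with hcdef
  have hc0 : 0 < c := by positivity
  have hlam : Laminar ((S.filter (· ⊂ R) : Finset (Set X)) : Set (Set X)) :=
    hS.mono (by intro Q hQ; exact (Finset.mem_filter.1 hQ).1)
  -- Only the maximal members strictly inside R matter: they are disjoint and cover everything that
  -- `core` removes.
  obtain ⟨T, hTS, hTd, hTc⟩ := hlam.exists_disjoint_cover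
  have hT : ∀ Q ∈ T, Q ∈ S ∧ Q ⊂ R := fun Q hQ => Finset.mem_filter.1 (hTS hQ)
  set U := ⋃ Q ∈ S, ⋃ _ : Q ⊂ R, Q
  have hUT : μ U ≤ ∑ Q ∈ T, μ Q := by
    refine (measure_mono ?_).trans (measure_biUnion_finset_le T id)
    refine Set.iUnion₂_subset fun Q hQ => Set.iUnion_subset fun hQR => ?_
    obtain ⟨R', hR', h⟩ := hTc Q (Finset.mem_filter.2 ⟨hQ, hQR⟩)
    exact h.trans (Set.subset_biUnion_of_mem (u := id) hR')
  set G := ∏ i, (∫⁻ y in R, f i y ∂μ) ^ c with hG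
  -- The m-th root of the growth condition has (μ Q / μ R)^θ here; it only decreases when θ ≤ 1 is
  -- replaced by 1. Summing over the disjoint Q and applying Hölder then compares 2 G Σ μ Q / μ R
  -- with G.
  have hpt : ∀ Q ∈ T, 2 * G * (μ Q / μ R) ≤ ∏ i, (∫⁻ y in Q, f i y ∂μ) ^ c := by
    intro Q hQ
    obtain ⟨hQS, hQR⟩ := hT Q hQ
    have h1 := ENNReal.rpow_le_rpow (hgrow Q hQS R hR hQR).le hc0.le
    rw [ENNReal.mul_rpow_of_nonneg _ _ hc0.le, setValue_rpow hθ f R,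
      setValue_rpow hθ f Q, ← ENNReal.rpow_natCast, ← ENNReal.rpow_mul] at h1
    have h2 : (Fintype.card ι : ℝ) * c = 1 := by rw [hcdef]; field_simp
    rw [h2, ENNReal.rpow_one] at h1
    have hQθ0 : μ Q ^ θ ≠ 0 := by simp [ENNReal.rpow_eq_zero_iff, h0 Q hQS, ht Q hQS]
    have hQθt : μ Q ^ θ ≠ ∞ := by simp [ENNReal.rpow_eq_top_iff, h0 Q hQS, ht Q hQS]
    have h3 := mul_le_mul_left h1 (μ Q ^ θ)
    rw [ENNReal.div_mul_cancel hQθ0 hQθt] at h3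
    refine le_trans ?_ h3
    rw [mul_assoc, mul_assoc]
    refine mul_le_mul_right ?_ 2
    rw [← hG, div_eq_mul_inv G, mul_assoc]
    refine mul_le_mul_right ?_ G
    rw [ENNReal.div_eq_inv_mul, ← ENNReal.rpow_neg_one, ← ENNReal.rpow_neg]
    have e1 : μ R ^ (-1:ℝ) = μ R ^ (-θ) * μ R ^ (θ - 1) := by
      rw [← ENNReal.rpow_add _ _ (h0 R hR) (ht R hR)]; ring_nf
    have e2 : μ Q ^ θ = μ Q ^ (θ - 1) * μ Q := by
      nth_rw 3 [← ENNReal.rpow_one (μ Q)]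
      rw [← ENNReal.rpow_add _ _ (h0 Q hQS) (ht Q hQS)]; ring_nf
    rw [e1, e2, mul_assoc]
    refine mul_le_mul_right (mul_le_mul_left ?_ _) _
    rw [show θ - 1 = -(1 - θ) by ring, ENNReal.rpow_neg, ENNReal.rpow_neg]
    exact ENNReal.inv_le_inv.2 (ENNReal.rpow_le_rpow (measure_mono hQR.subset) (by linarith))
  have hsum : 2 * G * ((∑ Q ∈ T, μ Q) / μ R) ≤ G := by
    rw [ENNReal.div_eq_inv_mul, Finset.mul_sum, Finset.mul_sum]
    calc _ ≤ ∑ Q ∈ T, ∏ i, (∫⁻ y in Q, f i y ∂μ) ^ c := by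
          refine Finset.sum_le_sum fun Q hQ => ?_
          rw [← ENNReal.div_eq_inv_mul]; exact hpt Q hQ
      _ ≤ ∏ i, (∑ Q ∈ T, ∫⁻ y in Q, f i y ∂μ) ^ c :=
          sum_prod_rpow_le T Finset.univ (fun i Q => ∫⁻ y in Q, f i y ∂μ)
            (by simp [hcdef]) (fun _ _ => hc0.le)
      _ ≤ G := by
          refine Finset.prod_le_prod' fun i _ => ?_
          gcongr
          exact sum_setLIntegral_le hTd (fun Q hQ => hm Q (hT Q hQ).1)
            (fun Q hQ => (hT Q hQ).2.subset) _
  have hhalf : 2 * (∑ Q ∈ T, μ Q) ≤ μ R := by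
    rcases T.eq_empty_or_nonempty with rfl | ⟨Q, hQ⟩
    · simp
    have hlt := hgrow Q (hT Q hQ).1 R hR (hT Q hQ).2
    have hθR0 : μ R ^ θ ≠ 0 := by simp [ENNReal.rpow_eq_zero_iff, h0 R hR, ht R hR]
    have hθRt : μ R ^ θ ≠ ∞ := by simp [ENNReal.rpow_eq_top_iff, h0 R hR, ht R hR]
    -- Cancelling G needs it nonzero and finite. Both follow from the strictness of the growth
    -- inequality at any single member of T.
    have hG0 : G ≠ 0 := by
      intro h
      rw [hG, Finset.prod_eq_zero_iff] at h
      obtain ⟨i, -, hi⟩ := h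
      have hi0 : ∫⁻ y in R, f i y ∂μ = 0 := by
        simpa [ENNReal.rpow_eq_zero_iff, hc0, hc0.not_gt] using hi
      have : setValue μ θ f Q = 0 := by
        refine Finset.prod_eq_zero (Finset.mem_univ i) ?_
        have : ∫⁻ y in Q, f i y ∂μ = 0 :=
          le_antisymm ((lintegral_mono_set (hT Q hQ).2.subset).trans hi0.le) (zero_le)
        simp [this]
      rw [this] at hlt
      exact not_lt_zero hlt
    have hGt : G ≠ ∞ := by
      intro h
      have h1 := setValue_rpow (μ := μ) hθ f R
      rw [← hcdef, ← hG, h, ENNReal.top_div_of_ne_top hθRt, ENNReal.rpow_eq_top_iff_of_pos hc0] at h1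
      rw [h1, ENNReal.mul_top (by positivity)] at hlt
      exact not_top_lt hlt
    have h4 : G * (2 * ((∑ Q ∈ T, μ Q) / μ R)) ≤ G * 1 := by
      rw [mul_one]; refine le_trans (le_of_eq ?_) hsum; ring
    have h5 := (ENNReal.mul_le_mul_iff_right hG0 hGt).1 h4
    rw [← mul_div_assoc] at h5
    rwa [ENNReal.div_le_iff (h0 R hR) (ht R hR), one_mul] at h5
  have hR2 : μ R ≤ μ (core S R) + μ U := by
    refine (measure_mono ?_).trans (measure_union_le _ _)
    intro x hx
    by_cases hxU : x ∈ U
    · exact Or.inr hxU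
    · exact Or.inl ⟨hx, hxU⟩
  have h6 : μ R + μ R ≤ 2 * μ (core S R) + μ R := by
    calc μ R + μ R = 2 * μ R := (two_mul _).symm
      _ ≤ 2 * (μ (core S R) + μ U) := by gcongr
      _ = 2 * μ (core S R) + 2 * μ U := mul_add _ _ _
      _ ≤ _ := by gcongr; exact (mul_le_mul_right hUT 2).trans hhalf
  exact (ENNReal.add_le_add_iff_right (ht R hR)).1 h6

end Sparse

/-! ### The layer cake formula and the Carleson embedding theorem. -/

theorem lintegral_Ioo_rpow {p : ℝ} (hp : 0 < p) {y : ℝ} (hy : 0 ≤ y) :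
    ∫⁻ t in Set.Ioo 0 y, ENNReal.ofReal (p * t ^ (p - 1)) = ENNReal.ofReal (y ^ p) := by
  have hint : IntervalIntegrable (fun t : ℝ => p * t ^ (p - 1)) volume 0 y :=
    (intervalIntegral.intervalIntegrable_rpow' (by linarith)).const_mul p
  rw [← ofReal_integral_eq_lintegral_ofReal, ← integral_Ioc_eq_integral_Ioo,
    ← intervalIntegral.integral_of_le hy, intervalIntegral.integral_const_mul,
    integral_rpow (Or.inl (by linarith)), sub_add_cancel, Real.zero_rpow hp.ne']
  · congr 1; field_simp; ring
  · exact ((intervalIntegrable_iff_integrableOn_Ioo_of_le hy).1 hint)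
  · refine (ae_restrict_iff' measurableSet_Ioo).2 (.of_forall fun t ht => ?_)
    have := Real.rpow_nonneg ht.1.le (p - 1)
    simp only [Pi.zero_apply]; positivity

/-- Layer cake representation of a power. The inequality for finite levels below x is isolated
first, because it also settles x = ∞ by letting the level grow. -/
theorem rpow_eq_lintegral_indicator {p : ℝ} (hp : 0 < p) (x : ℝ≥0∞) :
    x ^ p = ∫⁻ t in Set.Ioi (0 : ℝ), ENNReal.ofReal (p * t ^ (p - 1)) *
      Set.indicator {t : ℝ | ENNReal.ofReal t < x} 1 t := by
  have key : ∀ y : ℝ, 0 ≤ y → ENNReal.ofReal y ≤ x → ENNReal.ofReal (y ^ p) ≤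
      ∫⁻ t in Set.Ioi (0 : ℝ), ENNReal.ofReal (p * t ^ (p - 1)) *
        Set.indicator {t : ℝ | ENNReal.ofReal t < x} 1 t := by
    intro y hy hyx
    rw [← lintegral_Ioo_rpow hp hy, ← lintegral_indicator measurableSet_Ioo,
      ← lintegral_indicator measurableSet_Ioi]
    refine lintegral_mono fun t => ?_
    by_cases ht : t ∈ Set.Ioo 0 y
    · have h1 : ENNReal.ofReal t < x :=
        ((ENNReal.ofReal_lt_ofReal_iff (ht.1.trans ht.2)).2 ht.2).trans_le hyx
      rw [Set.indicator_of_mem ht, Set.indicator_of_mem (show t ∈ Set.Ioi (0:ℝ) from ht.1),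
        Set.indicator_of_mem (show t ∈ {t : ℝ | ENNReal.ofReal t < x} from h1)]
      simp
    · rw [Set.indicator_of_notMem ht]; exact zero_le
  rcases eq_or_ne x ∞ with rfl | hx
  · rw [ENNReal.top_rpow_of_pos hp]
    refine (ENNReal.eq_top_of_forall_nnreal_le fun r => ?_).symm
    refine le_trans (le_of_eq ?_) (key ((r : ℝ) ^ (1 / p)) (by positivity) le_top)
    rw [← Real.rpow_mul r.coe_nonneg, one_div_mul_cancel hp.ne', Real.rpow_one, ENNReal.ofReal_coe_nnreal]
  · obtain ⟨y, rfl⟩ : ∃ y : ℝ≥0, x = y := ⟨x.toNNReal, (ENNReal.coe_toNNReal hx).symm⟩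
    have hy : ((y : ℝ≥0∞)) ^ p = ENNReal.ofReal ((y : ℝ) ^ p) := by
      rw [← ENNReal.ofReal_rpow_of_nonneg y.coe_nonneg hp.le, ENNReal.ofReal_coe_nnreal]
    rw [hy]
    refine le_antisymm (key y y.coe_nonneg (by simp)) ?_
    rw [← lintegral_Ioo_rpow hp y.coe_nonneg, ← lintegral_indicator measurableSet_Ioo,
      ← lintegral_indicator measurableSet_Ioi]
    refine lintegral_mono fun t => ?_
    by_cases ht : 0 < t
    · rw [Set.indicator_of_mem (show t ∈ Set.Ioi (0:ℝ) from ht)]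
      by_cases hty : ENNReal.ofReal t < y
      · have : t < y := by
          rw [← ENNReal.ofReal_coe_nnreal] at hty
          exact (ENNReal.ofReal_lt_ofReal_iff_of_nonneg ht.le).1 hty
        rw [Set.indicator_of_mem (show t ∈ Set.Ioo 0 (y:ℝ) from ⟨ht, this⟩)]
        exact mul_le_of_le_one_right' (Set.indicator_le_self' (by simp) t)
      · rw [Set.indicator_of_notMem (show t ∉ {t : ℝ | ENNReal.ofReal t < y} from hty), mul_zero]
        exact zero_le
    · rw [Set.indicator_of_notMem (show t ∉ Set.Ioi (0:ℝ) from ht)]; exact zero_le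

section Carleson
variable {X : Type*} [MeasurableSpace X]

-- The weak-type half of the Carleson embedding. The sets with average above t lie under disjoint
-- maximal ones R, and packing reduces the sum to Λ Σ σ(R). On each R, t σ(R) ≤ ∫_R g; discarding
-- the part of g below t/2 costs at most t σ(R)/2, which is absorbed.
open Classical in
theorem Laminar.sum_lt_average_le {σ : Measure X} {F : Finset (Set X)}
    (hF : Laminar (F : Set (Set X)))
    (hm : ∀ Q ∈ F, MeasurableSet Q) (hfin : ∀ Q ∈ F, σ Q ≠ ∞) {a : Set X → ℝ≥0∞} {Λ : ℝ≥0∞}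
    (hcar : ∀ R ∈ F, ∑ Q ∈ F with Q ⊆ R, a Q ≤ Λ * σ R)
    {g : X → ℝ≥0∞} {t : ℝ≥0∞} (ht0 : t ≠ 0) (ht : t ≠ ∞) :
    ∑ Q ∈ F with t < (σ Q)⁻¹ * ∫⁻ y in Q, g y ∂σ, a Q ≤
      Λ * (2 / t * ∫⁻ y, Set.indicator {y | t < 2 * g y} g y ∂σ) := by
  classical
  set T := F.filter fun Q => t < (σ Q)⁻¹ * ∫⁻ y in Q, g y ∂σ
  have hlam : Laminar (T : Set (Set X)) := hF.mono (by intro Q hQ; exact (Finset.mem_filter.1 hQ).1)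
  obtain ⟨T', hTT, hTd, hTc⟩ := hlam.exists_disjoint_cover
  have hT : ∀ Q ∈ T', Q ∈ F ∧ t < (σ Q)⁻¹ * ∫⁻ y in Q, g y ∂σ :=
    fun Q hQ => Finset.mem_filter.1 (hTT hQ)
  have h1 : ∑ Q ∈ T, a Q ≤ ∑ R ∈ T', ∑ Q ∈ F with Q ⊆ R, a Q := by
    simp_rw [Finset.sum_filter]
    rw [Finset.sum_comm]
    refine (Finset.sum_le_sum fun Q hQ => ?_).trans
      (Finset.sum_le_sum_of_subset (Finset.filter_subset _ _))
    obtain ⟨R, hR, hQR⟩ := hTc Q hQ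
    exact (le_of_eq (if_pos hQR).symm).trans
      (Finset.single_le_sum (f := fun R => if Q ⊆ R then a Q else 0) (fun _ _ => zero_le) hR)
  set h : X → ℝ≥0∞ := Set.indicator {y | t < 2 * g y} g
  have h2 : ∀ R ∈ T', σ R ≤ 2 / t * ∫⁻ y in R, h y ∂σ := by
    intro R hR
    obtain ⟨hRF, htR⟩ := hT R hR
    have hσ0 : σ R ≠ 0 := by
      intro h0
      rw [setLIntegral_measure_zero R g h0, mul_zero] at htR
      exact not_lt_zero htR
    have h3 : t * σ R ≤ ∫⁻ y in R, g y ∂σ := by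
      have := mul_le_mul_left htR.le (σ R)
      rwa [mul_right_comm, ENNReal.inv_mul_cancel hσ0 (hfin R hRF), one_mul] at this
    have h4 : ∫⁻ y in R, g y ∂σ ≤ (∫⁻ y in R, h y ∂σ) + t / 2 * σ R := by
      rw [← setLIntegral_const, ← lintegral_add_right _ measurable_const]
      refine lintegral_mono fun y => ?_
      by_cases hy : t < 2 * g y
      · simp only [h, Set.indicator_of_mem (show y ∈ {y | t < 2 * g y} from hy)]
        exact le_self_add
      · refine le_add_left ?_
        rw [ENNReal.le_div_iff_mul_le (by simp) (by simp), mul_comm]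
        exact not_lt.1 hy
    have h5 : t / 2 * σ R ≤ ∫⁻ y in R, h y ∂σ := by
      have e : t * σ R = t / 2 * σ R + t / 2 * σ R := by rw [← add_mul, ENNReal.add_halves]
      rw [e] at h3
      exact (ENNReal.add_le_add_iff_right (ENNReal.mul_ne_top (ENNReal.div_ne_top ht (by simp))
        (hfin R hRF))).1 (h3.trans h4)
    calc σ R = 2 / t * (t / 2 * σ R) := by
          rw [← mul_assoc, ← mul_div_assoc, ENNReal.div_mul_cancel ht0 ht,
            ENNReal.div_self (by simp) (by simp), one_mul]
      _ ≤ _ := by gcongr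
  calc ∑ Q ∈ T, a Q ≤ ∑ R ∈ T', Λ * σ R :=
        h1.trans (Finset.sum_le_sum fun R hR => hcar R (hT R hR).1)
    _ ≤ ∑ R ∈ T', Λ * (2 / t * ∫⁻ y in R, h y ∂σ) :=
        Finset.sum_le_sum fun R hR => mul_le_mul_right (h2 R hR) Λ
    _ = Λ * (2 / t * ∑ R ∈ T', ∫⁻ y in R, h y ∂σ) := by rw [Finset.mul_sum, Finset.mul_sum]
    _ ≤ Λ * (2 / t * ∫⁻ y, h y ∂σ) := by
        gcongr
        refine (sum_setLIntegral_le hTd (fun Q hQ => hm Q (hT Q hQ).1)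
            (fun Q _ => Set.subset_univ Q) _).trans ?_
        rw [setLIntegral_univ]

open Classical in
/-- The Carleson embedding theorem for a finite laminar family. -/
theorem Laminar.carleson_embedding {σ : Measure X} [SFinite σ] {F : Finset (Set X)}
    (hF : Laminar (F : Set (Set X)))
    (hm : ∀ Q ∈ F, MeasurableSet Q) (hfin : ∀ Q ∈ F, σ Q ≠ ∞) {a : Set X → ℝ≥0∞} {Λ : ℝ≥0∞}
    (hcar : ∀ R ∈ F, ∑ Q ∈ F with Q ⊆ R, a Q ≤ Λ * σ R)
    {g : X → ℝ≥0∞} (hg : AEMeasurable g σ) {p : ℝ} (hp : 1 < p) :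
    ∑ Q ∈ F, a Q * ((σ Q)⁻¹ * ∫⁻ y in Q, g y ∂σ) ^ p ≤
      ENNReal.ofReal (p / (p - 1) * 2 ^ p) * Λ * ∫⁻ y, g y ^ p ∂σ := by
  classical
  -- Tonelli below needs joint measurability in the level and the point, so g is replaced by a
  -- measurable representative.
  wlog hgm : Measurable g generalizing g with H
  · have := H hg.measurable_mk.aemeasurable hg.measurable_mk
    have e1 : ∀ Q, ∫⁻ y in Q, g y ∂σ = ∫⁻ y in Q, hg.mk g y ∂σ := fun Q =>
      lintegral_congr_ae (ae_restrict_of_ae hg.ae_eq_mk)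
    have e2 : ∫⁻ y, g y ^ p ∂σ = ∫⁻ y, hg.mk g y ^ p ∂σ :=
      lintegral_congr_ae (hg.ae_eq_mk.mono fun y hy => by simp only [hy])
    simpa only [e1, e2] using this
  have hp0 : 0 < p := by linarith
  set x : Set X → ℝ≥0∞ := fun Q => (σ Q)⁻¹ * ∫⁻ y in Q, g y ∂σ
  have hmeas : ∀ z : ℝ≥0∞, Measurable fun t : ℝ =>
      Set.indicator {t : ℝ | ENNReal.ofReal t < z} (1 : ℝ → ℝ≥0∞) t := fun z =>
    measurable_one.indicator (measurableSet_lt ENNReal.measurable_ofReal measurable_const)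
  have hw : ∀ r : ℝ, Measurable fun t : ℝ => ENNReal.ofReal (r * t ^ (r - 1)) := fun r =>
    ENNReal.measurable_ofReal.comp ((measurable_id.pow_const _).const_mul r)
  have hwm : ∀ (r : ℝ) (z : ℝ≥0∞), Measurable fun t : ℝ => ENNReal.ofReal (r * t ^ (r - 1)) *
      Set.indicator {t : ℝ | ENNReal.ofReal t < z} 1 t := fun r z => (hw r).mul (hmeas z)
  calc ∑ Q ∈ F, a Q * x Q ^ p
      = ∫⁻ t in Set.Ioi (0 : ℝ), ENNReal.ofReal (p * t ^ (p - 1)) *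
          ∑ Q ∈ F with ENNReal.ofReal t < x Q, a Q := by
        simp_rw [rpow_eq_lintegral_indicator hp0 (x _), ← lintegral_const_mul _ (hwm p (x _))]
        rw [← lintegral_finsetSum _ fun Q _ => (hwm p (x Q)).const_mul _]
        refine lintegral_congr fun t => ?_
        rw [Finset.sum_filter, Finset.mul_sum]
        refine Finset.sum_congr rfl fun Q _ => ?_
        by_cases h : ENNReal.ofReal t < x Q
        · simp [h, mul_comm]
        · simp [h]
    -- The factor 2/t from the weak-type bound turns p t^(p-1) into 2p/(p-1) times the layer cake
    -- density of exponent p-1. After Tonelli the t-integral is (2g)^(p-1), which accounts for the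
    -- constant p/(p-1) · 2^p.
    _ ≤ ∫⁻ t in Set.Ioi (0 : ℝ), ∫⁻ y, Λ * ENNReal.ofReal (p / (p - 1) * 2) *
          (g y * (ENNReal.ofReal ((p - 1) * t ^ ((p - 1) - 1)) *
            Set.indicator {t : ℝ | ENNReal.ofReal t < 2 * g y} 1 t)) ∂σ := by
        refine setLIntegral_mono' measurableSet_Ioi fun t ht => ?_
        have ht0 : 0 < t := ht
        refine (mul_le_mul_right (hF.sum_lt_average_le hm hfin hcar (t := ENNReal.ofReal t)
          (by simpa using ht0) (by simp)) _).trans ?_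
        have hpos := Real.rpow_pos_of_pos ht0 (p - 1 - 1)
        have e : ENNReal.ofReal (p * t ^ (p - 1)) * (Λ * (2 / ENNReal.ofReal t *
            ∫⁻ y, Set.indicator {y | ENNReal.ofReal t < 2 * g y} g y ∂σ)) =
            (Λ * ENNReal.ofReal (p / (p - 1) * 2) * ENNReal.ofReal ((p - 1) * t ^ (p - 1 - 1))) *
            ∫⁻ y, Set.indicator {y | ENNReal.ofReal t < 2 * g y} g y ∂σ := by
          have e2 : (2 : ℝ≥0∞) / ENNReal.ofReal t = ENNReal.ofReal (2 / t) := by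
            rw [ENNReal.ofReal_div_of_pos ht0]; simp
          have e3 : ENNReal.ofReal (p * t ^ (p - 1)) * ENNReal.ofReal (2 / t) =
              ENNReal.ofReal (p / (p - 1) * 2) * ENNReal.ofReal ((p - 1) * t ^ (p - 1 - 1)) := by
            rw [← ENNReal.ofReal_mul (by positivity), ← ENNReal.ofReal_mul
              (mul_nonneg (div_nonneg hp0.le (by linarith)) (by norm_num))]
            congr 1
            rw [Real.rpow_sub_one ht0.ne' (p - 1)]
            have : p - 1 ≠ 0 := by linarith
            field_simp
          rw [e2, mul_left_comm, ← mul_assoc (ENNReal.ofReal (p * _)), e3]; ring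
        rw [e, ← lintegral_const_mul _ (hgm.indicator (measurableSet_lt measurable_const
          (hgm.const_mul 2)))]
        refine le_of_eq (lintegral_congr fun y => ?_)
        by_cases h : ENNReal.ofReal t < 2 * g y
        · simp [h]; ring
        · simp [h]
    _ = ∫⁻ y, Λ * ENNReal.ofReal (p / (p - 1) * 2) * (g y * (2 * g y) ^ (p - 1)) ∂σ := by
        rw [lintegral_lintegral_swap]
        · refine lintegral_congr fun y => ?_
          rw [rpow_eq_lintegral_indicator (sub_pos.2 hp),
            ← lintegral_const_mul _ (hwm (p - 1) _),
            ← lintegral_const_mul _ ((hwm (p - 1) _).const_mul _)]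
        · refine Measurable.aemeasurable ?_
          refine Measurable.const_mul (Measurable.mul (hgm.comp measurable_snd)
            (Measurable.mul ((hw (p - 1)).comp measurable_fst) ?_)) _
          exact (measurable_one.indicator (s := {z : ℝ × X | ENNReal.ofReal z.1 < 2 * g z.2})
            (measurableSet_lt (ENNReal.measurable_ofReal.comp measurable_fst)
              ((hgm.comp measurable_snd).const_mul 2)))
    _ = ENNReal.ofReal (p / (p - 1) * 2 ^ p) * Λ * ∫⁻ y, g y ^ p ∂σ := by
        rw [← lintegral_const_mul _ (hgm.pow_const p)]
        refine lintegral_congr fun y => ?_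
        have e1 : g y * g y ^ (p - 1) = g y ^ p := by
          have := ENNReal.rpow_add_of_nonneg (x := g y) 1 (p - 1) zero_le_one (by linarith)
          rw [ENNReal.rpow_one] at this
          rw [← this]; ring_nf
        have e2 : ENNReal.ofReal (p / (p - 1) * 2 ^ p) =
            ENNReal.ofReal (p / (p - 1) * 2) * 2 ^ (p - 1) := by
          have : (2 : ℝ≥0∞) ^ (p - 1) = ENNReal.ofReal (2 ^ (p - 1)) := by
            rw [← ENNReal.ofReal_rpow_of_pos (by norm_num)]; simp
          rw [this, ← ENNReal.ofReal_mul (mul_nonneg (div_nonneg hp0.le (by linarith)) (by norm_num)),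
            mul_assoc]
          congr 2
          rw [Real.rpow_sub_one (by norm_num)]; ring
        rw [ENNReal.mul_rpow_of_nonneg _ _ (by linarith), e2, ← e1]; ring

end Carleson
end RoughFractional

/-! ### Logarithmic coordinates and the inequalities for a single cube. -/

namespace RoughFractional

/-- The exponential with values in `[0, ∞]`. -/
def eexp (c : ℝ) : ℝ≥0∞ := ENNReal.ofReal (Real.exp c)

theorem eexp_ne_zero (c : ℝ) : eexp c ≠ 0 := by simp [eexp, Real.exp_pos]
theorem eexp_ne_top (c : ℝ) : eexp c ≠ ∞ := ENNReal.ofReal_ne_top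
theorem eexp_zero : eexp 0 = 1 := by simp [eexp]
theorem eexp_add (a b : ℝ) : eexp (a + b) = eexp a * eexp b := by
  rw [eexp, Real.exp_add, ENNReal.ofReal_mul (Real.exp_pos a).le]; rfl
theorem eexp_rpow (a r : ℝ) : eexp a ^ r = eexp (a * r) := by
  rw [eexp, ENNReal.ofReal_rpow_of_pos (Real.exp_pos a), ← Real.exp_mul]; rfl
theorem eexp_neg (a : ℝ) : eexp (-a) = (eexp a)⁻¹ := by
  rw [← ENNReal.rpow_neg_one, eexp_rpow, mul_neg_one]
theorem eexp_sub (a b : ℝ) : eexp (a - b) = eexp a / eexp b := by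
  rw [sub_eq_add_neg, eexp_add, eexp_neg, div_eq_mul_inv]
theorem eexp_sum {ι : Type*} (s : Finset ι) (c : ι → ℝ) :
    eexp (∑ i ∈ s, c i) = ∏ i ∈ s, eexp (c i) := by
  classical
  induction s using Finset.induction_on with
  | empty => simp [eexp_zero]
  | insert a s ha ih => rw [Finset.sum_insert ha, Finset.prod_insert ha, eexp_add, ih]
theorem eexp_le_eexp {a b : ℝ} : eexp a ≤ eexp b ↔ a ≤ b := by
  rw [eexp, eexp, ENNReal.ofReal_le_ofReal_iff (Real.exp_pos b).le, Real.exp_le_exp]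
-- In these coordinates inequalities between products of powers of positive finite quantities become
-- linear inequalities between real numbers.
theorem exists_eexp {y : ℝ≥0∞} (h0 : y ≠ 0) (ht : y ≠ ∞) : ∃ c, y = eexp c :=
  ⟨Real.log y.toReal, by
    rw [eexp, Real.exp_log (ENNReal.toReal_pos h0 ht), ENNReal.ofReal_toReal ht]⟩

theorem sum_rpow_le_rpow_sum {α : Type*} (T : Finset α) (f : α → ℝ≥0∞) {t : ℝ} (ht : 1 ≤ t) :
    ∑ a ∈ T, f a ^ t ≤ (∑ a ∈ T, f a) ^ t := by
  classical
  induction T using Finset.induction_on with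
  | empty => simp
  | insert a s ha ih =>
    rw [Finset.sum_insert ha, Finset.sum_insert ha]
    exact (add_le_add le_rfl ih).trans (ENNReal.add_rpow_le_rpow_add _ _ ht)

/-- Normalize the exponents to total 1, use superadditivity of x ↦ x^t for t ≥ 1 with t the original
total, and apply Hölder. -/
theorem sum_prod_rpow_le_of_one_le {α ι : Type*} (T : Finset α) (s : Finset ι)
    (f : ι → α → ℝ≥0∞) {p : ι → ℝ} (hp : 1 ≤ ∑ i ∈ s, p i) (hp0 : ∀ i ∈ s, 0 ≤ p i) :
    ∑ a ∈ T, ∏ i ∈ s, f i a ^ p i ≤ ∏ i ∈ s, (∑ a ∈ T, f i a) ^ p i := by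
  set t := ∑ i ∈ s, p i
  have ht : 0 < t := by linarith
  have e : ∀ g : ι → ℝ≥0∞, ∏ i ∈ s, g i ^ p i = (∏ i ∈ s, g i ^ (p i / t)) ^ t := fun g => by
    rw [← ENNReal.prod_rpow_of_nonneg ht.le]
    refine Finset.prod_congr rfl fun i _ => ?_
    rw [← ENNReal.rpow_mul, div_mul_cancel₀ _ ht.ne']
  simp_rw [e]
  refine (sum_rpow_le_rpow_sum T _ hp).trans (ENNReal.rpow_le_rpow ?_ ht.le)
  refine sum_prod_rpow_le T s f ?_ fun i hi => div_nonneg (hp0 i hi) ht.le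
  rw [← Finset.sum_div, div_self ht.ne']

section Cube
variable {ι : Type*} [Fintype ι]

/-- Here U = u(Q), v = |Q|, s_i = w_i(Q) and z_i = ∫_Q f_i. For z = s the two sides agree once K is
replaced by the characteristic of Q, because `hθ` balances the powers of v. The averages z_i / s_i
then factor out of both sides. -/
theorem mixed_cube_bound {p : ι → ℝ} (hp : ∀ i, 0 < p i) {κ θ : ℝ} (hκ : 0 < κ)
    (hθ : Fintype.card ι * θ = 1 / κ + ∑ i, (1 - 1 / p i))
    {U v K : ℝ≥0∞} {s : ι → ℝ≥0∞} (z : ι → ℝ≥0∞) (hU : U ≠ 0) (hU' : U ≠ ∞)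
    (hv : v ≠ 0) (hv' : v ≠ ∞) (hs : ∀ i, s i ≠ 0) (hs' : ∀ i, s i ≠ ∞)
    (hK : U / v * ∏ i, (s i / v) ^ (κ * (1 - 1 / p i)) ≤ K) :
    (∏ i, z i / v ^ θ) ^ κ * U ≤ K * ∏ i, (s i * ((s i)⁻¹ * z i) ^ p i) ^ (κ / p i) := by
  have key : (∏ i, s i / v ^ θ) ^ κ * U ≤ K * ∏ i, s i ^ (κ / p i) := by
    obtain ⟨U, rfl⟩ := exists_eexp hU hU'
    obtain ⟨v, rfl⟩ := exists_eexp hv hv'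
    choose s hs using fun i => exists_eexp (hs i) (hs' i)
    simp_rw [hs] at hK ⊢
    refine le_trans ?_ (mul_le_mul_left hK _)
    simp_rw [eexp_rpow, ← eexp_sub, eexp_rpow, ← eexp_sum, eexp_rpow, ← eexp_add]
    rw [eexp_le_eexp]
    refine le_of_eq ?_
    simp only [Finset.sum_sub_distrib, Finset.sum_const, Finset.card_univ, nsmul_eq_mul,
      sub_mul, mul_sub, mul_one]
    simp only [Finset.sum_sub_distrib, Finset.sum_const, Finset.card_univ, nsmul_eq_mul,
      mul_one] at hθ
    have h1 : ∑ i, v * (κ * (1 / p i)) = v * κ * ∑ i, 1 / p i := by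
      rw [Finset.mul_sum]; exact Finset.sum_congr rfl fun i _ => by ring
    have h2 : ∑ i, s i * (κ / p i) = ∑ i, s i * (κ * (1 / p i)) :=
      Finset.sum_congr rfl fun i _ => by ring
    rw [h1, h2, ← Finset.sum_mul]
    have h3 : (Fintype.card ι * (v * θ)) * κ = v * κ * (1 / κ + (Fintype.card ι - ∑ i, 1 / p i)) := by
      rw [← hθ]; ring
    rw [h3]
    field_simp
    ring
  have e1 : ∀ i, z i = ((s i)⁻¹ * z i) * s i := fun i => by
    rw [mul_right_comm, ENNReal.inv_mul_cancel (hs i) (hs' i), one_mul]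
  calc (∏ i, z i / v ^ θ) ^ κ * U
      = (∏ i, ((s i)⁻¹ * z i)) ^ κ * ((∏ i, s i / v ^ θ) ^ κ * U) := by
        rw [← mul_assoc, ← ENNReal.mul_rpow_of_nonneg _ _ hκ.le, ← Finset.prod_mul_distrib]
        congr 2
        refine Finset.prod_congr rfl fun i _ => ?_
        rw [← mul_div_assoc, ← e1]
    _ ≤ (∏ i, ((s i)⁻¹ * z i)) ^ κ * (K * ∏ i, s i ^ (κ / p i)) := by gcongr
    _ = _ := by
        rw [mul_left_comm, ← ENNReal.prod_rpow_of_nonneg hκ.le, ← Finset.prod_mul_distrib]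
        congr 1
        refine Finset.prod_congr rfl fun i _ => ?_
        have := (div_pos hκ (hp i)).le
        rw [ENNReal.mul_rpow_of_nonneg _ _ this, ← ENNReal.rpow_mul, mul_div_cancel₀ _ (hp i).ne',
          mul_comm]

/-- Here w, u' and e_i are the measure, the u-mass and the w_i-masses of the core of Q, and the
other letters are as in `mixed_cube_bound`. Insert the characteristic to the power L. What is left
over are powers of U and s_i with nonnegative exponents, by `hL` and `hLq`, so these masses may be
lowered to those of the core. The resulting combination is controlled by `hH`, the Hölder inequality
on the core, raised to κ(L - 1), and v ≤ 2w costs the power of 2 in the constant. -/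
theorem upper_cube_bound {p q : ι → ℝ} (hq : ∀ i, 0 < q i) {κ θ L : ℝ}
    (hκ : 0 < κ) (hθ : Fintype.card ι * θ = 1 / κ + ∑ i, (1 - 1 / p i))
    (hqκ : ∑ i, 1 / q i = 1 / κ) (hL : 1 ≤ L)
    (hLq : ∀ i, 1 - 1 / p i + 1 / q i ≤ L * (1 - 1 / p i))
    {U v K w u' : ℝ≥0∞} {s e : ι → ℝ≥0∞} (z : ι → ℝ≥0∞) (hU : U ≠ 0) (hU' : U ≠ ∞)
    (hv : v ≠ 0) (hv' : v ≠ ∞) (hs : ∀ i, s i ≠ 0) (hs' : ∀ i, s i ≠ ∞)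
    (hu : u' ≠ 0) (he : ∀ i, e i ≠ 0) (hu' : u' ≤ U) (hes : ∀ i, e i ≤ s i)
    (hK : U / v * ∏ i, (s i / v) ^ (κ * (1 - 1 / p i)) ≤ K)
    (hw : v ≤ 2 * w)
    (hH : w ^ (Fintype.card ι * θ) ≤ u' ^ (1 / κ) * ∏ i, e i ^ (1 - 1 / p i)) :
    (∏ i, z i / v ^ θ) ^ κ * U ≤ eexp ((L - 1) * (κ * (Fintype.card ι * θ) * Real.log 2)) * K ^ L *
      ∏ i, (e i * (z i / s i ^ (1 - 1 / p i + 1 / q i)) ^ q i) ^ (κ / q i) := by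
  have hτ : 0 ≤ Fintype.card ι * θ := by
    rw [hθ]
    have : 0 ≤ ∑ i, (1 - 1 / p i) := Finset.sum_nonneg fun i _ => by
      have h1 := hLq i
      have h2 : 0 < 1 / q i := one_div_pos.2 (hq i)
      by_contra h3
      nlinarith
    positivity
  set τ := Fintype.card ι * θ with hτdef
  have h2 : (2 : ℝ≥0∞) = eexp (Real.log 2) := by
    rw [eexp, Real.exp_log (by norm_num)]; simp
  have key : (∏ i, s i ^ (1 - 1 / p i + 1 / q i) / v ^ θ) ^ κ * U ≤
      eexp ((L - 1) * (κ * τ * Real.log 2)) * K ^ L * ∏ i, e i ^ (κ / q i) := by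
    have hv2 : v ^ τ ≤ 2 ^ τ * (u' ^ (1 / κ) * ∏ i, e i ^ (1 - 1 / p i)) :=
      (ENNReal.rpow_le_rpow hw hτ).trans (by
        rw [ENNReal.mul_rpow_of_nonneg _ _ hτ]; gcongr)
    have he' : ∀ i, e i ≠ ∞ := fun i => ne_top_of_le_ne_top (hs' i) (hes i)
    obtain ⟨u', rfl⟩ := exists_eexp hu (ne_top_of_le_ne_top hU' hu')
    obtain ⟨U, rfl⟩ := exists_eexp hU hU'
    obtain ⟨v, rfl⟩ := exists_eexp hv hv'
    choose s hs using fun i => exists_eexp (hs i) (hs' i)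
    choose e he using fun i => exists_eexp (he i) (he' i)
    simp_rw [he, hs, eexp_le_eexp] at hes
    rw [eexp_le_eexp] at hu'
    simp_rw [hs] at hK ⊢
    simp_rw [he, h2] at hv2 ⊢
    refine le_trans ?_ (mul_le_mul_left (mul_le_mul_right (ENNReal.rpow_le_rpow hK
      (by linarith)) _) _)
    simp_rw [eexp_rpow, ← eexp_sub, eexp_rpow, ← eexp_sum, eexp_rpow, ← eexp_add] at hv2 ⊢
    rw [eexp_rpow, ← eexp_add, ← eexp_add, eexp_le_eexp]
    rw [eexp_le_eexp] at hv2
    -- The lowering from s_i to e_i in logarithmic form; `hLq` is exactly nonnegativity of the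
    -- coefficients.
    have hsum : ∑ i, (L * (1 - 1 / p i) - (1 - 1 / p i + 1 / q i)) * (e i - v) ≤
        ∑ i, (L * (1 - 1 / p i) - (1 - 1 / p i + 1 / q i)) * (s i - v) :=
      Finset.sum_le_sum fun i _ => mul_le_mul_of_nonneg_left (by linarith [hes i])
        (by linarith [hLq i])
    have hl1 : 0 ≤ (L - 1) * (U - u') := mul_nonneg (by linarith) (by linarith)
    have hl2 := mul_le_mul_of_nonneg_left hv2 (mul_nonneg (sub_nonneg.2 hL) hκ.le)
    have hvs : v * τ = v * (1 / κ) + ∑ i, v * (1 - 1 / p i) := by rw [hθ, mul_add, Finset.mul_sum]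
    have hvq : ∑ i, v * (1 / q i) = v * (1 / κ) := by rw [← Finset.mul_sum, hqκ]
    set A := ∑ i, s i * (1 - 1 / p i) with hA
    set A' := ∑ i, s i * (1 / q i) with hA'
    set B := ∑ i, e i * (1 - 1 / p i) with hB
    set B' := ∑ i, e i * (1 / q i) with hB'
    set D := ∑ i, v * (1 - 1 / p i) with hD
    set D' := ∑ i, v * (1 / q i) with hD'
    have t1 : ∀ c : ι → ℝ, ∑ i, (L * (1 - 1 / p i) - (1 - 1 / p i + 1 / q i)) * (c i - v) =
        (L - 1) * ∑ i, c i * (1 - 1 / p i) - ∑ i, c i * (1 / q i) - ((L - 1) * D - D') := by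
      intro c
      rw [hD, hD', Finset.mul_sum, Finset.mul_sum, ← Finset.sum_sub_distrib,
        ← Finset.sum_sub_distrib, ← Finset.sum_sub_distrib]
      exact Finset.sum_congr rfl fun i _ => by ring
    rw [t1, t1, ← hA, ← hA', ← hB, ← hB'] at hsum
    have t2 : ∑ i, (s i * (1 - 1 / p i + 1 / q i) - v * θ) = A + A' - v * τ := by
      rw [Finset.sum_sub_distrib, hA, hA', ← Finset.sum_add_distrib]
      simp only [mul_add, Finset.sum_const, Finset.card_univ, nsmul_eq_mul, hτdef]
      ring
    have t3 : ∑ i, (s i - v) * (κ * (1 - 1 / p i)) = κ * (A - D) := by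
      rw [hA, hD, ← Finset.sum_sub_distrib, Finset.mul_sum]
      exact Finset.sum_congr rfl fun i _ => by ring
    have t4 : ∑ i, e i * (κ / q i) = κ * B' := by
      rw [hB', Finset.mul_sum]
      exact Finset.sum_congr rfl fun i _ => by ring
    rw [t2, t3, t4]
    rw [hvs] at hl2 ⊢
    rw [hvq] at hsum
    have hκκ : κ * (1 / κ) = 1 := by field_simp
    have hs2 := mul_le_mul_of_nonneg_left hsum hκ.le
    have x1 : (L - 1) * κ * (v * (1 / κ) + D) = (L - 1) * v * (κ * (1 / κ)) + (L - 1) * κ * D := by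
      ring
    have x2 : (L - 1) * κ * (Real.log 2 * τ + (u' * (1 / κ) + B)) =
      (L - 1) * (κ * τ * Real.log 2) + (L - 1) * u' * (κ * (1 / κ)) + (L - 1) * κ * B := by ring
    rw [x1, x2, hκκ] at hl2
    have x3 : κ * ((L - 1) * B - B' - ((L - 1) * D - v * (1 / κ))) =
      (L - 1) * κ * B - κ * B' - (L - 1) * κ * D + v * (κ * (1 / κ)) := by ring
    have x4 : κ * ((L - 1) * A - A' - ((L - 1) * D - v * (1 / κ))) =
      (L - 1) * κ * A - κ * A' - (L - 1) * κ * D + v * (κ * (1 / κ)) := by ring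
    rw [x3, x4, hκκ] at hs2
    have x5 : (A + A' - (v * (1 / κ) + D)) * κ = κ * A + κ * A' - v * (κ * (1 / κ)) - κ * D := by
      ring
    rw [x5, hκκ]
    nlinarith
  have hpow : ∀ i, s i ^ (1 - 1 / p i + 1 / q i) ≠ 0 ∧ s i ^ (1 - 1 / p i + 1 / q i) ≠ ∞ :=
    fun i => ⟨by simp [ENNReal.rpow_eq_zero_iff, hs i, hs' i],
      by simp [ENNReal.rpow_eq_top_iff, hs i, hs' i]⟩
  have e1 : ∀ i, z i = (z i / s i ^ (1 - 1 / p i + 1 / q i)) * s i ^ (1 - 1 / p i + 1 / q i) :=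
    fun i => (ENNReal.div_mul_cancel (hpow i).1 (hpow i).2).symm
  calc (∏ i, z i / v ^ θ) ^ κ * U
      = (∏ i, (z i / s i ^ (1 - 1 / p i + 1 / q i))) ^ κ *
          ((∏ i, s i ^ (1 - 1 / p i + 1 / q i) / v ^ θ) ^ κ * U) := by
        rw [← mul_assoc, ← ENNReal.mul_rpow_of_nonneg _ _ hκ.le, ← Finset.prod_mul_distrib]
        congr 2
        refine Finset.prod_congr rfl fun i _ => ?_
        rw [← mul_div_assoc, ← e1]
    _ ≤ (∏ i, (z i / s i ^ (1 - 1 / p i + 1 / q i))) ^ κ *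
          (eexp ((L - 1) * (κ * τ * Real.log 2)) * K ^ L * ∏ i, e i ^ (κ / q i)) := by gcongr
    _ = _ := by
        rw [mul_left_comm, ← ENNReal.prod_rpow_of_nonneg hκ.le, ← Finset.prod_mul_distrib]
        congr 1
        refine Finset.prod_congr rfl fun i _ => ?_
        have := (div_pos hκ (hq i)).le
        rw [ENNReal.mul_rpow_of_nonneg _ _ this, ← ENNReal.rpow_mul, mul_div_cancel₀ _ (hq i).ne',
          mul_comm]

end Cube
end RoughFractional

/-! ### Weighted Carleson embedding and bounds for finite families. -/

namespace RoughFractional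

section Weighted
variable {X : Type*} [MeasurableSpace X] {μ : Measure X}

-- This is the embedding theorem for the measure w dμ applied to f / w, since (f/w)^p w = f^p
-- w^(1-p) almost everywhere.
open Classical in
theorem Laminar.carleson_embedding_weight [SFinite μ] {F : Finset (Set X)}
    (hF : Laminar (F : Set (Set X))) (hm : ∀ Q ∈ F, MeasurableSet Q) {w f : X → ℝ≥0∞}
    (hw : AEMeasurable w μ) (hw0 : ∀ᵐ x ∂μ, w x ≠ 0) (hwt : ∀ᵐ x ∂μ, w x ≠ ∞)
    (hf : AEMeasurable f μ) (hfin : ∀ Q ∈ F, ∫⁻ y in Q, w y ∂μ ≠ ∞)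
    {a : Set X → ℝ≥0∞} {Λ : ℝ≥0∞}
    (hcar : ∀ R ∈ F, ∑ Q ∈ F with Q ⊆ R, a Q ≤ Λ * ∫⁻ y in R, w y ∂μ) {p : ℝ} (hp : 1 < p) :
    ∑ Q ∈ F, a Q * ((∫⁻ y in Q, w y ∂μ)⁻¹ * ∫⁻ y in Q, f y ∂μ) ^ p ≤
      ENNReal.ofReal (p / (p - 1) * 2 ^ p) * Λ * ∫⁻ y, f y ^ p * w y ^ (1 - p) ∂μ := by
  have hσ : ∀ Q ∈ F, μ.withDensity w Q = ∫⁻ y in Q, w y ∂μ := fun Q hQ =>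
    withDensity_apply _ (hm Q hQ)
  have hg : AEMeasurable (fun y => f y / w y) μ := hf.div hw
  have h1 : ∀ Q ∈ F, ∫⁻ y in Q, f y / w y ∂(μ.withDensity w) = ∫⁻ y in Q, f y ∂μ := by
    intro Q hQ
    rw [restrict_withDensity (hm Q hQ), lintegral_withDensity_eq_lintegral_mul₀ hw.restrict
      hg.restrict]
    refine lintegral_congr_ae (ae_restrict_of_ae ?_)
    filter_upwards [hw0, hwt] with y h0 ht
    simp only [Pi.mul_apply]
    exact ENNReal.mul_div_cancel h0 ht
  have h2 : ∫⁻ y, (f y / w y) ^ p ∂(μ.withDensity w) = ∫⁻ y, f y ^ p * w y ^ (1 - p) ∂μ := by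
    rw [lintegral_withDensity_eq_lintegral_mul₀ hw (hg.pow_const p)]
    refine lintegral_congr_ae ?_
    filter_upwards [hw0, hwt] with y h0 ht
    simp only [Pi.mul_apply]
    rw [ENNReal.div_rpow_of_nonneg _ _ (by linarith), mul_comm, div_eq_mul_inv, mul_assoc,
      ← ENNReal.rpow_neg]
    nth_rw 2 [← ENNReal.rpow_one (w y)]
    rw [← ENNReal.rpow_add _ _ h0 ht]
    ring_nf
  have := hF.carleson_embedding (σ := μ.withDensity w) hm (fun Q hQ => (hσ Q hQ).symm ▸ hfin Q hQ)
    (a := a) (Λ := Λ) (fun R hR => (hσ R hR).symm ▸ hcar R hR) (g := fun y => f y / w y)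
    (hg.mono_ac (withDensity_absolutelyContinuous _ _)) hp
  rw [h2] at this
  refine le_trans (le_of_eq (Finset.sum_congr rfl fun Q hQ => ?_)) this
  rw [hσ Q hQ, h1 Q hQ]

/-- Hölder for the factorization f = (f w^(-1/p')) · w^(1/p'). -/
theorem setLIntegral_le_weight {w f : X → ℝ≥0∞}
    (hw : AEMeasurable w μ) (hw0 : ∀ᵐ x ∂μ, w x ≠ 0) (hwt : ∀ᵐ x ∂μ, w x ≠ ∞)
    (hf : AEMeasurable f μ) {p : ℝ} (hp : 1 < p) (Q : Set X) :
    ∫⁻ y in Q, f y ∂μ ≤ (∫⁻ y, f y ^ p * w y ^ (1 - p) ∂μ) ^ (1 / p) *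
      (∫⁻ y in Q, w y ∂μ) ^ (1 - 1 / p) := by
  have hpq : p.HolderConjugate (Real.conjExponent p) := Real.HolderConjugate.conjExponent hp
  have hx : 1 / Real.conjExponent p = 1 - 1 / p := by
    have := hpq.inv_add_inv_eq_one
    simp only [one_div]; linarith
  have hxp : (1 - 1 / p) * p = p - 1 := by field_simp
  have hx0 : 0 < 1 - 1 / p := hx ▸ one_div_pos.2 hpq.symm.pos
  have h := ENNReal.lintegral_mul_le_Lp_mul_Lq (μ.restrict Q) hpq
    (f := fun y => f y * w y ^ (-(1 - 1 / p))) (g := fun y => w y ^ (1 - 1 / p))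
    (hf.mul (hw.pow_const _)).restrict (hw.pow_const _).restrict
  have e1 : ∫⁻ y in Q, f y ∂μ = ∫⁻ y in Q, ((fun y => f y * w y ^ (-(1 - 1 / p))) *
      fun y => w y ^ (1 - 1 / p)) y ∂μ := by
    refine lintegral_congr_ae (ae_restrict_of_ae ?_)
    filter_upwards [hw0, hwt] with y h0 ht
    simp only [Pi.mul_apply]
    rw [mul_assoc, ← ENNReal.rpow_add _ _ h0 ht, neg_add_cancel, ENNReal.rpow_zero, mul_one]
  have e2 : ∀ y, (w y ^ (1 - 1 / p)) ^ (Real.conjExponent p) = w y := fun y => by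
    rw [← hx, ← ENNReal.rpow_mul, one_div, inv_mul_cancel₀ hpq.symm.ne_zero, ENNReal.rpow_one]
  have e3 : ∀ y, (f y * w y ^ (-(1 - 1 / p))) ^ p = f y ^ p * w y ^ (1 - p) := fun y => by
    rw [ENNReal.mul_rpow_of_nonneg _ _ (by linarith), ← ENNReal.rpow_mul, neg_mul, hxp, neg_sub]
  rw [← e1] at h
  simp only [e2, e3, hx] at h
  refine h.trans ?_
  gcongr
  exact Measure.restrict_le_self

variable {ι : Type*} [Fintype ι]

/-- The maximal function of the family `F`. -/
def familyMax (μ : Measure X) (θ : ℝ) (f : ι → X → ℝ≥0∞) (F : Set (Set X)) (x : X) : ℝ≥0∞ :=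
  ⨆ Q ∈ F, Q.indicator (fun _ => setValue μ θ f Q) x

/-- Take the principal members with respect to domination up to the factor 2^m. Every discarded set
lies in a selected one of comparable value, so the maximal function is at most 2^m times the largest
selected value and its κ-th power is bounded by a sum; the selected sets grow by more than 2^m
inward, which forces sparseness. The selection depends on neither u nor κ. -/
theorem Laminar.exists_sparse [Nonempty ι] {F : Finset (Set X)}
    (hF : Laminar (F : Set (Set X))) (hm : ∀ Q ∈ F, MeasurableSet Q) (h0 : ∀ Q ∈ F, μ Q ≠ 0)
    (ht : ∀ Q ∈ F, μ Q ≠ ∞) {θ : ℝ} (hθ : 0 < θ) (hθ1 : θ ≤ 1) (f : ι → X → ℝ≥0∞) :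
    ∃ S ⊆ F, (∀ R ∈ S, μ R ≤ 2 * μ (core S R)) ∧
      ∀ (κ : ℝ) (u : X → ℝ≥0∞), 0 < κ → AEMeasurable u μ →
        ∫⁻ x, familyMax μ θ f F x ^ κ * u x ∂μ ≤
          (2 ^ Fintype.card ι) ^ κ * ∑ R ∈ S, setValue μ θ f R ^ κ * ∫⁻ y in R, u y ∂μ := by
  obtain ⟨S, hSF, h1, h2⟩ := exists_principal
    (fun Q R => setValue μ θ f Q ≤ 2 ^ Fintype.card ι * setValue μ θ f R) F
  refine ⟨S, hSF, fun R hR => ?_, fun κ u hκ hu => ?_⟩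
  · exact (hF.mono (Finset.coe_subset.2 hSF)).measure_le_two_mul_core (fun Q hQ => hm Q (hSF hQ))
      (fun Q hQ => h0 Q (hSF hQ)) (fun Q hQ => ht Q (hSF hQ)) hθ hθ1 f
      (fun Q hQ R hR hlt => not_le.1 (h1 Q hQ R hR hlt)) hR
  · have hpt : ∀ x, familyMax μ θ f F x ^ κ ≤
        ∑ R ∈ S, R.indicator (fun _ => (2 ^ Fintype.card ι * setValue μ θ f R) ^ κ) x := by
      intro x
      rw [familyMax, ← ENNReal.orderIsoRpow_apply κ hκ]
      simp_rw [OrderIso.map_iSup]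
      refine iSup₂_le fun Q hQ => ?_
      rw [ENNReal.orderIsoRpow_apply]
      by_cases hx : x ∈ Q
      · rw [Set.indicator_of_mem hx]
        obtain ⟨R, hR, hxR, hle⟩ : ∃ R ∈ S, x ∈ R ∧
            setValue μ θ f Q ≤ 2 ^ Fintype.card ι * setValue μ θ f R := by
          rcases h2 Q hQ with h | ⟨R, hR, hlt, hle⟩
          · exact ⟨Q, h, hx, le_mul_of_one_le_left' (one_le_pow₀ (by norm_num))⟩
          · exact ⟨R, hR, hlt.1 hx, hle⟩
        refine le_trans ?_ (Finset.single_le_sum (f := fun R : Set X =>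
          R.indicator (fun _ => (2 ^ Fintype.card ι * setValue μ θ f R) ^ κ) x)
          (fun _ _ => zero_le) hR)
        simp only [Set.indicator_of_mem hxR]
        gcongr
      · rw [Set.indicator_of_notMem hx, ENNReal.zero_rpow_of_pos hκ]
        exact zero_le
    calc ∫⁻ x, familyMax μ θ f F x ^ κ * u x ∂μ
        ≤ ∫⁻ x, ∑ R ∈ S, (2 ^ Fintype.card ι * setValue μ θ f R) ^ κ * R.indicator u x ∂μ := by
          refine lintegral_mono fun x => (mul_le_mul_left (hpt x) _).trans (le_of_eq ?_)
          rw [Finset.sum_mul]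
          refine Finset.sum_congr rfl fun R _ => ?_
          by_cases hx : x ∈ R <;> simp [hx]
      _ = _ := by
          rw [lintegral_finsetSum' _ fun R hR => (hu.indicator (hm R (hSF hR))).const_mul _,
            Finset.mul_sum]
          refine Finset.sum_congr rfl fun R hR => ?_
          rw [lintegral_const_mul'' _ (hu.indicator (hm R (hSF hR))),
            lintegral_indicator (hm R (hSF hR)), ENNReal.mul_rpow_of_nonneg _ _ hκ.le, mul_assoc]

theorem setLIntegral_ne_zero_of_ae {u : X → ℝ≥0∞} (hu : AEMeasurable u μ)
    (hu0 : ∀ᵐ x ∂μ, u x ≠ 0) {A : Set X} (hA : μ A ≠ 0) : ∫⁻ y in A, u y ∂μ ≠ 0 := by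
  intro h
  rw [lintegral_eq_zero_iff' hu.restrict] at h
  have h2 : ∀ᵐ _ ∂μ.restrict A, False := by
    filter_upwards [h, ae_restrict_of_ae hu0] with y hy1 hy2 using hy2 hy1
  rw [ae_iff] at h2
  simp [hA] at h2

/-- A weight `u` with weights `wᵢ` satisfying the duality relation `u^(1/κ) ∏ wᵢ^(1/pᵢ') = 1`. -/
structure DualWeights (μ : Measure X) (p : ι → ℝ) (κ : ℝ) (u : X → ℝ≥0∞) (w : ι → X → ℝ≥0∞) :
    Prop where
  one_lt : ∀ i, 1 < p i
  pos : 0 < κ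
  aemeasurable_u : AEMeasurable u μ
  aemeasurable_w : ∀ i, AEMeasurable (w i) μ
  u_ne_zero : ∀ᵐ x ∂μ, u x ≠ 0
  w_ne_zero : ∀ i, ∀ᵐ x ∂μ, w i x ≠ 0
  w_ne_top : ∀ i, ∀ᵐ x ∂μ, w i x ≠ ∞
  dual : ∀ᵐ x ∂μ, u x ^ (1 / κ) * ∏ i, w i x ^ (1 - 1 / p i) = 1

/-- The set `Q` is nondegenerate for the weights, with characteristic at most `K`. -/
structure GoodSet (μ : Measure X) (p : ι → ℝ) (κ : ℝ) (u : X → ℝ≥0∞) (w : ι → X → ℝ≥0∞)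
    (K : ℝ≥0∞) (Q : Set X) : Prop where
  measurable : MeasurableSet Q
  ne_zero : μ Q ≠ 0
  ne_top : μ Q ≠ ∞
  u_ne_top : ∫⁻ y in Q, u y ∂μ ≠ ∞
  w_ne_top : ∀ i, ∫⁻ y in Q, w i y ∂μ ≠ ∞
  bound : (∫⁻ y in Q, u y ∂μ) / μ Q * ∏ i, ((∫⁻ y in Q, w i y ∂μ) / μ Q) ^ (κ * (1 - 1 / p i)) ≤ K

variable {p : ι → ℝ} {κ θ : ℝ} {u : X → ℝ≥0∞} {w : ι → X → ℝ≥0∞} {K : ℝ≥0∞}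

/-- Hölder applied to the duality relation: the function 1 is a product of powers of u and the w_i,
and division by τ = mθ makes the exponents sum to 1. -/
theorem DualWeights.measure_rpow_le (h : DualWeights μ p κ u w)
    (hθ : Fintype.card ι * θ = 1 / κ + ∑ i, (1 - 1 / p i)) (A : Set X) :
    μ A ^ (Fintype.card ι * θ) ≤
      (∫⁻ y in A, u y ∂μ) ^ (1 / κ) * ∏ i, (∫⁻ y in A, w i y ∂μ) ^ (1 - 1 / p i) := by
  have hκ := h.pos
  have hx : ∀ i, 0 < 1 - 1 / p i := fun i => by
    have := h.one_lt i
    rw [sub_pos, div_lt_one (by linarith)]; exact this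
  set τ := Fintype.card ι * θ
  have hτ : 0 < τ := by
    have : 0 ≤ ∑ i, (1 - 1 / p i) := Finset.sum_nonneg fun i _ => (hx i).le
    rw [hθ]; positivity
  let F : Option ι → X → ℝ≥0∞ := fun o => o.elim u w
  let P : Option ι → ℝ := fun o => o.elim (1 / κ / τ) fun i => (1 - 1 / p i) / τ
  have hH := ENNReal.lintegral_prod_norm_pow_le (μ := μ.restrict A) Finset.univ (f := F)
    (fun o _ => by cases o; exacts [h.aemeasurable_u.restrict, (h.aemeasurable_w _).restrict])
    (p := P) (by
      simp only [P, Fintype.sum_option, Option.elim]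
      rw [← Finset.sum_div, ← add_div, ← hθ, div_self hτ.ne'])
    (fun o _ => by cases o <;> simp only [P, Option.elim] <;> [positivity; exact (div_pos (hx _) hτ).le])
  simp only [Fintype.prod_option, F, P, Option.elim] at hH
  have h1 : ∫⁻ y in A, u y ^ (1 / κ / τ) * ∏ i, w i y ^ ((1 - 1 / p i) / τ) ∂μ = μ A := by
    rw [← setLIntegral_one]
    refine lintegral_congr_ae (ae_restrict_of_ae ?_)
    filter_upwards [h.dual] with y hy
    simp_rw [div_eq_mul_inv _ τ, ENNReal.rpow_mul]
    rw [ENNReal.prod_rpow_of_nonneg (by positivity), ← ENNReal.mul_rpow_of_nonneg _ _ (by positivity),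
      hy, ENNReal.one_rpow]
  rw [h1] at hH
  refine (ENNReal.rpow_le_rpow hH hτ.le).trans (le_of_eq ?_)
  rw [ENNReal.mul_rpow_of_nonneg _ _ hτ.le, ← ENNReal.rpow_mul, div_mul_cancel₀ _ hτ.ne',
    ← ENNReal.prod_rpow_of_nonneg hτ.le]
  congr 1
  refine Finset.prod_congr rfl fun i _ => ?_
  rw [← ENNReal.rpow_mul, div_mul_cancel₀ _ hτ.ne']

/-- After sparse domination and `mixed_cube_bound`, the sum of products splits because Σ κ/p_i ≥ 1.
Each factor is a Carleson sum with coefficients w_i(Q). Their packing constant is 2 A_i: by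
sparseness w_i(Q) is at most twice the average of w_i on Q times the measure of the core, the
average is at most N on the core, and the cores inside R are disjoint. -/
theorem DualWeights.mixed_bound_finset [Nonempty ι] [SFinite μ] (h : DualWeights μ p κ u w)
    (hθ0 : 0 < θ) (hθ1 : θ ≤ 1)
    (hθ : Fintype.card ι * θ = 1 / κ + ∑ i, (1 - 1 / p i)) (hpκ : 1 / κ ≤ ∑ i, 1 / p i)
    {F : Finset (Set X)} (hF : Laminar (F : Set (Set X)))
    (hgood : ∀ Q ∈ F, GoodSet μ p κ u w K Q) {A : ι → ℝ≥0∞}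
    (hA : ∀ i, ∀ R ∈ F, ∃ N : X → ℝ≥0∞, (∀ Q ∈ F, Q ⊆ R → ∀ x ∈ Q,
      (∫⁻ y in Q, w i y ∂μ) / μ Q ≤ N x) ∧ ∫⁻ x in R, N x ∂μ ≤ A i * ∫⁻ y in R, w i y ∂μ)
    {f : ι → X → ℝ≥0∞} (hf : ∀ i, AEMeasurable (f i) μ) :
    ∫⁻ x, familyMax μ θ f F x ^ κ * u x ∂μ ≤ (2 ^ Fintype.card ι) ^ κ * (K *
      ∏ i, (ENNReal.ofReal (p i / (p i - 1) * 2 ^ p i) * (2 * A i) *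
        ∫⁻ y, f i y ^ p i * w i y ^ (1 - p i) ∂μ) ^ (κ / p i)) := by
  classical
  have hκ := h.pos
  have hp0 : ∀ i, 0 < p i := fun i => zero_lt_one.trans (h.one_lt i)
  obtain ⟨S, hSF, hS, hbound⟩ := hF.exists_sparse (fun Q hQ => (hgood Q hQ).measurable)
    (fun Q hQ => (hgood Q hQ).ne_zero) (fun Q hQ => (hgood Q hQ).ne_top) hθ0 hθ1 f
  refine (hbound κ u hκ h.aemeasurable_u).trans (mul_le_mul_right ?_ _)
  have hlam : Laminar (S : Set (Set X)) := hF.mono (Finset.coe_subset.2 hSF)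
  have hmS : ∀ Q ∈ S, MeasurableSet Q := fun Q hQ => (hgood Q (hSF hQ)).measurable
  calc ∑ R ∈ S, setValue μ θ f R ^ κ * ∫⁻ y in R, u y ∂μ
      ≤ ∑ R ∈ S, K * ∏ i, ((∫⁻ y in R, w i y ∂μ) *
          ((∫⁻ y in R, w i y ∂μ)⁻¹ * ∫⁻ y in R, f i y ∂μ) ^ p i) ^ (κ / p i) := by
        refine Finset.sum_le_sum fun R hR => ?_
        have hg := hgood R (hSF hR)
        exact mixed_cube_bound hp0 hκ hθ _
          (setLIntegral_ne_zero_of_ae h.aemeasurable_u h.u_ne_zero hg.ne_zero) hg.u_ne_top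
          hg.ne_zero hg.ne_top
          (fun i => setLIntegral_ne_zero_of_ae (h.aemeasurable_w i) (h.w_ne_zero i) hg.ne_zero)
          hg.w_ne_top hg.bound
    _ ≤ K * ∏ i, (∑ R ∈ S, (∫⁻ y in R, w i y ∂μ) *
          ((∫⁻ y in R, w i y ∂μ)⁻¹ * ∫⁻ y in R, f i y ∂μ) ^ p i) ^ (κ / p i) := by
        rw [← Finset.mul_sum]
        gcongr
        refine sum_prod_rpow_le_of_one_le S Finset.univ (fun i R => (∫⁻ y in R, w i y ∂μ) *
          ((∫⁻ y in R, w i y ∂μ)⁻¹ * ∫⁻ y in R, f i y ∂μ) ^ p i) ?_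
          fun i _ => (div_pos hκ (hp0 i)).le
        have := mul_le_mul_of_nonneg_left hpκ hκ.le
        rw [Finset.mul_sum, mul_one_div_cancel hκ.ne'] at this
        simpa only [mul_one_div] using this
    _ ≤ _ := by
        gcongr with i
        · exact (div_pos hκ (hp0 i)).le
        refine hlam.carleson_embedding_weight hmS (h.aemeasurable_w i) (h.w_ne_zero i)
          (h.w_ne_top i) (hf i) (fun Q hQ => (hgood Q (hSF hQ)).w_ne_top i)
          (a := fun Q => ∫⁻ y in Q, w i y ∂μ) (Λ := 2 * A i) (fun R hR => ?_) (h.one_lt i)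
        obtain ⟨N, hN, hNA⟩ := hA i R (hSF hR)
        calc ∑ Q ∈ S with Q ⊆ R, ∫⁻ y in Q, w i y ∂μ
            ≤ ∑ Q ∈ S with Q ⊆ R, 2 * ∫⁻ x in core S Q, N x ∂μ := by
              refine Finset.sum_le_sum fun Q hQ => ?_
              obtain ⟨hQS, hQR⟩ := Finset.mem_filter.1 hQ
              have hg := hgood Q (hSF hQS)
              calc ∫⁻ y in Q, w i y ∂μ = (∫⁻ y in Q, w i y ∂μ) / μ Q * μ Q :=
                    (ENNReal.div_mul_cancel hg.ne_zero hg.ne_top).symm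
                _ ≤ (∫⁻ y in Q, w i y ∂μ) / μ Q * (2 * μ (core S Q)) := by
                    gcongr; exact hS Q hQS
                _ = 2 * ∫⁻ _ in core S Q, (∫⁻ y in Q, w i y ∂μ) / μ Q ∂μ := by
                    rw [setLIntegral_const]; ring
                _ ≤ _ := by
                    gcongr 2 * ?_
                    exact setLIntegral_mono' (measurableSet_core hmS hQS) fun x hx =>
                      hN Q (hSF hQS) hQR x (core_subset S Q hx)
          _ ≤ 2 * ∫⁻ x in R, N x ∂μ := by
              rw [← Finset.mul_sum]
              gcongr
              rw [← lintegral_biUnion_finset (fun Q hQ Q' hQ' hne => hlam.core_disjoint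
                (Finset.mem_filter.1 hQ).1 (Finset.mem_filter.1 hQ').1 hne)
                (fun Q hQ => measurableSet_core hmS (Finset.mem_filter.1 hQ).1)]
              exact lintegral_mono_set (Set.iUnion₂_subset fun Q hQ =>
                (core_subset S Q).trans (Finset.mem_filter.1 hQ).2)
          _ ≤ 2 * (A i * ∫⁻ y in R, w i y ∂μ) := by gcongr
          _ = _ := by rw [mul_assoc]

/-- A normalized integral of order `1/p - 1/q` is controlled by the average. -/
theorem fractional_average_le {p q : ℝ} (hp : 1 < p) (hpq : p ≤ q) {z s B : ℝ≥0∞} (hs : s ≠ 0)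
    (hs' : s ≠ ∞) (hz : z ≤ B ^ (1 / p) * s ^ (1 - 1 / p)) :
    (z / s ^ (1 - 1 / p + 1 / q)) ^ q ≤ B ^ (q / p - 1) * (s⁻¹ * z) ^ p := by
  have hp0 : 0 < p := by linarith
  have hq0 : 0 < q := by linarith
  obtain ⟨s, rfl⟩ := exists_eexp hs hs'
  have e1 : z ^ q = z ^ p * z ^ (q - p) := by
    rw [← ENNReal.rpow_add_of_nonneg _ _ hp0.le (by linarith)]; ring_nf
  calc (z / eexp s ^ (1 - 1 / p + 1 / q)) ^ q
      = z ^ p * z ^ (q - p) * eexp (-(s * (1 - 1 / p + 1 / q)) * q) := by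
        rw [eexp_rpow, div_eq_mul_inv, ← eexp_neg, ENNReal.mul_rpow_of_nonneg _ _ hq0.le, eexp_rpow,
          e1]
    _ ≤ z ^ p * (B ^ (1 / p) * eexp s ^ (1 - 1 / p)) ^ (q - p) *
          eexp (-(s * (1 - 1 / p + 1 / q)) * q) := by
        gcongr
    _ = _ := by
        rw [ENNReal.mul_rpow_of_nonneg _ _ (by linarith : 0 ≤ q - p), eexp_rpow, eexp_rpow,
          ← ENNReal.rpow_mul, ← eexp_neg, ENNReal.mul_rpow_of_nonneg _ _ hp0.le, eexp_rpow]
        have e2 : 1 / p * (q - p) = q / p - 1 := by field_simp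
        have e3 : eexp (s * (1 - 1 / p) * (q - p)) * eexp (-(s * (1 - 1 / p + 1 / q)) * q) =
            eexp (-s * p) := by
          rw [← eexp_add]; congr 1; field_simp; ring
        rw [e2, ← e3]; ring

/-- With `upper_cube_bound` the Carleson coefficients are masses of disjoint cores, so the packing
constant is 1 and no A_∞ information enters. Hölder is used with exponents κ/q_i, which sum to 1,
and `fractional_average_le` trades the larger exponent q_i for p_i by spending a power of the norm
of f_i. -/
theorem DualWeights.upper_bound_finset [Nonempty ι] [SFinite μ] (h : DualWeights μ p κ u w)
    (hθ0 : 0 < θ) (hθ1 : θ ≤ 1)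
    (hθ : Fintype.card ι * θ = 1 / κ + ∑ i, (1 - 1 / p i))
    {q : ι → ℝ} (hpq : ∀ i, p i ≤ q i) (hqκ : ∑ i, 1 / q i = 1 / κ) {L : ℝ} (hL : 1 ≤ L)
    (hLq : ∀ i, 1 - 1 / p i + 1 / q i ≤ L * (1 - 1 / p i))
    {F : Finset (Set X)} (hF : Laminar (F : Set (Set X)))
    (hgood : ∀ Q ∈ F, GoodSet μ p κ u w K Q)
    {f : ι → X → ℝ≥0∞} (hf : ∀ i, AEMeasurable (f i) μ) :
    ∫⁻ x, familyMax μ θ f F x ^ κ * u x ∂μ ≤ (2 ^ Fintype.card ι) ^ κ *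
      (eexp ((L - 1) * (κ * (Fintype.card ι * θ) * Real.log 2)) * K ^ L *
      ∏ i, (ENNReal.ofReal (p i / (p i - 1) * 2 ^ p i) ^ (κ / q i) *
        (∫⁻ y, f i y ^ p i * w i y ^ (1 - p i) ∂μ) ^ (κ / p i))) := by
  classical
  have hκ := h.pos
  have hp0 : ∀ i, 0 < p i := fun i => zero_lt_one.trans (h.one_lt i)
  have hq0 : ∀ i, 0 < q i := fun i => (hp0 i).trans_le (hpq i)
  obtain ⟨S, hSF, hS, hbound⟩ := hF.exists_sparse (fun Q hQ => (hgood Q hQ).measurable)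
    (fun Q hQ => (hgood Q hQ).ne_zero) (fun Q hQ => (hgood Q hQ).ne_top) hθ0 hθ1 f
  refine (hbound κ u hκ h.aemeasurable_u).trans (mul_le_mul_right ?_ _)
  have hlam : Laminar (S : Set (Set X)) := hF.mono (Finset.coe_subset.2 hSF)
  have hmS : ∀ Q ∈ S, MeasurableSet Q := fun Q hQ => (hgood Q (hSF hQ)).measurable
  have hcore : ∀ Q ∈ S, μ (core S Q) ≠ 0 := fun Q hQ h0 => by
    have := hS Q hQ
    rw [h0, mul_zero, nonpos_iff_eq_zero] at this
    exact (hgood Q (hSF hQ)).ne_zero this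
  have hw0 : ∀ i, ∀ Q ∈ S, ∫⁻ y in Q, w i y ∂μ ≠ 0 := fun i Q hQ =>
    setLIntegral_ne_zero_of_ae (h.aemeasurable_w i) (h.w_ne_zero i) (hgood Q (hSF hQ)).ne_zero
  set B : ι → ℝ≥0∞ := fun i => ∫⁻ y, f i y ^ p i * w i y ^ (1 - p i) ∂μ
  set C := eexp ((L - 1) * (κ * (Fintype.card ι * θ) * Real.log 2)) * K ^ L
  calc ∑ R ∈ S, setValue μ θ f R ^ κ * ∫⁻ y in R, u y ∂μ
      ≤ ∑ R ∈ S, C * ∏ i, ((∫⁻ y in core S R, w i y ∂μ) * ((∫⁻ y in R, f i y ∂μ) /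
          (∫⁻ y in R, w i y ∂μ) ^ (1 - 1 / p i + 1 / q i)) ^ q i) ^ (κ / q i) := by
        refine Finset.sum_le_sum fun R hR => ?_
        have hg := hgood R (hSF hR)
        exact upper_cube_bound hq0 hκ hθ hqκ hL hLq _
          (setLIntegral_ne_zero_of_ae h.aemeasurable_u h.u_ne_zero hg.ne_zero) hg.u_ne_top
          hg.ne_zero hg.ne_top (fun i => hw0 i R hR) hg.w_ne_top
          (setLIntegral_ne_zero_of_ae h.aemeasurable_u h.u_ne_zero (hcore R hR))
          (fun i => setLIntegral_ne_zero_of_ae (h.aemeasurable_w i) (h.w_ne_zero i) (hcore R hR))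
          (lintegral_mono_set (core_subset S R)) (fun i => lintegral_mono_set (core_subset S R))
          hg.bound (hS R hR) (h.measure_rpow_le hθ _)
    _ ≤ C * ∏ i, (∑ R ∈ S, (∫⁻ y in core S R, w i y ∂μ) * ((∫⁻ y in R, f i y ∂μ) /
          (∫⁻ y in R, w i y ∂μ) ^ (1 - 1 / p i + 1 / q i)) ^ q i) ^ (κ / q i) := by
        rw [← Finset.mul_sum]
        gcongr
        refine sum_prod_rpow_le S Finset.univ (fun i R => (∫⁻ y in core S R, w i y ∂μ) *
          ((∫⁻ y in R, f i y ∂μ) / (∫⁻ y in R, w i y ∂μ) ^ (1 - 1 / p i + 1 / q i)) ^ q i) ?_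
          fun i _ => (div_pos hκ (hq0 i)).le
        simp_rw [← mul_one_div κ]
        rw [← Finset.mul_sum, hqκ, mul_one_div_cancel hκ.ne']
    _ ≤ C * ∏ i, (B i ^ (q i / p i - 1) *
          (ENNReal.ofReal (p i / (p i - 1) * 2 ^ p i) * 1 * B i)) ^ (κ / q i) := by
        gcongr with i
        · exact (div_pos hκ (hq0 i)).le
        have hcarl := hlam.carleson_embedding_weight hmS (h.aemeasurable_w i) (h.w_ne_zero i)
          (h.w_ne_top i) (hf i) (fun Q hQ => (hgood Q (hSF hQ)).w_ne_top i)
          (a := fun Q => ∫⁻ y in core S Q, w i y ∂μ) (Λ := 1) (fun R hR => ?_) (h.one_lt i)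
        · refine le_trans ?_ (mul_le_mul_right hcarl _)
          rw [Finset.mul_sum]
          refine Finset.sum_le_sum fun R hR => ?_
          rw [mul_left_comm]
          gcongr
          exact fractional_average_le (h.one_lt i) (hpq i) (hw0 i R hR)
            ((hgood R (hSF hR)).w_ne_top i) (setLIntegral_le_weight (h.aemeasurable_w i)
              (h.w_ne_zero i) (h.w_ne_top i) (hf i) (h.one_lt i) R)
        · rw [one_mul, ← lintegral_biUnion_finset (fun Q hQ Q' hQ' hne => hlam.core_disjoint
                (Finset.mem_filter.1 hQ).1 (Finset.mem_filter.1 hQ').1 hne)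
                (fun Q hQ => measurableSet_core hmS (Finset.mem_filter.1 hQ).1)]
          exact lintegral_mono_set (Set.iUnion₂_subset fun Q hQ =>
                (core_subset S Q).trans (Finset.mem_filter.1 hQ).2)
    _ = _ := by
        congr 1
        refine Finset.prod_congr rfl fun i _ => ?_
        have h1 : 0 ≤ q i / p i - 1 := by
          rw [sub_nonneg, le_div_iff₀ (hp0 i), one_mul]; exact hpq i
        have e : B i ^ (q i / p i - 1) * B i = B i ^ (q i / p i) := by
          have := ENNReal.rpow_add_of_nonneg (x := B i) (q i / p i - 1) 1 h1 zero_le_one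
          rw [ENNReal.rpow_one, sub_add_cancel] at this
          exact this.symm
        rw [mul_one, mul_left_comm, e, ENNReal.mul_rpow_of_nonneg _ _ (div_pos hκ (hq0 i)).le,
          ← ENNReal.rpow_mul]
        congr 2
        have := (hp0 i).ne'
        have := (hq0 i).ne'
        field_simp

end Weighted
end RoughFractional

/-! ### Cubes, shifted dyadic grids and passage to finite families. -/

namespace RoughFractional
variable {m n : ℕ}

/-- The half-open cube with lower corner `a` and side length `l`. -/
def halfCube (a : E n) (l : ℝ) : Set (E n) := {y | ∀ j, y j ∈ Set.Ico (a j) (a j + l)}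

theorem halfCube_subset_cube (a : E n) (l : ℝ) : halfCube a l ⊆ cube a l :=
  fun _ hy j => Set.Ico_subset_Icc_self (hy j)

theorem cube_eq_preimage (a : E n) (l : ℝ) : cube a l =
    (WithLp.ofLp : E n → Fin n → ℝ) ⁻¹' Set.univ.pi fun j => Set.Icc (a j) (a j + l) := by
  ext; simp only [cube, Set.mem_ofPred_eq, Set.mem_preimage, Set.mem_univ_pi]

theorem halfCube_eq_preimage (a : E n) (l : ℝ) : halfCube a l =
    (WithLp.ofLp : E n → Fin n → ℝ) ⁻¹' Set.univ.pi fun j => Set.Ico (a j) (a j + l) := by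
  ext; simp only [halfCube, Set.mem_ofPred_eq, Set.mem_preimage, Set.mem_univ_pi]

theorem measurableSet_cube (a : E n) (l : ℝ) : MeasurableSet (cube a l) := by
  rw [cube_eq_preimage]
  exact (PiLp.volume_preserving_ofLp (Fin n)).measurable
    (MeasurableSet.univ_pi fun _ => measurableSet_Icc)

theorem measurableSet_halfCube (a : E n) (l : ℝ) : MeasurableSet (halfCube a l) := by
  rw [halfCube_eq_preimage]
  exact (PiLp.volume_preserving_ofLp (Fin n)).measurable
    (MeasurableSet.univ_pi fun _ => measurableSet_Ico)

theorem volume_cube (a : E n) (l : ℝ) : volume (cube a l) = ENNReal.ofReal l ^ n := by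
  rw [cube_eq_preimage, (PiLp.volume_preserving_ofLp (Fin n)).measure_preimage
    (MeasurableSet.univ_pi fun _ => measurableSet_Icc).nullMeasurableSet, volume_pi_pi]
  simp

theorem volume_halfCube (a : E n) (l : ℝ) : volume (halfCube a l) = ENNReal.ofReal l ^ n := by
  rw [halfCube_eq_preimage, (PiLp.volume_preserving_ofLp (Fin n)).measure_preimage
    (MeasurableSet.univ_pi fun _ => measurableSet_Ico).nullMeasurableSet, volume_pi_pi]
  simp

theorem volume_cube_ne_zero (a : E n) {l : ℝ} (hl : 0 < l) : volume (cube a l) ≠ 0 := by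
  rw [volume_cube]; exact pow_ne_zero _ (by simpa using hl)

theorem volume_cube_ne_top (a : E n) (l : ℝ) : volume (cube a l) ≠ ∞ := by
  rw [volume_cube]; exact ENNReal.pow_ne_top ENNReal.ofReal_ne_top

theorem halfCube_ae_eq_cube (a : E n) (l : ℝ) :
    halfCube a l =ᵐ[volume] cube a l :=
  ae_eq_of_subset_of_measure_ge (halfCube_subset_cube a l)
    (by rw [volume_cube, volume_halfCube]) (measurableSet_halfCube a l).nullMeasurableSet
    (volume_cube_ne_top a l)

theorem setLIntegral_halfCube (a : E n) (l : ℝ) (g : E n → ℝ≥0∞) :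
    ∫⁻ y in halfCube a l, g y = ∫⁻ y in cube a l, g y :=
  setLIntegral_congr (halfCube_ae_eq_cube a l)

/-- Three times the shift of generation `k`, in the grid with shift parameter `t`. -/
def gridSign (t : Bool) (k : ℤ) : ℤ := if t then (if Even k then 1 else -1) else 0

theorem gridSign_succ (t : Bool) (k : ℤ) : gridSign t (k + 1) = -gridSign t k := by
  unfold gridSign
  cases t <;> by_cases h : Even k <;> simp [h]

/-- The coordinate of the cell of generation `k` in the grid with shift parameter `t`. -/
def gridCoord (t : Bool) (k : ℤ) (x : ℝ) : ℤ := ⌊x / 2 ^ k - gridSign t k / 3⌋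

/-- The alternating sign of the shift makes consecutive generations nested: with σ the current sign,
(x/2^k - σ/3 + σ)/2 = x/2^(k+1) + σ/3, so the next coordinate depends on x only through the present
one. -/
theorem gridCoord_succ (t : Bool) (k : ℤ) (x : ℝ) :
    gridCoord t (k + 1) x = (gridCoord t k x + gridSign t k) / 2 := by
  have h2 : (2 : ℝ) ^ (k + 1) = 2 ^ k * 2 := zpow_add_one₀ (by norm_num) k
  have hk : (0 : ℝ) < 2 ^ k := by positivity
  rw [gridCoord, gridCoord, gridSign_succ, ← Int.floor_add_intCast]
  have := Int.floor_div_natCast (x / 2 ^ k - (gridSign t k : ℝ) / 3 + gridSign t k) 2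
  push_cast at this
  rw [← this]
  congr 1
  rw [h2]; push_cast; field_simp; ring

theorem gridCoord_mono {t : Bool} {k k' : ℤ} (hk : k ≤ k') {x y : ℝ}
    (h : gridCoord t k x = gridCoord t k y) : gridCoord t k' x = gridCoord t k' y := by
  induction k', hk using Int.leInduction with
  | base => exact h
  | succ k' _ ih => rw [gridCoord_succ, gridCoord_succ, ih]

theorem gridCoord_eq_iff (t : Bool) (k : ℤ) (x : ℝ) (j : ℤ) : gridCoord t k x = j ↔
    x ∈ Set.Ico ((j + gridSign t k / 3 : ℝ) * 2 ^ k) ((j + gridSign t k / 3 : ℝ) * 2 ^ k + 2 ^ k) := by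
  have hk : (0 : ℝ) < 2 ^ k := by positivity
  rw [gridCoord, Int.floor_eq_iff, Set.mem_Ico, le_sub_iff_add_le, le_div_iff₀ hk,
    sub_lt_iff_lt_add, div_lt_iff₀ hk]
  constructor <;> rintro ⟨h1, h2⟩ <;> exact ⟨h1, by linarith⟩

/-- The lower corner of a grid cell. -/
def gridCorner (t : Fin n → Bool) (k : ℤ) (j : Fin n → ℤ) : E n :=
  WithLp.toLp 2 fun c => (j c + gridSign (t c) k / 3 : ℝ) * 2 ^ k

/-- A grid cell of generation `k`. -/
def cell (t : Fin n → Bool) (k : ℤ) (j : Fin n → ℤ) : Set (E n) :=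
  halfCube (gridCorner t k j) (2 ^ k)

theorem mem_cell {t : Fin n → Bool} {k : ℤ} {j : Fin n → ℤ} {x : E n} :
    x ∈ cell t k j ↔ ∀ c, gridCoord (t c) k (x c) = j c :=
  forall_congr' fun c => (gridCoord_eq_iff (t c) k (x c) (j c)).symm

/-- The shifted dyadic grid with shift parameter `t`. -/
def grid (t : Fin n → Bool) : Set (Set (E n)) :=
  Set.range fun kj : ℤ × (Fin n → ℤ) => cell t kj.1 kj.2

theorem countable_grid (t : Fin n → Bool) : (grid t).Countable := Set.countable_range _

theorem cell_subset_of_le {t : Fin n → Bool} {k k' : ℤ} (hk : k ≤ k') {j j' : Fin n → ℤ} {x : E n}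
    (hx : x ∈ cell t k j) (hx' : x ∈ cell t k' j') : cell t k j ⊆ cell t k' j' := by
  intro y hy
  rw [mem_cell] at *
  intro c
  rw [← hx' c]
  exact gridCoord_mono hk ((hy c).trans (hx c).symm)

theorem laminar_grid (t : Fin n → Bool) : Laminar (grid t) := by
  rintro _ ⟨⟨k, j⟩, rfl⟩ _ ⟨⟨k', j'⟩, rfl⟩
  by_cases h : Disjoint (cell t k j) (cell t k' j')
  · exact Or.inr (Or.inr h)
  · obtain ⟨x, hx, hx'⟩ := Set.not_disjoint_iff.1 h
    rcases le_total k k' with hk | hk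
    · exact Or.inl (cell_subset_of_le hk hx hx')
    · exact Or.inr (Or.inl (cell_subset_of_le hk hx' hx))

/-- The one-third trick. If both one-dimensional grids had a breakpoint in the interval then, in
units of 2^k, an integer and a number N' ± 1/3 would lie in a common half-open interval of length
1/3; but such numbers are at least 1/3 apart. -/
theorem exists_shift_gridCoord_eq {k : ℤ} {a l : ℝ} (hl : 3 * l ≤ 2 ^ k) :
    ∃ t, ∀ y ∈ Set.Icc a (a + l), gridCoord t k y = gridCoord t k a := by
  by_contra! h
  have hk : (0 : ℝ) < 2 ^ k := by positivity
  have key : ∀ t, ∃ N : ℤ, a / 2 ^ k < N + (gridSign t k : ℝ) / 3 ∧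
      (N + (gridSign t k : ℝ) / 3) ≤ a / 2 ^ k + 1 / 3 := by
    intro t
    obtain ⟨y, hy, hne⟩ := h t
    have hle : gridCoord t k a ≤ gridCoord t k y :=
      Int.floor_le_floor (by have := div_le_div_of_nonneg_right hy.1 hk.le; linarith)
    have hlt : gridCoord t k a + 1 ≤ gridCoord t k y := lt_of_le_of_ne hle (Ne.symm hne)
    refine ⟨gridCoord t k a + 1, ?_, ?_⟩
    · have := Int.lt_floor_add_one (a / 2 ^ k - (gridSign t k : ℝ) / 3)
      push_cast
      rw [gridCoord]; linarith
    · have h1 : ((gridCoord t k a + 1 : ℤ) : ℝ) ≤ y / 2 ^ k - (gridSign t k : ℝ) / 3 :=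
        Int.le_floor.1 hlt
      have h2 : y / 2 ^ k ≤ a / 2 ^ k + 1 / 3 := by
        rw [div_add_div _ _ hk.ne' (by norm_num), div_le_div_iff₀ hk (by positivity)]
        nlinarith [hy.2]
      linarith
  obtain ⟨N, h1, h2⟩ := key false
  obtain ⟨N', h3, h4⟩ := key true
  have e : gridSign false k = 0 := rfl
  rw [e, Int.cast_zero, zero_div, add_zero] at h1 h2
  have h5 : ((3 * N : ℤ) : ℝ) < (3 * N' + gridSign true k + 1 : ℤ) := by push_cast; linarith
  have h6 : ((3 * N' + gridSign true k : ℤ) : ℝ) < (3 * N + 1 : ℤ) := by push_cast; linarith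
  rw [Int.cast_lt] at h5 h6
  have h7 : gridSign true k = 1 ∨ gridSign true k = -1 := by
    unfold gridSign; by_cases h : Even k <;> simp [h]
  omega

theorem exists_cube_subset_cell (a : E n) {l : ℝ} (hl : 0 < l) :
    ∃ (t : Fin n → Bool) (k : ℤ) (j : Fin n → ℤ), cube a l ⊆ cell t k j ∧ (2 : ℝ) ^ k ≤ 6 * l := by
  -- The cell has generation k + 1, where 2^k < 3l ≤ 2^(k+1); this is the origin of the factor 6.
  -- The shift is chosen separately in each coordinate, hence 2^n grids.
  obtain ⟨k, hk1, hk2⟩ := exists_mem_Ioc_zpow (show (0:ℝ) < 3 * l by positivity) (one_lt_two (α := ℝ))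
  have h6 : (2 : ℝ) ^ (k + 1) ≤ 6 * l := by
    rw [zpow_add_one₀ (by norm_num)]; linarith
  choose t ht using fun c => exists_shift_gridCoord_eq (a := a c) hk2
  exact ⟨t, k + 1, fun c => gridCoord (t c) (k + 1) (a c),
    fun y hy => mem_cell.2 fun c => ht c (y c) (hy c), h6⟩

theorem setValue_cube_le (a : E n) {l : ℝ} (hl : 0 < l) {θ : ℝ} (hθ : 0 ≤ θ)
    (f : Fin m → E n → ℝ≥0∞) : ∃ t, ∃ Q ∈ grid t, cube a l ⊆ Q ∧
      setValue volume θ f (cube a l) ≤ ((6 ^ n) ^ θ) ^ m * setValue volume θ f Q := by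
  obtain ⟨t, k, j, hsub, hk⟩ := exists_cube_subset_cell a hl
  refine ⟨t, cell t k j, ⟨(k, j), rfl⟩, hsub, ?_⟩
  have hvol : volume (cell t k j) ≤ 6 ^ n * volume (cube a l) := by
    rw [cell, volume_halfCube, volume_cube, ← mul_pow]
    refine pow_le_pow_left' ?_ n
    have : (6 : ℝ≥0∞) = ENNReal.ofReal 6 := by simp
    rw [this, ← ENNReal.ofReal_mul (by norm_num)]
    exact ENNReal.ofReal_le_ofReal hk
  have hQ0 : volume (cell t k j) ≠ 0 := fun h =>
    volume_cube_ne_zero a hl (measure_mono_null hsub h)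
  have hQt : volume (cell t k j) ≠ ∞ := by
    rw [cell, volume_halfCube]; exact ENNReal.pow_ne_top ENNReal.ofReal_ne_top
  have hconst : ((6 ^ n : ℝ≥0∞) ^ θ) ^ m = ∏ _i : Fin m, (6 ^ n : ℝ≥0∞) ^ θ := by simp
  rw [setValue, setValue, hconst, ← Finset.prod_mul_distrib]
  refine Finset.prod_le_prod' fun i _ => ?_
  rw [← mul_div_assoc, mul_comm, mul_div_assoc]
  rw [div_eq_mul_inv]
  refine mul_le_mul' (lintegral_mono_set hsub) ?_
  rw [ENNReal.le_div_iff_mul_le (Or.inl (by simp [ENNReal.rpow_eq_zero_iff, hQ0, hQt]))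
    (Or.inl (by simp [ENNReal.rpow_eq_top_iff, hQ0, hQt]))]
  calc (volume (cube a l) ^ θ)⁻¹ * volume (cell t k j) ^ θ
      ≤ (volume (cube a l) ^ θ)⁻¹ * (6 ^ n * volume (cube a l)) ^ θ := by gcongr
    _ = (6 ^ n) ^ θ := by
        have h1 : volume (cube a l) ^ θ ≠ 0 := by
          simp [ENNReal.rpow_eq_zero_iff, volume_cube_ne_zero a hl, volume_cube_ne_top a l]
        have h2 : volume (cube a l) ^ θ ≠ ∞ := by
          simp [ENNReal.rpow_eq_top_iff, volume_cube_ne_zero a hl, volume_cube_ne_top a l]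
        rw [ENNReal.mul_rpow_of_nonneg _ _ hθ, mul_left_comm, ENNReal.inv_mul_cancel h1 h2, mul_one]

/-- Monotone convergence along the directed set of finite subfamilies, which is available because
the family is countable. -/
theorem lintegral_familyMax_le {X ι : Type*} [MeasurableSpace X] {μ : Measure X} [Fintype ι]
    {D : Set (Set X)} (hD : D.Countable) (hm : ∀ Q ∈ D, MeasurableSet Q) {θ κ : ℝ} (hκ : 0 < κ)
    (f : ι → X → ℝ≥0∞) {u : X → ℝ≥0∞} (hu : AEMeasurable u μ) {B : ℝ≥0∞}
    (hB : ∀ F : Finset (Set X), (F : Set (Set X)) ⊆ D →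
      ∫⁻ x, familyMax μ θ f F x ^ κ * u x ∂μ ≤ B) :
    ∫⁻ x, familyMax μ θ f D x ^ κ * u x ∂μ ≤ B := by
  classical
  have : Countable D := hD.to_subtype
  have hmono : ∀ {F G : Set (Set X)}, F ⊆ G → ∀ x, familyMax μ θ f F x ≤ familyMax μ θ f G x :=
    fun h x => biSup_mono fun Q hQ => h hQ
  have himg : ∀ F : Finset D, ((F.image Subtype.val : Finset (Set X)) : Set (Set X)) ⊆ D := by
    intro F Q hQ
    obtain ⟨Q', -, rfl⟩ := Finset.mem_image.1 hQ
    exact Q'.2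
  have e : ∀ x, familyMax μ θ f D x ^ κ * u x = ⨆ F : Finset D,
      familyMax μ θ f ((F.image Subtype.val : Finset (Set X)) : Set (Set X)) x ^ κ * u x := by
    intro x
    rw [← ENNReal.iSup_mul]
    congr 1
    have e2 : familyMax μ θ f D x =
        ⨆ F : Finset D, familyMax μ θ f ((F.image Subtype.val : Finset (Set X)) : Set (Set X)) x := by
      refine le_antisymm (iSup₂_le fun Q hQ => ?_) (iSup_le fun F => hmono (himg F) x)
      refine le_iSup_of_le {⟨Q, hQ⟩} ?_
      have hmem : Q ∈ ((({⟨Q, hQ⟩} : Finset D).image Subtype.val : Finset (Set X)) :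
          Set (Set X)) := by simp
      unfold familyMax
      exact le_iSup₂_of_le Q hmem le_rfl
    rw [e2, ← ENNReal.orderIsoRpow_apply κ hκ, OrderIso.map_iSup]
    rfl
  rw [lintegral_congr e, lintegral_iSup_directed]
  · exact iSup_le fun F => hB _ (himg F)
  · intro F
    refine AEMeasurable.mul (Measurable.aemeasurable (Measurable.pow_const ?_ _)) hu
    exact Measurable.biSup _ (Finset.countable_toSet _) fun Q hQ =>
      measurable_const.indicator (hm Q (himg F hQ))
  · refine directed_of_isDirected_le fun F G hFG x => ?_
    have := hmono (Finset.coe_subset.2 (Finset.image_subset_image (f := Subtype.val) hFG)) x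
    dsimp only
    gcongr

end RoughFractional

/-! ### Relations between the exponents, and nondegeneracy of the weights. -/

namespace RoughFractional
variable {m n : ℕ}

/-- The standing relations between the exponents of a fractional maximal operator. -/
structure FracExponents (m n : ℕ) (P : Fin m → ℝ) (β κ : ℝ) : Prop where
  m_pos : 0 < m
  n_pos : 0 < n
  one_lt : ∀ i, 1 < P i
  β_pos : 0 < β
  κ_pos : 0 < κ
  κ_eq : 1 / κ = ∑ i, 1 / P i - β / n

namespace FracExponents
variable {P : Fin m → ℝ} {β κ : ℝ}

/-- The homogeneity relation mθ = 1/κ + Σ 1/p_i', which balances the powers of |Q| in all the cube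
estimates. -/
theorem mul_theta (h : FracExponents m n P β κ) :
    (Fintype.card (Fin m) : ℝ) * (1 - β / (m * n)) = 1 / κ + ∑ i, (1 - 1 / P i) := by
  have := h.m_pos
  have := h.n_pos
  rw [h.κ_eq, Finset.sum_sub_distrib]
  simp only [Fintype.card_fin, Finset.sum_const, Finset.card_univ, nsmul_eq_mul, mul_one]
  field_simp
  ring

theorem inv_pos (h : FracExponents m n P β κ) (i : Fin m) : 0 < 1 - 1 / P i := by
  have := h.one_lt i
  rw [sub_pos, div_lt_one (by linarith)]; exact this

theorem one_div_le (h : FracExponents m n P β κ) : 1 / κ ≤ ∑ i, 1 / P i := by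
  have := h.n_pos
  have : 0 ≤ β / n := div_nonneg h.β_pos.le (by positivity)
  linarith [h.κ_eq]

theorem theta_pos (h : FracExponents m n P β κ) : 0 < 1 - β / (m * n) := by
  have h1 := h.mul_theta
  have h2 : 0 < 1 / κ := one_div_pos.2 h.κ_pos
  have h3 : 0 ≤ ∑ i, (1 - 1 / P i) := Finset.sum_nonneg fun i _ => (h.inv_pos i).le
  have h4 : (0 : ℝ) < Fintype.card (Fin m) := by simpa using h.m_pos
  by_contra h5
  nlinarith

theorem theta_le_one (h : FracExponents m n P β κ) : 1 - β / (m * n) ≤ 1 := by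
  have : 0 ≤ β / (m * n) := div_nonneg h.β_pos.le (by positivity)
  linarith

theorem conj_mul (h : FracExponents m n P β κ) (i : Fin m) :
    (P i).conjExponent * (1 - 1 / P i) = 1 := by
  have := h.one_lt i
  have h0 : P i - 1 ≠ 0 := by linarith
  have h1 : P i ≠ 0 := by linarith
  rw [Real.conjExponent]
  field_simp

theorem conj_pos (h : FracExponents m n P β κ) (i : Fin m) : 0 < (P i).conjExponent :=
  (Real.HolderConjugate.conjExponent (h.one_lt i)).symm.pos

/-- Write x_i = 1/p_i' and L = θM. The requirements are 1/q_i ≤ c_i := min(1, L x_i) - x_i and Σ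
1/q_i = 1/κ. Since M x_i ≥ 1 and θ ≤ 1, each minimum is at least θ, so Σ c_i ≥ mθ - Σ x_i = 1/κ, and
scaling the c_i down proportionally gives the 1/q_i. Positivity of c_i uses L > 1, which follows
from mL = M/κ + Σ M x_i. -/
theorem exists_split (h : FracExponents m n P β κ) {M : ℝ} (hM : ∀ i, (P i).conjExponent ≤ M) :
    1 ≤ (1 - β / (m * n)) * M ∧ ∃ q : Fin m → ℝ, (∀ i, P i ≤ q i) ∧ ∑ i, 1 / q i = 1 / κ ∧
      ∀ i, 1 - 1 / P i + 1 / q i ≤ (1 - β / (m * n)) * M * (1 - 1 / P i) := by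
  set θ := 1 - β / (m * n)
  have hκ := h.κ_pos
  have hm0 : (0 : ℝ) < m := by exact_mod_cast h.m_pos
  have hθ := h.mul_theta
  rw [Fintype.card_fin] at hθ
  have hθ1 : θ ≤ 1 := h.theta_le_one
  have hθ0 : 0 < θ := h.theta_pos
  have hMx : ∀ i, 1 ≤ M * (1 - 1 / P i) := fun i =>
    (h.conj_mul i).symm.le.trans (mul_le_mul_of_nonneg_right (hM i) (h.inv_pos i).le)
  have hM0 : 0 < M := (h.conj_pos ⟨0, h.m_pos⟩).trans_le (hM _)
  have hL : 1 < θ * M := by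
    have h1 : m * (θ * M) = M * (1 / κ) + ∑ i, M * (1 - 1 / P i) := by
      rw [← Finset.mul_sum, ← mul_add, ← hθ]; ring
    have h2 : (m : ℝ) ≤ ∑ i, M * (1 - 1 / P i) := by
      calc (m : ℝ) = ∑ _i : Fin m, (1 : ℝ) := by simp
        _ ≤ _ := Finset.sum_le_sum fun i _ => hMx i
    have h3 : 0 < M * (1 / κ) := by positivity
    by_contra h4
    nlinarith
  refine ⟨hL.le, ?_⟩
  set c : Fin m → ℝ := fun i => min 1 (θ * M * (1 - 1 / P i)) - (1 - 1 / P i) with hc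
  have hc0 : ∀ i, 0 < c i := fun i => by
    have h1 := h.inv_pos i
    have h2 : 0 < 1 / P i := one_div_pos.2 (zero_lt_one.trans (h.one_lt i))
    rw [hc, sub_pos, lt_min_iff]
    exact ⟨by linarith, by nlinarith⟩
  have hcs : 1 / κ ≤ ∑ i, c i := by
    rw [hc, Finset.sum_sub_distrib, le_sub_iff_add_le, ← hθ]
    calc m * θ = ∑ _i : Fin m, θ := by simp
      _ ≤ _ := Finset.sum_le_sum fun i _ => le_min hθ1 (by
        rw [mul_assoc]; exact le_mul_of_one_le_right hθ0.le (hMx i))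
  set s := ∑ i, c i
  have hs : 0 < s := lt_of_lt_of_le (by positivity) hcs
  have hq : ∀ i, 1 / (κ * s / c i) ≤ c i := fun i => by
    rw [one_div_div, div_le_iff₀ (by positivity)]
    have := mul_le_mul_of_nonneg_left hcs hκ.le
    rw [mul_one_div_cancel hκ.ne'] at this
    exact le_mul_of_one_le_right (hc0 i).le this
  refine ⟨fun i => κ * s / c i, fun i => ?_, ?_, fun i => ?_⟩
  · have hP : 0 < P i := zero_lt_one.trans (h.one_lt i)
    have h1 : c i ≤ 1 / P i := by
      have : min 1 (θ * M * (1 - 1 / P i)) ≤ 1 := min_le_left _ _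
      simp only [hc]; linarith
    have h2 := (hq i).trans h1
    have hq0 : 0 < κ * s / c i := by have := hc0 i; positivity
    exact (one_div_le_one_div hq0 hP).1 h2
  · simp_rw [one_div_div]
    rw [← Finset.sum_div]
    field_simp
    rfl
  · have h1 : min 1 (θ * M * (1 - 1 / P i)) ≤ θ * M * (1 - 1 / P i) := min_le_right _ _
    have h2 : 1 / (κ * s / c i) ≤ min 1 (θ * M * (1 - 1 / P i)) - (1 - 1 / P i) := hq i
    dsimp only
    linarith

end FracExponents

theorem wpow_one (ω : Fin m → E n → ℝ≥0) : wpow ω 1 = fun i x => (ω i x : ℝ≥0∞) := by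
  funext i x; simp [wpow]

/-- The density of `nuMeasure`. -/
def nuDensity (ω : Fin m → E n → ℝ≥0) (κ : ℝ) (x : E n) : ℝ≥0∞ := (∏ i, (ω i x : ℝ≥0∞)) ^ κ

/-- The weights dual to `ω`. -/
def dualWeight (P : Fin m → ℝ) (ω : Fin m → E n → ℝ≥0) (i : Fin m) : E n → ℝ≥0∞ :=
  wpow ω (-(P i).conjExponent) i

theorem aemeasurable_nuDensity {ω : Fin m → E n → ℝ≥0} (hω : ∀ i, AEMeasurable (ω i)) (κ : ℝ) :
    AEMeasurable (nuDensity ω κ) :=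
  (Finset.aemeasurable_fun_prod _ fun i _ => (hω i).coe_nnreal_ennreal).pow_const _

theorem aemeasurable_dualWeight {ω : Fin m → E n → ℝ≥0} (hω : ∀ i, AEMeasurable (ω i))
    (P : Fin m → ℝ) (i : Fin m) : AEMeasurable (dualWeight P ω i) :=
  (hω i).coe_nnreal_ennreal.pow_const _

variable {P : Fin m → ℝ} {β κ : ℝ} {ω : Fin m → E n → ℝ≥0}

theorem le_apqConst (h : FracExponents m n P β κ) (a : E n) {l : ℝ} (hl : 0 < l) :
    (∫⁻ y in cube a l, nuDensity ω κ y) / volume (cube a l) *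
      ∏ i, ((∫⁻ y in cube a l, dualWeight P ω i y) / volume (cube a l)) ^ (κ * (1 - 1 / P i)) ≤
      apqConst P κ (wpow ω 1) := by
  unfold apqConst
  refine le_iSup_of_le a (le_iSup_of_le l (le_iSup_of_le hl (le_of_eq ?_)))
  rw [wpow_one]
  have e : ∀ i, κ * (1 - 1 / P i) = κ / (P i).conjExponent := fun i => by
    rw [eq_div_iff (h.conj_pos i).ne', mul_assoc, mul_comm (1 - 1 / P i), h.conj_mul i, mul_one]
  simp_rw [e]
  rfl

theorem cube_subset_cube_of_norm (a : E n) {l : ℝ} (hl : 0 ≤ l) {r : ℝ} :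
    cube (-WithLp.toLp 2 fun _ => r) (2 * r) ⊆
      cube (a - WithLp.toLp 2 fun _ => (‖a‖ + l + r : ℝ)) (l + 2 * (‖a‖ + l + r)) := by
  intro y hy j
  have := hy j
  have h1 := PiLp.norm_apply_le a j
  rw [Real.norm_eq_abs, abs_le] at h1
  simp only [Set.mem_Icc, PiLp.sub_apply, PiLp.neg_apply] at *
  exact ⟨by linarith, by linarith⟩

theorem iUnion_cube : (⋃ N : ℕ, cube (-WithLp.toLp 2 fun _ => ((N + 1 : ℕ) : ℝ) : E n)
    (2 * (N + 1 : ℕ))) = Set.univ := by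
  refine Set.eq_univ_of_forall fun x => Set.mem_iUnion.2 ?_
  obtain ⟨N, hN⟩ := exists_nat_ge ‖x‖
  refine ⟨N, fun j => ?_⟩
  have h1 := (PiLp.norm_apply_le x j).trans hN
  rw [Real.norm_eq_abs, abs_le] at h1
  simp only [Set.mem_Icc, PiLp.neg_apply]
  push_cast
  exact ⟨by linarith, by linarith⟩

theorem ae_of_forall_cube {p : E n → Prop}
    (h : ∀ (a : E n) (l : ℝ), 0 < l → ∀ᵐ x ∂volume.restrict (cube a l), p x) : ∀ᵐ x, p x := by
  rw [← Measure.restrict_univ (μ := (volume : Measure (E n))), ← iUnion_cube, ae_restrict_iUnion_iff]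
  exact fun N => h _ _ (by positivity)

theorem avg_dualWeight_ne_zero (h : FracExponents m n P β κ) (hω : ∀ i, AEMeasurable (ω i))
    (i : Fin m) (a : E n) {l : ℝ} (hl : 0 < l) :
    ∫⁻ y in cube a l, dualWeight P ω i y ≠ 0 := by
  refine setLIntegral_ne_zero_of_ae (aemeasurable_dualWeight hω P i) (.of_forall fun x => ?_)
    (volume_cube_ne_zero a hl)
  simp [dualWeight, wpow, ENNReal.rpow_eq_zero_iff, (h.conj_pos i).le]

/-- In a finite product with no zero factor every factor is finite. The dual averages never vanish,
since a negative power of a finite number is positive; only the ν-mass has to be assumed nonzero. -/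
theorem cube_finite (h : FracExponents m n P β κ) (hω : ∀ i, AEMeasurable (ω i))
    (hA : InApq P κ (wpow ω 1)) (a : E n) {l : ℝ} (hl : 0 < l)
    (hu : ∫⁻ y in cube a l, nuDensity ω κ y ≠ 0) :
    ∫⁻ y in cube a l, nuDensity ω κ y ≠ ∞ ∧ ∀ i, ∫⁻ y in cube a l, dualWeight P ω i y ≠ ∞ := by
  have hb := (le_apqConst (ω := ω) h a hl).trans_lt hA
  have hc : ∀ i, 0 < κ * (1 - 1 / P i) := fun i => mul_pos h.κ_pos (h.inv_pos i)
  have hv0 := volume_cube_ne_zero a hl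
  have hvt := volume_cube_ne_top a l
  have hf0 : ∀ i, ((∫⁻ y in cube a l, dualWeight P ω i y) / volume (cube a l)) ^
      (κ * (1 - 1 / P i)) ≠ 0 := fun i => by
    have : (∫⁻ y in cube a l, dualWeight P ω i y) / volume (cube a l) ≠ 0 :=
      ENNReal.div_ne_zero.2 ⟨avg_dualWeight_ne_zero h hω i a hl, hvt⟩
    rw [Ne, ENNReal.rpow_eq_zero_iff]
    exact fun h => h.elim (fun h => this h.1) fun h => (hc i).not_gt h.2
  constructor
  · intro ht
    rw [ht, ENNReal.top_div_of_ne_top hvt, ENNReal.top_mul (Finset.prod_ne_zero_iff.2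
      fun i _ => hf0 i)] at hb
    exact lt_irrefl _ hb
  · intro i ht
    have h1 := Finset.mul_prod_erase Finset.univ (fun i => ((∫⁻ y in cube a l, dualWeight P ω i y) /
      volume (cube a l)) ^ (κ * (1 - 1 / P i))) (Finset.mem_univ i)
    rw [ht, ENNReal.top_div_of_ne_top hvt, ENNReal.top_rpow_of_pos (hc i),
      ENNReal.top_mul (Finset.prod_ne_zero_iff.2 fun i _ => hf0 i)] at h1
    rw [← h1, ENNReal.mul_top (ENNReal.div_ne_zero.2 ⟨hu, hvt⟩)] at hb
    exact lt_irrefl _ hb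

/-- A weight in the class is either trivial or nondegenerate on every cube. -/
theorem nu_dichotomy (h : FracExponents m n P β κ) (hω : ∀ i, AEMeasurable (ω i))
    (hA : InApq P κ (wpow ω 1)) : nuMeasure ω κ = 0 ∨
      ((∀ i, ∀ᵐ x, ω i x ≠ 0) ∧ ∀ (a : E n) (l : ℝ), 0 < l →
        ∫⁻ y in cube a l, nuDensity ω κ y ≠ ∞ ∧ ∀ i, ∫⁻ y in cube a l, dualWeight P ω i y ≠ ∞) := by
  have hω0 : ∀ (a : E n) (l : ℝ), 0 < l → ∫⁻ y in cube a l, nuDensity ω κ y ≠ 0 →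
      ∀ i, ∀ᵐ x ∂volume.restrict (cube a l), ω i x ≠ 0 := by
    intro a l hl hu i
    have := ae_lt_top' (aemeasurable_dualWeight hω P i).restrict ((cube_finite h hω hA a hl hu).2 i)
    filter_upwards [this] with x hx h0
    simp [dualWeight, wpow, h0, ENNReal.zero_rpow_of_neg (neg_lt_zero.2 (h.conj_pos i))] at hx
  by_cases hall : ∀ (a : E n) (l : ℝ), 0 < l → ∫⁻ y in cube a l, nuDensity ω κ y ≠ 0
  · right
    exact ⟨fun i => ae_of_forall_cube fun a l hl => hω0 a l hl (hall a l hl) i,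
      fun a l hl => cube_finite h hω hA a hl (hall a l hl)⟩
  · left
    push Not at hall
    obtain ⟨a, l, hl, h0⟩ := hall
    -- Positive ν-mass on a larger cube would make every ω_i nonzero almost everywhere there, hence
    -- on the small cube, contradicting the vanishing mass. Larger cubes exhaust the space.
    have hbig : ∀ (b : E n) (r : ℝ), 0 < r → cube a l ⊆ cube b r →
        ∫⁻ y in cube b r, nuDensity ω κ y = 0 := by
      intro b r hr hsub
      by_contra hne
      refine setLIntegral_ne_zero_of_ae (μ := volume.restrict (cube a l)) (A := Set.univ)
        (aemeasurable_nuDensity hω κ).restrict ?_ (by simpa using volume_cube_ne_zero a hl)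
        (by rwa [Measure.restrict_univ])
      have hae : ∀ᵐ x ∂volume.restrict (cube a l), ∀ i, ω i x ≠ 0 :=
        ae_all_iff.2 fun i => ae_mono (Measure.restrict_mono_set _ hsub) (hω0 b r hr hne i)
      filter_upwards [hae] with x hx
      have h1 : ∏ i, (ω i x : ℝ≥0∞) ≠ 0 :=
        Finset.prod_ne_zero_iff.2 fun i _ => by simpa using hx i
      simp [nuDensity, ENNReal.rpow_eq_zero_iff, h1, h.κ_pos.le]
    have hz : ∀ᵐ x, nuDensity ω κ x = 0 := by
      rw [← Measure.restrict_univ (μ := (volume : Measure (E n))), ← iUnion_cube,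
        ae_restrict_iUnion_iff]
      intro N
      have hr : 0 < l + 2 * (‖a‖ + l + ((N + 1 : ℕ) : ℝ)) := by positivity
      have hs2 := cube_subset_cube_of_norm a hl.le (r := ((N + 1 : ℕ) : ℝ))
      have hs1 : cube a l ⊆ cube (a - WithLp.toLp 2 fun _ => (‖a‖ + l + ((N + 1 : ℕ) : ℝ) : ℝ))
          (l + 2 * (‖a‖ + l + ((N + 1 : ℕ) : ℝ))) := by
        intro y hy j
        have := hy j
        have h3 : 0 ≤ ‖a‖ + l + ((N + 1 : ℕ) : ℝ) := by positivity
        simp only [Set.mem_Icc, PiLp.sub_apply] at *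
        exact ⟨by linarith, by linarith⟩
      have := hbig _ _ hr hs1
      rw [lintegral_eq_zero_iff' (aemeasurable_nuDensity hω κ).restrict] at this
      exact ae_mono (Measure.restrict_mono_set _ hs2) this
    exact (withDensity_congr_ae hz).trans withDensity_zero

end RoughFractional

/-! ### Upper bounds for the multilinear fractional maximal operator. -/

namespace RoughFractional
variable {m n : ℕ} {P : Fin m → ℝ} {β κ : ℝ} {ω : Fin m → E n → ℝ≥0}

/-- Membership in the weighted space gives measurability only for ω_i^(p_i) dx; as ω_i is almost
everywhere nonzero, Lebesgue measure is absolutely continuous with respect to it. -/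
theorem aemeasurable_of_memWeighted (hω : ∀ i, AEMeasurable (ω i)) (hω0 : ∀ i, ∀ᵐ x, ω i x ≠ 0)
    {f : Fin m → E n → ℂ} (hf : MemWeighted P ω f) (i : Fin m) : AEStronglyMeasurable (f i) := by
  refine (hf i).1.mono_ac (withDensity_absolutelyContinuous' ((hω i).coe_nnreal_ennreal.pow_const _)
    ?_)
  filter_upwards [hω0 i] with x hx
  simp [ENNReal.rpow_eq_zero_iff, hx]

theorem eLpNorm_wMeasure (h : FracExponents m n P β κ) (hω : ∀ i, AEMeasurable (ω i))
    {f : Fin m → E n → ℂ} (i : Fin m) (hf : AEStronglyMeasurable (f i)) :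
    eLpNorm (f i) (ENNReal.ofReal (P i)) (wMeasure (ω i) (P i)) =
      (∫⁻ y, ‖f i y‖ₑ ^ P i * dualWeight P ω i y ^ (1 - P i)) ^ (1 / P i) := by
  have hP : 1 < P i := h.one_lt i
  have hP0 : 0 < P i := by linarith
  rw [eLpNorm_eq_lintegral_rpow_enorm_toReal (by simpa using hP0) ENNReal.ofReal_ne_top,
    ENNReal.toReal_ofReal hP0.le, wMeasure, lintegral_withDensity_eq_lintegral_mul₀
    ((hω i).coe_nnreal_ennreal.pow_const _) (hf.enorm.pow_const _)]
  congr 1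
  refine lintegral_congr fun y => ?_
  have e : -(P i).conjExponent * (1 - P i) = P i := by
    have : P i - 1 ≠ 0 := by linarith
    rw [Real.conjExponent]; field_simp; ring
  simp only [Pi.mul_apply, dualWeight, wpow]
  rw [← ENNReal.rpow_mul, e, mul_comm]

theorem dualWeights (h : FracExponents m n P β κ) (hω : ∀ i, AEMeasurable (ω i))
    (hω0 : ∀ i, ∀ᵐ x, ω i x ≠ 0) :
    DualWeights volume P κ (nuDensity ω κ) (dualWeight P ω) where
  one_lt := h.one_lt
  pos := h.κ_pos
  aemeasurable_u := aemeasurable_nuDensity hω κ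
  aemeasurable_w := aemeasurable_dualWeight hω P
  u_ne_zero := by
    filter_upwards [ae_all_iff.2 hω0] with x hx
    have h1 : ∏ i, (ω i x : ℝ≥0∞) ≠ 0 := Finset.prod_ne_zero_iff.2 fun i _ => by simpa using hx i
    simp [nuDensity, ENNReal.rpow_eq_zero_iff, h1, h.κ_pos.le]
  w_ne_zero i := .of_forall fun x => by
    simp [dualWeight, wpow, ENNReal.rpow_eq_zero_iff, (h.conj_pos i).le]
  w_ne_top i := by
    filter_upwards [hω0 i] with x hx
    simp [dualWeight, wpow, ENNReal.rpow_eq_top_iff, hx]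
  dual := by
    filter_upwards [ae_all_iff.2 hω0] with x hx
    rw [nuDensity, ← ENNReal.rpow_mul, mul_one_div_cancel h.κ_pos.ne', ENNReal.rpow_one,
      ← Finset.prod_mul_distrib]
    refine Finset.prod_eq_one fun i _ => ?_
    rw [dualWeight, wpow, ← ENNReal.rpow_mul, neg_mul, h.conj_mul, ENNReal.rpow_neg_one]
    exact ENNReal.mul_inv_cancel (by simpa using hx i) ENNReal.coe_ne_top

theorem goodSet_of_mem_grid (h : FracExponents m n P β κ)
    (hfin : ∀ (a : E n) (l : ℝ), 0 < l →
      ∫⁻ y in cube a l, nuDensity ω κ y ≠ ∞ ∧ ∀ i, ∫⁻ y in cube a l, dualWeight P ω i y ≠ ∞)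
    {t : Fin n → Bool} {Q : Set (E n)} (hQ : Q ∈ grid t) :
    GoodSet volume P κ (nuDensity ω κ) (dualWeight P ω) (apqConst P κ (wpow ω 1)) Q := by
  obtain ⟨⟨k, j⟩, rfl⟩ := hQ
  have hk : (0 : ℝ) < 2 ^ k := by positivity
  have hv : volume (cell t k j) = volume (cube (gridCorner t k j) (2 ^ k)) := by
    rw [cell, volume_cube, volume_halfCube]
  constructor
  · exact measurableSet_halfCube _ _
  · exact hv ▸ volume_cube_ne_zero _ hk
  · exact hv ▸ volume_cube_ne_top _ _
  · simp only [cell, setLIntegral_halfCube]; exact (hfin _ _ hk).1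
  · simp only [cell, setLIntegral_halfCube]; exact (hfin _ _ hk).2
  · rw [hv]; simp only [cell, setLIntegral_halfCube]; exact le_apqConst h _ hk

/-- The comparison constant between cubes and grid cells. -/
def gridFactor (m n : ℕ) (θ : ℝ) : ℝ≥0∞ := ((6 ^ n) ^ θ) ^ m

theorem gridFactor_ne_top (m n : ℕ) {θ : ℝ} (hθ : 0 ≤ θ) : gridFactor m n θ ≠ ∞ :=
  ENNReal.pow_ne_top (ENNReal.rpow_ne_top_of_nonneg hθ (ENNReal.pow_ne_top (by simp)))

theorem fracMaximal_le (h : FracExponents m n P β κ) (f : Fin m → E n → ℂ) (x : E n) :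
    fracMaximal β f x ≤ gridFactor m n (1 - β / (m * n)) *
      ⨆ t, familyMax volume (1 - β / (m * n)) (fun i y => ‖f i y‖ₑ) (grid t) x := by
  refine iSup_le fun a => iSup_le fun l => iSup_le fun hl => iSup_le fun hx => ?_
  obtain ⟨t, Q, hQ, hsub, hle⟩ := setValue_cube_le a hl h.theta_pos.le (fun i y => ‖f i y‖ₑ)
  refine hle.trans (mul_le_mul_right (le_iSup_of_le t ?_) _)
  unfold familyMax
  refine le_iSup₂_of_le Q hQ ?_
  rw [Set.indicator_of_mem (hsub hx)]

theorem measurable_familyMax_grid (θ : ℝ) (f : Fin m → E n → ℝ≥0∞) (t : Fin n → Bool) :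
    Measurable (familyMax volume θ f (grid t)) := by
  refine Measurable.biSup _ (countable_grid t) fun Q hQ => measurable_const.indicator ?_
  obtain ⟨⟨k, j⟩, rfl⟩ := hQ
  exact measurableSet_halfCube _ _

/-- The maximum over the 2^n grids is bounded by the sum, and each grid is reduced to its finite
subfamilies. -/
theorem eLpNorm_fracMaximal_le (h : FracExponents m n P β κ) (hω : ∀ i, AEMeasurable (ω i))
    (f : Fin m → E n → ℂ) {B : ℝ≥0∞}
    (hB : ∀ t, ∀ F : Finset (Set (E n)), (F : Set (Set (E n))) ⊆ grid t →
      ∫⁻ x, familyMax volume (1 - β / (m * n)) (fun i y => ‖f i y‖ₑ) F x ^ κ * nuDensity ω κ x ≤ B) :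
    eLpNorm (fracMaximal β f) (ENNReal.ofReal κ) (nuMeasure ω κ) ≤
      (gridFactor m n (1 - β / (m * n)) ^ κ * (2 ^ n * B)) ^ (1 / κ) := by
  have hκ := h.κ_pos
  rw [eLpNorm_eq_lintegral_rpow_enorm_toReal (by simpa using hκ) ENNReal.ofReal_ne_top,
    ENNReal.toReal_ofReal hκ.le]
  refine ENNReal.rpow_le_rpow ?_ (by positivity)
  set M := fun t => familyMax volume (1 - β / (m * n)) (fun i y => ‖f i y‖ₑ) (grid t : Set (Set (E n)))
  have hM : ∀ t, Measurable fun x => M t x ^ κ := fun t =>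
    (measurable_familyMax_grid _ _ t).pow_const _
  calc ∫⁻ x, ‖fracMaximal β f x‖ₑ ^ κ ∂nuMeasure ω κ
      ≤ ∫⁻ x, gridFactor m n (1 - β / (m * n)) ^ κ * ∑ t, M t x ^ κ ∂nuMeasure ω κ := by
        refine lintegral_mono fun x => ?_
        rw [enorm_eq_self]
        refine (ENNReal.rpow_le_rpow (fracMaximal_le h f x) hκ.le).trans ?_
        rw [ENNReal.mul_rpow_of_nonneg _ _ hκ.le]
        gcongr
        rw [← ENNReal.orderIsoRpow_apply κ hκ, OrderIso.map_iSup]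
        exact iSup_le fun t => Finset.single_le_sum (f := fun t => M t x ^ κ)
          (fun _ _ => zero_le) (Finset.mem_univ t)
    _ = gridFactor m n (1 - β / (m * n)) ^ κ * ∑ t, ∫⁻ x, M t x ^ κ * nuDensity ω κ x := by
        rw [lintegral_const_mul _ (Finset.measurable_fun_sum _ fun t _ => hM t),
          lintegral_finsetSum _ fun t _ => hM t]
        congr 1
        refine Finset.sum_congr rfl fun t _ => ?_
        change ∫⁻ x, M t x ^ κ ∂volume.withDensity (nuDensity ω κ) = _
        rw [lintegral_withDensity_eq_lintegral_mul₀ (aemeasurable_nuDensity hω κ)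
          (hM t).aemeasurable]
        exact lintegral_congr fun x => mul_comm _ _
    _ ≤ _ := by
        gcongr
        calc ∑ t, ∫⁻ x, M t x ^ κ * nuDensity ω κ x ≤ ∑ _t : Fin n → Bool, B :=
              Finset.sum_le_sum fun t _ => lintegral_familyMax_le (countable_grid t)
                (fun Q hQ => by obtain ⟨⟨k, j⟩, rfl⟩ := hQ; exact measurableSet_halfCube _ _) hκ _
                (aemeasurable_nuDensity hω κ) (hB t)
          _ = 2 ^ n * B := by simp

theorem eLpNorm_nuMeasure_zero (h0 : nuMeasure ω κ = 0) {F : Type*} [TopologicalSpace F] [ENorm F]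
    (g : E n → F) (r : ℝ≥0∞) : eLpNorm g r (nuMeasure ω κ) = 0 := by
  rw [h0]; exact eLpNorm_measure_zero

/-- The upper bound for the best power in the weighted inequality for the maximal operator. -/
theorem maximalPower_upperPower (h : FracExponents m n P β κ) :
    MaximalPower n P β κ (upperPower n P κ β) := by
  have hκ := h.κ_pos
  have : Nonempty (Fin m) := ⟨⟨0, h.m_pos⟩⟩
  set θ := 1 - β / (m * n)
  set M := ⨆ i, (P i).conjExponent
  -- The characteristic will occur to the power L = θM in the κ-th power of the norm, so the final
  -- exponent is θM/κ.
  obtain ⟨hL, q, hpq, hqκ, hLq⟩ := h.exists_split (M := M) fun i =>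
    le_ciSup (f := fun i => (P i).conjExponent) (Set.finite_range _).bddAbove i
  have hP0 : ∀ i, 0 < P i := fun i => zero_lt_one.trans (h.one_lt i)
  have hq0 : ∀ i, 0 < q i := fun i => (hP0 i).trans_le (hpq i)
  set C₁ : ℝ≥0∞ := eexp ((θ * M - 1) * (κ * (Fintype.card (Fin m) * θ) * Real.log 2))
  set C₂ : ℝ≥0∞ := ∏ i, ENNReal.ofReal (P i / (P i - 1) * 2 ^ P i) ^ (κ / q i)
  set C : ℝ≥0∞ := (gridFactor m n θ ^ κ * (2 ^ n * ((2 ^ Fintype.card (Fin m)) ^ κ * (C₁ * C₂)))) ^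
    (1 / κ)
  have hC : C ≠ ∞ := by
    refine ENNReal.rpow_ne_top_of_nonneg (by positivity) (ENNReal.mul_ne_top
      (ENNReal.rpow_ne_top_of_nonneg hκ.le (gridFactor_ne_top m n h.theta_pos.le))
      (ENNReal.mul_ne_top (by simp) (ENNReal.mul_ne_top
      (ENNReal.rpow_ne_top_of_nonneg hκ.le (by simp)) (ENNReal.mul_ne_top (eexp_ne_top _)
      (ENNReal.prod_ne_top fun i _ => ENNReal.rpow_ne_top_of_nonneg (div_pos hκ (hq0 i)).le
        ENNReal.ofReal_ne_top)))))
  refine ⟨C.toNNReal, fun ω hω hA f hf => ?_⟩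
  rw [ENNReal.coe_toNNReal hC]
  rcases nu_dichotomy h hω hA with h0 | ⟨hω0, hfin⟩
  · rw [eLpNorm_nuMeasure_zero h0]; exact zero_le
  have hfm := aemeasurable_of_memWeighted hω hω0 hf
  refine (eLpNorm_fracMaximal_le h hω f fun t F hF =>
    (dualWeights h hω hω0).upper_bound_finset h.theta_pos h.theta_le_one h.mul_theta hpq hqκ hL hLq
      ((laminar_grid t).mono hF) (fun Q hQ => goodSet_of_mem_grid h hfin (hF hQ))
      (fun i => (hfm i).enorm)).trans (le_of_eq ?_)
  rw [Finset.prod_mul_distrib, prodNorm]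
  have hκ' : 0 ≤ 1 / κ := by positivity
  have e1 : ∀ i, eLpNorm (f i) (ENNReal.ofReal (P i)) (wMeasure (ω i) (P i)) =
      ((∫⁻ y, ‖f i y‖ₑ ^ P i * dualWeight P ω i y ^ (1 - P i)) ^ (κ / P i)) ^ (1 / κ) := fun i => by
    rw [eLpNorm_wMeasure h hω i (hfm i), ← ENNReal.rpow_mul]
    congr 1
    field_simp
  have e2 : apqConst P κ (wpow ω 1) ^ upperPower n P κ β =
      (apqConst P κ (wpow ω 1) ^ (θ * M)) ^ (1 / κ) := by
    rw [← ENNReal.rpow_mul]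
    congr 1
    simp only [upperPower, θ, M]; ring
  simp_rw [e1]
  rw [e2, ENNReal.prod_rpow_of_nonneg hκ', ← ENNReal.mul_rpow_of_nonneg _ _ hκ',
    ← ENNReal.mul_rpow_of_nonneg _ _ hκ']
  congr 1
  ring

/-- The majorant N is the maximal function of the dual weight restricted to the closed cube of R;
bounding its integral over R is the definition of the A_∞ constant. -/
theorem carleson_of_aInfty (h : FracExponents m n P β κ) (hω : ∀ i, AEMeasurable (ω i))
    (hfin : ∀ (a : E n) (l : ℝ), 0 < l →
      ∫⁻ y in cube a l, nuDensity ω κ y ≠ ∞ ∧ ∀ i, ∫⁻ y in cube a l, dualWeight P ω i y ≠ ∞)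
    {t : Fin n → Bool} (i : Fin m) {R : Set (E n)} (hR : R ∈ grid t) :
    ∃ N : E n → ℝ≥0∞, (∀ Q ∈ grid t, Q ⊆ R → ∀ x ∈ Q,
      (∫⁻ y in Q, dualWeight P ω i y) / volume Q ≤ N x) ∧
      ∫⁻ x in R, N x ≤ aInfty (dualWeight P ω i) * ∫⁻ y in R, dualWeight P ω i y := by
  obtain ⟨⟨k, j⟩, rfl⟩ := hR
  have hk : (0 : ℝ) < 2 ^ k := by positivity
  set R' := cube (gridCorner t k j) (2 ^ k)
  refine ⟨hardyLittlewood (R'.indicator (dualWeight P ω i)), ?_, ?_⟩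
  · rintro _ ⟨⟨k', j'⟩, rfl⟩ hsub x hx
    have hk' : (0 : ℝ) < 2 ^ k' := by positivity
    refine le_iSup_of_le (gridCorner t k' j') (le_iSup_of_le (2 ^ k') (le_iSup_of_le hk'
      (le_iSup_of_le (halfCube_subset_cube _ _ hx) ?_)))
    rw [avg]
    simp only [cell]
    rw [volume_halfCube, volume_cube]
    refine ENNReal.div_le_div_right ?_ _
    rw [← setLIntegral_halfCube]
    refine setLIntegral_mono_ae' (measurableSet_halfCube _ _) (.of_forall fun y hy => ?_)
    rw [Set.indicator_of_mem (halfCube_subset_cube _ _ (hsub hy))]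
  · simp only [cell, setLIntegral_halfCube]
    rw [← ENNReal.div_le_iff (avg_dualWeight_ne_zero h hω i _ hk) ((hfin _ _ hk).2 i)]
    exact le_iSup_of_le (gridCorner t k j) (le_iSup_of_le (2 ^ k) (le_iSup_of_le hk le_rfl))

/-- The mixed `A_(P,q)`-`A_∞` bound for the multilinear fractional maximal operator. -/
theorem eLpNorm_fracMaximal_le_mixed (h : FracExponents m n P β κ) :
    ∃ C : ℝ≥0, ∀ ω : Fin m → E n → ℝ≥0, (∀ i, AEMeasurable (ω i)) → InApq P κ (wpow ω 1) →
    ∀ f : Fin m → E n → ℂ, MemWeighted P ω f →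
      eLpNorm (fracMaximal β f) (ENNReal.ofReal κ) (nuMeasure ω κ) ≤
        C * (apqConst P κ (wpow ω 1) ^ (1 / κ) * ∏ i, aInfty (dualWeight P ω i) ^ (1 / P i)) *
          prodNorm P ω f := by
  have hκ := h.κ_pos
  have : Nonempty (Fin m) := ⟨⟨0, h.m_pos⟩⟩
  set θ := 1 - β / (m * n)
  have hP0 : ∀ i, 0 < P i := fun i => zero_lt_one.trans (h.one_lt i)
  set C₂ : ℝ≥0∞ := ∏ i, (ENNReal.ofReal (P i / (P i - 1) * 2 ^ P i) * 2) ^ (κ / P i)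
  set C : ℝ≥0∞ := (gridFactor m n θ ^ κ * (2 ^ n * ((2 ^ Fintype.card (Fin m)) ^ κ * C₂))) ^ (1 / κ)
  have hC : C ≠ ∞ := by
    refine ENNReal.rpow_ne_top_of_nonneg (by positivity) (ENNReal.mul_ne_top
      (ENNReal.rpow_ne_top_of_nonneg hκ.le (gridFactor_ne_top m n h.theta_pos.le))
      (ENNReal.mul_ne_top (by simp) (ENNReal.mul_ne_top
      (ENNReal.rpow_ne_top_of_nonneg hκ.le (by simp))
      (ENNReal.prod_ne_top fun i _ => ENNReal.rpow_ne_top_of_nonneg (div_pos hκ (hP0 i)).le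
        (ENNReal.mul_ne_top ENNReal.ofReal_ne_top (by simp))))))
  refine ⟨C.toNNReal, fun ω hω hA f hf => ?_⟩
  rw [ENNReal.coe_toNNReal hC]
  rcases nu_dichotomy h hω hA with h0 | ⟨hω0, hfin⟩
  · rw [eLpNorm_nuMeasure_zero h0]; exact zero_le
  have hfm := aemeasurable_of_memWeighted hω hω0 hf
  refine (eLpNorm_fracMaximal_le h hω f fun t F hF =>
    (dualWeights h hω hω0).mixed_bound_finset h.theta_pos h.theta_le_one h.mul_theta h.one_div_le
      ((laminar_grid t).mono hF) (fun Q hQ => goodSet_of_mem_grid h hfin (hF hQ))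
      (A := fun i => aInfty (dualWeight P ω i)) (fun i R hR => ?_)
      (fun i => (hfm i).enorm)).trans (le_of_eq ?_)
  · obtain ⟨N, h1, h2⟩ := carleson_of_aInfty h hω hfin i (hF hR)
    exact ⟨N, fun Q hQ => h1 Q (hF hQ), h2⟩
  rw [prodNorm]
  have hκ' : 0 ≤ 1 / κ := by positivity
  have e1 : ∀ i, eLpNorm (f i) (ENNReal.ofReal (P i)) (wMeasure (ω i) (P i)) =
      ((∫⁻ y, ‖f i y‖ₑ ^ P i * dualWeight P ω i y ^ (1 - P i)) ^ (κ / P i)) ^ (1 / κ) := fun i => by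
    rw [eLpNorm_wMeasure h hω i (hfm i), ← ENNReal.rpow_mul]
    congr 1
    field_simp
  have e2 : ∀ i, aInfty (dualWeight P ω i) ^ (1 / P i) =
      (aInfty (dualWeight P ω i) ^ (κ / P i)) ^ (1 / κ) := fun i => by
    rw [← ENNReal.rpow_mul]
    congr 1
    field_simp
  have e3 : ∀ i, (ENNReal.ofReal (P i / (P i - 1) * 2 ^ P i) * (2 * aInfty (dualWeight P ω i)) *
      ∫⁻ y, ‖f i y‖ₑ ^ P i * dualWeight P ω i y ^ (1 - P i)) ^ (κ / P i) =
      (ENNReal.ofReal (P i / (P i - 1) * 2 ^ P i) * 2) ^ (κ / P i) *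
      aInfty (dualWeight P ω i) ^ (κ / P i) *
      (∫⁻ y, ‖f i y‖ₑ ^ P i * dualWeight P ω i y ^ (1 - P i)) ^ (κ / P i) := fun i => by
    have := (div_pos hκ (hP0 i)).le
    rw [← mul_assoc, ENNReal.mul_rpow_of_nonneg _ _ this, ENNReal.mul_rpow_of_nonneg _ _ this]
  simp_rw [e1, e2, e3]
  rw [Finset.prod_mul_distrib, Finset.prod_mul_distrib, ENNReal.prod_rpow_of_nonneg hκ',
    ENNReal.prod_rpow_of_nonneg hκ', ← ENNReal.mul_rpow_of_nonneg _ _ hκ',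
    ← ENNReal.mul_rpow_of_nonneg _ _ hκ', ← ENNReal.mul_rpow_of_nonneg _ _ hκ']
  congr 1
  ring

end RoughFractional

/-! ### Power weights and the lower bound for admissible powers. -/

namespace RoughFractional
variable {m n : ℕ} {P : Fin m → ℝ} {β κ : ℝ} {ω : Fin m → E n → ℝ≥0}

theorem enorm_rpow_of_pos {F : Type*} [NormedAddCommGroup F] {x : F} (hx : x ≠ 0) (b : ℝ) :
    ‖x‖ₑ ^ b = ENNReal.ofReal (‖x‖ ^ b) := by
  rw [← ENNReal.ofReal_rpow_of_pos (norm_pos_iff.2 hx), ofReal_norm]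

/-- The constant in the integral of a power of the norm over a ball. -/
def ballConst (n : ℕ) : ℝ≥0∞ := n * volume (Metric.ball (0 : E n) 1)

theorem ballConst_ne_zero (hn : 0 < n) : ballConst n ≠ 0 :=
  mul_ne_zero (by exact_mod_cast hn.ne') (Metric.measure_ball_pos _ _ one_pos).ne'

theorem ballConst_ne_top : ballConst n ≠ ∞ :=
  ENNReal.mul_ne_top (by simp) measure_ball_lt_top.ne

theorem ae_ne_zero (hn : 0 < n) : ∀ᵐ x : E n, x ≠ 0 := by
  have : Nonempty (Fin n) := ⟨⟨0, hn⟩⟩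
  exact Measure.ae_ne volume 0

/-- Polar coordinates: the radial integrand becomes t^(η-1) on (0, D). -/
theorem lintegral_ball_enorm_rpow (hn : 0 < n) {η D : ℝ} (hη : 0 < η) (hD : 0 < D) :
    ∫⁻ x in Metric.ball (0 : E n) D, ‖x‖ₑ ^ (η - n) =
      ballConst n * (ENNReal.ofReal D ^ η / ENNReal.ofReal η) := by
  have : Nonempty (Fin n) := ⟨⟨0, hn⟩⟩
  set F : ℝ → ℝ := Set.indicator (Set.Iio D) fun y => y ^ (η - n)
  have hF : ∀ y ∈ Set.Ioi (0 : ℝ), y ^ (Module.finrank ℝ (E n) - 1) • F y =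
      Set.indicator (Set.Iio D) (fun y => y ^ (η - 1)) y := by
    intro y hy
    have hy0 : (0 : ℝ) < y := hy
    by_cases h : y < D
    · have hy' : y ∈ Set.Iio D := h
      simp only [F, Set.indicator_of_mem hy', finrank_euclideanSpace, Fintype.card_fin, smul_eq_mul]
      rw [← Real.rpow_natCast, ← Real.rpow_add hy0, Nat.cast_sub hn]
      congr 1; push_cast; ring
    · have hy' : y ∉ Set.Iio D := h
      simp [F, Set.indicator_of_notMem hy']
  have hIoo : Set.Ioi (0 : ℝ) ∩ Set.Iio D = Set.Ioo 0 D := by ext; simp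
  have hint0 : IntegrableOn (fun y : ℝ => y ^ (η - 1)) (Set.Ioo 0 D) :=
    (intervalIntegrable_iff_integrableOn_Ioo_of_le hD.le).1
      (intervalIntegral.intervalIntegrable_rpow' (by linarith))
  have hint : Integrable (fun x : E n => F ‖x‖) := by
    rw [integrable_fun_norm_addHaar, integrableOn_congr_fun hF measurableSet_Ioi, IntegrableOn,
      integrable_indicator_iff measurableSet_Iio, IntegrableOn,
      Measure.restrict_restrict measurableSet_Iio, Set.inter_comm, hIoo]
    exact hint0
  have hval : ∫ x : E n, F ‖x‖ = n * volume.real (Metric.ball (0 : E n) 1) * (D ^ η / η) := by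
    rw [integral_fun_norm_addHaar, setIntegral_congr_fun measurableSet_Ioi hF,
      setIntegral_indicator measurableSet_Iio, hIoo, ← integral_Ioc_eq_integral_Ioo,
      ← intervalIntegral.integral_of_le hD.le, integral_rpow (Or.inl (by linarith))]
    simp [Real.zero_rpow hη.ne', mul_assoc]
  have hnonneg : ∀ y : ℝ, 0 ≤ y → 0 ≤ F y := fun y hy =>
    Set.indicator_apply_nonneg fun _ => Real.rpow_nonneg hy _
  have e1 : ∫⁻ x in Metric.ball (0 : E n) D, ‖x‖ₑ ^ (η - n) = ∫⁻ x : E n, ENNReal.ofReal (F ‖x‖) := by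
    rw [← lintegral_indicator measurableSet_ball]
    refine lintegral_congr_ae ?_
    filter_upwards [ae_ne_zero hn] with x hx
    by_cases h : ‖x‖ < D
    · rw [Set.indicator_of_mem (by simpa using h), enorm_rpow_of_pos hx]
      simp only [F, Set.indicator_of_mem (show ‖x‖ ∈ Set.Iio D from h)]
    · rw [Set.indicator_of_notMem (by simpa using h)]
      simp only [F, Set.indicator_of_notMem (show ‖x‖ ∉ Set.Iio D from h), ENNReal.ofReal_zero]
  rw [e1, ← ofReal_integral_eq_lintegral_ofReal hint (.of_forall fun x => hnonneg _ (norm_nonneg x)),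
    hval, ENNReal.ofReal_mul (by positivity), ENNReal.ofReal_mul (by positivity),
    ENNReal.ofReal_div_of_pos hη, ENNReal.ofReal_rpow_of_pos hD, ENNReal.ofReal_natCast,
    ofReal_measureReal measure_ball_lt_top.ne, ballConst]

theorem norm_le_of_coord {y : E n} {l : ℝ} (hl : 0 ≤ l) (h : ∀ j, |y j| ≤ l) : ‖y‖ ≤ n * l := by
  rw [EuclideanSpace.norm_eq, Real.sqrt_le_left (by positivity)]
  calc ∑ i, ‖y i‖ ^ 2 ≤ ∑ _i : Fin n, l ^ 2 := by
        refine Finset.sum_le_sum fun i _ => ?_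
        rw [Real.norm_eq_abs]
        exact pow_le_pow_left₀ (abs_nonneg _) (h i) 2
    _ = n * l ^ 2 := by simp
    _ ≤ (n * l) ^ 2 := by
        rw [mul_pow]
        refine mul_le_mul_of_nonneg_right ?_ (sq_nonneg l)
        rcases Nat.eq_zero_or_pos n with rfl | hn
        · simp
        · have : (1 : ℝ) ≤ n := by exact_mod_cast hn
          nlinarith

/-- Take D = |a| + nl. If nl ≤ D/4 the cube is far from the origin, |x| ≥ D/2 on it, and the
integrand is essentially constant. Otherwise |Q| is comparable to D^n and the integral over the ball
of radius 2D contains the whole singularity, which costs 1/η. The constant C does not depend on η.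
-/
theorem exists_avg_enorm_rpow_le (hn : 0 < n) : ∃ C : ℝ≥0∞, C ≠ ∞ ∧ ∀ (η : ℝ), 0 < η → η < 1 →
    ∀ (a : E n) (l : ℝ), 0 < l → ∃ D : ℝ≥0∞, D ≠ 0 ∧ D ≠ ∞ ∧ (∀ x ∈ cube a l, ‖x‖ₑ ≤ D) ∧
      (∫⁻ x in cube a l, ‖x‖ₑ ^ (η - n)) / volume (cube a l) ≤
        C * D ^ (η - n) / ENNReal.ofReal η := by
  have hn1 : (1 : ℝ) ≤ n := by exact_mod_cast hn
  refine ⟨2 ^ n + ballConst n * (2 * (4 * n) ^ n), ENNReal.add_ne_top.2 ⟨by simp,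
    ENNReal.mul_ne_top ballConst_ne_top (ENNReal.mul_ne_top (by simp)
      (ENNReal.pow_ne_top (ENNReal.mul_ne_top (by simp) (by simp))))⟩, fun η hη hη1 a l hl => ?_⟩
  set d := ‖a‖ + n * l with hd
  have hd0 : 0 < d := by positivity
  have hdist : ∀ x ∈ cube a l, ‖x - a‖ ≤ n * l := fun x hx => by
    refine norm_le_of_coord hl.le fun j => ?_
    have := hx j
    rw [PiLp.sub_apply, abs_le]
    exact ⟨by linarith [this.1], by linarith [this.2]⟩
  have hle : ∀ x ∈ cube a l, ‖x‖ ≤ d := fun x hx => by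
    have h1 := norm_add_le a (x - a)
    rw [add_sub_cancel] at h1
    linarith [hdist x hx]
  have hD0 : ENNReal.ofReal d ≠ 0 := by simpa using hd0
  refine ⟨ENNReal.ofReal d, hD0, ENNReal.ofReal_ne_top, fun x hx => ?_, ?_⟩
  · rw [← ofReal_norm]; exact ENNReal.ofReal_le_ofReal (hle x hx)
  have hη1' : 1 ≤ (ENNReal.ofReal η)⁻¹ := by
    rw [ENNReal.one_le_inv]; simpa using hη1.le
  rcases le_or_gt (n * l) (d / 4) with h | h
  · have hpt : ∀ x ∈ cube a l, ‖x‖ₑ ^ (η - n) ≤ 2 ^ n * ENNReal.ofReal d ^ (η - n) := by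
      intro x hx
      have h1 : d / 2 ≤ ‖x‖ := by
        have h1 := norm_sub_norm_le a x
        rw [norm_sub_rev] at h1
        linarith [hdist x hx]
      have h2 : ENNReal.ofReal d / 2 ≤ ‖x‖ₑ := by
        have e : ENNReal.ofReal (d / 2) = ENNReal.ofReal d / 2 := by
          rw [ENNReal.ofReal_div_of_pos (by norm_num)]; simp
        rw [← ofReal_norm, ← e]
        exact ENNReal.ofReal_le_ofReal h1
      rw [show η - n = -(n - η) by ring, ENNReal.rpow_neg, ENNReal.rpow_neg, ← div_eq_mul_inv,
        ENNReal.inv_le_iff_inv_le]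
      refine le_trans ?_ (ENNReal.rpow_le_rpow h2 (by linarith))
      rw [ENNReal.div_rpow_of_nonneg _ _ (by linarith), ENNReal.inv_div (by simp) (by simp)]
      refine ENNReal.div_le_div_left ?_ _
      rw [← ENNReal.rpow_natCast]
      exact ENNReal.rpow_le_rpow_of_exponent_le (by norm_num) (by linarith)
    rw [ENNReal.div_le_iff (volume_cube_ne_zero a hl) (volume_cube_ne_top a l)]
    calc ∫⁻ x in cube a l, ‖x‖ₑ ^ (η - n)
        ≤ ∫⁻ _ in cube a l, 2 ^ n * ENNReal.ofReal d ^ (η - n) :=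
          setLIntegral_mono' (measurableSet_cube a l) hpt
      _ = 2 ^ n * ENNReal.ofReal d ^ (η - n) * 1 * volume (cube a l) := by
          rw [setLIntegral_const, mul_one]
      _ ≤ _ := by
          rw [div_eq_mul_inv]
          gcongr
          exact le_self_add
  · have hsub : cube a l ⊆ Metric.ball (0 : E n) (2 * d) := fun x hx => by
      rw [mem_ball_zero_iff]; linarith [hle x hx]
    have hvol : (volume (cube a l))⁻¹ ≤ (4 * n) ^ n * ENNReal.ofReal d ^ (-(n : ℝ)) := by
      rw [volume_cube, ENNReal.rpow_neg, ENNReal.rpow_natCast, ← div_eq_mul_inv,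
        ENNReal.inv_le_iff_inv_le, ENNReal.inv_div (by simp)
          (Or.inl (pow_ne_zero _ (by simpa using hd0))), div_eq_mul_inv, ENNReal.inv_pow, ← mul_pow,
        ← div_eq_mul_inv]
      refine pow_le_pow_left' ?_ n
      rw [show (4 * n : ℝ≥0∞) = ENNReal.ofReal (4 * n) by
        rw [ENNReal.ofReal_mul (by norm_num)]; simp, ← ENNReal.ofReal_div_of_pos (by positivity)]
      refine ENNReal.ofReal_le_ofReal ?_
      rw [div_le_iff₀ (by positivity)]
      linarith
    calc (∫⁻ x in cube a l, ‖x‖ₑ ^ (η - n)) / volume (cube a l)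
        ≤ (∫⁻ x in Metric.ball (0 : E n) (2 * d), ‖x‖ₑ ^ (η - n)) * (volume (cube a l))⁻¹ := by
          rw [div_eq_mul_inv]; gcongr
      _ ≤ ballConst n * (2 * ENNReal.ofReal d ^ η / ENNReal.ofReal η) *
            ((4 * n) ^ n * ENNReal.ofReal d ^ (-(n : ℝ))) := by
          rw [lintegral_ball_enorm_rpow hn hη (by positivity), ENNReal.ofReal_mul (by norm_num),
            ENNReal.mul_rpow_of_nonneg _ _ hη.le]
          gcongr
          rw [show ENNReal.ofReal 2 = 2 by simp]
          nth_rw 2 [← ENNReal.rpow_one 2]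
          exact ENNReal.rpow_le_rpow_of_exponent_le (by norm_num) hη1.le
      _ = ballConst n * (2 * (4 * n) ^ n) * ENNReal.ofReal d ^ (η - n) / ENNReal.ofReal η := by
          rw [sub_eq_add_neg, ENNReal.rpow_add _ _ hD0 ENNReal.ofReal_ne_top, div_eq_mul_inv,
            div_eq_mul_inv]
          ring
      _ ≤ _ := by
          gcongr
          exact le_add_self

theorem prod_rpow_eq_rpow_sum {ι : Type*} (s : Finset ι) (x : ℝ≥0∞) {b : ι → ℝ}
    (hb : ∀ i ∈ s, 0 ≤ b i) : ∏ i ∈ s, x ^ b i = x ^ ∑ i ∈ s, b i := by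
  classical
  induction s using Finset.induction_on with
  | empty => simp
  | insert a s ha ih =>
    rw [Finset.prod_insert ha, Finset.sum_insert ha, ih fun i hi => hb i (Finset.mem_insert_of_mem hi),
      ENNReal.rpow_add_of_nonneg _ _ (hb a (Finset.mem_insert_self _ _))
        (Finset.sum_nonneg fun i hi => hb i (Finset.mem_insert_of_mem hi))]

/-- Growth rates are compared as τ → ∞: a fixed ratio of constants cannot compensate a positive
difference a - b. -/
theorem le_of_forall_eexp_le {A B : ℝ≥0∞} (hA : A ≠ 0) (hB : B ≠ ∞) {a b : ℝ}
    (h : ∀ τ : ℝ, 0 < τ → A * eexp (τ * a) ≤ B * eexp (τ * b)) : a ≤ b := by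
  have hAt : A ≠ ∞ := by
    rintro rfl
    have := h 1 one_pos
    rw [ENNReal.top_mul (eexp_ne_zero _), top_le_iff] at this
    exact ENNReal.mul_ne_top hB (eexp_ne_top _) this
  obtain ⟨x, rfl⟩ := exists_eexp hA hAt
  obtain ⟨y, hy⟩ := exists_eexp (y := B + 1) (by simp) (by simpa using hB)
  by_contra! hlt
  have hd : 0 < a - b := by linarith
  have h1 : 0 < (|y - x| + 1) / (a - b) := by positivity
  have h2 := (h _ h1).trans (mul_le_mul_left (le_self_add (b := 1)) _)
  rw [hy, ← eexp_add, ← eexp_add, eexp_le_eexp] at h2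
  have h3 : (|y - x| + 1) / (a - b) * a - (|y - x| + 1) / (a - b) * b = |y - x| + 1 := by
    field_simp
  linarith [le_abs_self (y - x)]

/-- The power weights that are extremal for the maximal operator. -/
def powerWeight (P : Fin m → ℝ) (η : ℝ) : Fin m → E n → ℝ≥0 :=
  fun i x => ‖x‖₊ ^ ((n - η) * (1 - 1 / P i))

/-- The functions that are extremal for the maximal operator. -/
def powerFun (m n : ℕ) (η : ℝ) : Fin m → E n → ℂ :=
  fun _ => (Metric.ball (0 : E n) 1).indicator fun x => ((‖x‖ ^ (η - n) : ℝ) : ℂ)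

section PowerWeight
variable {η : ℝ}

theorem sub_pos_of_lt_one (h : FracExponents m n P β κ) (hη1 : η < 1) : 0 < (n : ℝ) - η := by
  have : (1 : ℝ) ≤ n := by exact_mod_cast h.n_pos
  linarith

theorem coe_powerWeight (h : FracExponents m n P β κ) (hη1 : η < 1) (i : Fin m) (x : E n) :
    (powerWeight P η i x : ℝ≥0∞) = ‖x‖ₑ ^ ((n - η) * (1 - 1 / P i)) := by
  rw [powerWeight, ENNReal.coe_rpow_of_nonneg _
    (mul_pos (sub_pos_of_lt_one h hη1) (h.inv_pos i)).le]
  rfl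

theorem aemeasurable_powerWeight (i : Fin m) : AEMeasurable (powerWeight (n := n) P η i) :=
  (measurable_nnnorm.pow_const _).aemeasurable

theorem nuDensity_powerWeight (h : FracExponents m n P β κ) (hη1 : η < 1) (x : E n) :
    nuDensity (powerWeight P η) κ x = ‖x‖ₑ ^ (κ * ((n - η) * ∑ i, (1 - 1 / P i))) := by
  simp_rw [nuDensity, coe_powerWeight h hη1]
  rw [prod_rpow_eq_rpow_sum _ _ fun i _ => (mul_pos (sub_pos_of_lt_one h hη1) (h.inv_pos i)).le,
    ← Finset.mul_sum, ← ENNReal.rpow_mul, mul_comm κ]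

theorem dualWeight_powerWeight (h : FracExponents m n P β κ) (hη1 : η < 1) (i : Fin m) (x : E n) :
    dualWeight P (powerWeight P η) i x = ‖x‖ₑ ^ (η - n) := by
  rw [dualWeight, wpow, coe_powerWeight h hη1, ← ENNReal.rpow_mul]
  congr 1
  linear_combination -(n - η) * h.conj_mul i

/-- On a cube the ν-average is at most a power of D, since its exponent is nonnegative, and each
dual average is at most (C/η) D^(η-n). The powers of D cancel, leaving only a power of 1/η. -/
theorem apqConst_powerWeight_le (h : FracExponents m n P β κ) :
    ∃ C : ℝ≥0∞, C ≠ ∞ ∧ ∀ η : ℝ, 0 < η → η < 1 → apqConst P κ (wpow (powerWeight (n := n) P η) 1) ≤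
      (C / ENNReal.ofReal η) ^ (κ * ∑ i, (1 - 1 / P i)) := by
  obtain ⟨C, hC, hle⟩ := exists_avg_enorm_rpow_le h.n_pos
  refine ⟨C, hC, fun η hη hη1 => iSup_le fun a => iSup_le fun l => iSup_le fun hl => ?_⟩
  have hκ := h.κ_pos
  have hnη := sub_pos_of_lt_one h hη1
  obtain ⟨D, hD0, hDt, hD, havg⟩ := hle η hη hη1 a l hl
  set S := ∑ i, (1 - 1 / P i)
  have hS : 0 ≤ S := Finset.sum_nonneg fun i _ => (h.inv_pos i).le
  have e0 : ∀ i, κ / (P i).conjExponent = κ * (1 - 1 / P i) := fun i => by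
    rw [div_eq_iff (h.conj_pos i).ne', mul_assoc, mul_comm (1 - 1 / P i), h.conj_mul i, mul_one]
  have h1 : avg (cube a l) (fun y => (∏ i, wpow (powerWeight P η) 1 i y) ^ κ) ≤
      D ^ (κ * ((n - η) * S)) := by
    rw [wpow_one]
    change (∫⁻ y in cube a l, nuDensity (powerWeight P η) κ y) / volume (cube a l) ≤ _
    rw [ENNReal.div_le_iff (volume_cube_ne_zero a hl) (volume_cube_ne_top a l), ← setLIntegral_const]
    refine setLIntegral_mono' (measurableSet_cube a l) fun y hy => ?_
    rw [nuDensity_powerWeight h hη1]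
    exact ENNReal.rpow_le_rpow (hD y hy) (by positivity)
  have h2 : ∀ i, avg (cube a l) (fun y => wpow (powerWeight P η) 1 i y ^ (-(P i).conjExponent)) ^
      (κ / (P i).conjExponent) ≤ (C / ENNReal.ofReal η * D ^ (η - n)) ^ (κ * (1 - 1 / P i)) := by
    intro i
    rw [wpow_one, e0]
    refine ENNReal.rpow_le_rpow ?_ (mul_pos hκ (h.inv_pos i)).le
    change (∫⁻ y in cube a l, dualWeight P (powerWeight P η) i y) / volume (cube a l) ≤ _
    simp_rw [dualWeight_powerWeight h hη1]
    refine havg.trans (le_of_eq ?_)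
    rw [div_eq_mul_inv, div_eq_mul_inv, mul_right_comm]
  refine (mul_le_mul' h1 (Finset.prod_le_prod' fun i _ => h2 i)).trans (le_of_eq ?_)
  rw [prod_rpow_eq_rpow_sum _ _ fun i _ => (mul_pos hκ (h.inv_pos i)).le, ← Finset.mul_sum,
    ENNReal.mul_rpow_of_nonneg _ _ (by positivity), mul_left_comm, ← ENNReal.rpow_mul,
    ← ENNReal.rpow_add _ _ hD0 hDt, show κ * ((n - η) * S) + (η - n) * (κ * S) = 0 by ring,
    ENNReal.rpow_zero, mul_one]

theorem enorm_powerFun (hn : 0 < n) (i : Fin m) : ∀ᵐ x : E n, ‖powerFun m n η i x‖ₑ =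
    (Metric.ball (0 : E n) 1).indicator (fun x => ‖x‖ₑ ^ (η - n)) x := by
  filter_upwards [ae_ne_zero hn] with x hx
  by_cases hx1 : x ∈ Metric.ball (0 : E n) 1
  · rw [powerFun, Set.indicator_of_mem hx1, Set.indicator_of_mem hx1, enorm_rpow_of_pos hx,
      ← ofReal_norm, Complex.norm_real, Real.norm_of_nonneg (by positivity)]
  · rw [powerFun, Set.indicator_of_notMem hx1, Set.indicator_of_notMem hx1, enorm_zero]

theorem measurable_powerFun (i : Fin m) : Measurable (powerFun m n η i) :=
  (Complex.measurable_ofReal.comp (measurable_norm.pow_const _)).indicator measurableSet_ball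

theorem eLpNorm_powerFun (h : FracExponents m n P β κ) (hη : 0 < η) (hη1 : η < 1) (i : Fin m) :
    eLpNorm (powerFun m n η i) (ENNReal.ofReal (P i)) (wMeasure (powerWeight P η i) (P i)) =
      (ballConst n / ENNReal.ofReal η) ^ (1 / P i) := by
  have hP : 0 < P i := zero_lt_one.trans (h.one_lt i)
  rw [eLpNorm_wMeasure h aemeasurable_powerWeight i (measurable_powerFun i).aestronglyMeasurable]
  congr 1
  have := lintegral_ball_enorm_rpow h.n_pos hη one_pos
  rw [ENNReal.ofReal_one, ENNReal.one_rpow, mul_one_div] at this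
  rw [← this, ← lintegral_indicator measurableSet_ball]
  refine lintegral_congr_ae ?_
  filter_upwards [enorm_powerFun h.n_pos i, ae_ne_zero h.n_pos] with x hx hx0
  rw [hx, dualWeight_powerWeight h hη1]
  by_cases hx1 : x ∈ Metric.ball (0 : E n) 1
  · rw [Set.indicator_of_mem hx1, ← ENNReal.rpow_mul, ← ENNReal.rpow_mul,
      ← ENNReal.rpow_add _ _ (by simpa using hx0) enorm_ne_top]
    congr 1; ring
  · rw [Set.indicator_of_notMem hx1, ENNReal.zero_rpow_of_pos hP, zero_mul]

/-- Test on the cube centred at the origin with half side |x|. It contains the ball of radius |x|,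
where each function has mass proportional to |x|^η / η. -/
theorem fracMaximal_powerFun_ge (h : FracExponents m n P β κ) (hη : 0 < η) {x : E n} (hx : x ≠ 0)
    (hx1 : ‖x‖ < 1) :
    (ballConst n / ENNReal.ofReal η / 2 ^ (n * (1 - β / (m * n)))) ^ m *
      ‖x‖ₑ ^ (m * (η - n * (1 - β / (m * n)))) ≤ fracMaximal β (powerFun m n η) x := by
  set θ := 1 - β / (m * n) with hθ
  have hx0 : 0 < ‖x‖ := norm_pos_iff.2 hx
  set a : E n := -WithLp.toLp 2 fun _ => ‖x‖
  have hmem : ∀ y : E n, ‖y‖ ≤ ‖x‖ → y ∈ cube a (2 * ‖x‖) := fun y hy j => by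
    have h1 := (PiLp.norm_apply_le y j).trans hy
    rw [Real.norm_eq_abs, abs_le] at h1
    simp only [a, Set.mem_Icc, PiLp.neg_apply]
    exact ⟨by linarith, by linarith⟩
  have hf : ∀ i, ballConst n * (‖x‖ₑ ^ η / ENNReal.ofReal η) ≤
      ∫⁻ y in cube a (2 * ‖x‖), ‖powerFun m n η i y‖ₑ := fun i => by
    rw [← ofReal_norm x, ← lintegral_ball_enorm_rpow h.n_pos hη hx0]
    refine le_trans (le_of_eq ?_) (lintegral_mono_set (s := Metric.ball 0 ‖x‖) fun y hy =>
      hmem y (mem_ball_zero_iff.1 hy).le)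
    refine setLIntegral_congr_fun_ae measurableSet_ball ?_
    filter_upwards [enorm_powerFun (m := m) (η := η) h.n_pos i] with y hy hy1
    rw [hy, Set.indicator_of_mem]
    exact Metric.ball_subset_ball hx1.le hy1
  have hvol : volume (cube a (2 * ‖x‖)) ^ θ = 2 ^ (n * θ) * ‖x‖ₑ ^ (n * θ) := by
    rw [volume_cube, ENNReal.ofReal_mul (by norm_num), ofReal_norm, ← ENNReal.rpow_natCast,
      ← ENNReal.rpow_mul, ENNReal.mul_rpow_of_nonneg _ _ (mul_nonneg n.cast_nonneg h.theta_pos.le),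
      show ENNReal.ofReal 2 = 2 by simp]
  refine le_trans ?_ (le_iSup_of_le a (le_iSup_of_le (2 * ‖x‖) (le_iSup_of_le (by positivity)
    (le_iSup_of_le (hmem x le_rfl) (Finset.prod_le_prod' fun i _ =>
      ENNReal.div_le_div_right (hf i) _)))))
  have hpow : ‖x‖ₑ ^ (m * (η - n * θ)) = (‖x‖ₑ ^ (η - n * θ)) ^ m := by
    rw [← ENNReal.rpow_natCast, ← ENNReal.rpow_mul, mul_comm]
  rw [Finset.prod_const, Finset.card_univ, Fintype.card_fin, hvol, hpow, ← mul_pow]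
  refine le_of_eq ?_
  congr 1
  rw [ENNReal.rpow_sub _ _ (by simpa using hx) enorm_ne_top]
  simp only [div_eq_mul_inv]
  rw [ENNReal.mul_inv (by simp) (by simp)]
  ring

/-- Hölder for the duality relation on a single cube. It makes powers of the characteristic
increasing in the exponent. -/
theorem one_le_apqConst (h : FracExponents m n P β κ) (hω : ∀ i, AEMeasurable (ω i))
    (hω0 : ∀ i, ∀ᵐ x, ω i x ≠ 0) (hA : InApq P κ (wpow ω 1)) : 1 ≤ apqConst P κ (wpow ω 1) := by
  have hκ := h.κ_pos
  have hD := dualWeights h hω hω0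
  have hv0 := volume_cube_ne_zero (0 : E n) one_pos
  have hvt := volume_cube_ne_top (0 : E n) 1
  have hu0 := setLIntegral_ne_zero_of_ae hD.aemeasurable_u hD.u_ne_zero hv0
  obtain ⟨hut, hst⟩ := cube_finite h hω hA 0 one_pos hu0
  have hs0 := fun i => setLIntegral_ne_zero_of_ae (hD.aemeasurable_w i) (hD.w_ne_zero i) hv0
  have hH := hD.measure_rpow_le h.mul_theta (cube 0 1)
  refine le_trans ?_ (le_apqConst h (0 : E n) one_pos)
  obtain ⟨U, hU⟩ := exists_eexp hu0 hut
  obtain ⟨v, hv⟩ := exists_eexp hv0 hvt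
  choose s hs using fun i => exists_eexp (hs0 i) (hst i)
  simp_rw [hU, hv, hs] at hH ⊢
  simp_rw [← eexp_sub, eexp_rpow, ← eexp_sum, ← eexp_add] at hH ⊢
  rw [← eexp_zero, eexp_le_eexp]
  rw [eexp_le_eexp, h.mul_theta, mul_add, Finset.mul_sum] at hH
  have h1 := mul_le_mul_of_nonneg_left hH hκ.le
  have h2 : ∑ i, (s i - v) * (κ * (1 - 1 / P i)) =
      κ * ∑ i, s i * (1 - 1 / P i) - κ * ∑ i, v * (1 - 1 / P i) := by
    rw [Finset.mul_sum, Finset.mul_sum, ← Finset.sum_sub_distrib]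
    exact Finset.sum_congr rfl fun i _ => by ring
  rw [mul_add, mul_add] at h1
  have h3 : κ * (U * (1 / κ)) = U := by field_simp
  have h4 : κ * (v * (1 / κ)) = v := by field_simp
  rw [h3, h4] at h1
  rw [h2]
  linarith

/-- With S = Σ 1/p_i', the maximal function contributes η^(-m) pointwise, and the remaining
integrand |x|^(κη/p - n) contributes a further η^(-1/κ) after the root. On the other side the
characteristic gives η^(-κSγ) and the norms η^(-1/p). Hence κSγ ≥ m + 1/κ - 1/p = mθ. -/
theorem lowerPower_le (h : FracExponents m n P β κ) {p : ℝ} (hp : 1 / p = ∑ i, 1 / P i) {γ : ℝ}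
    (hγ : MaximalPower n P β κ γ) : lowerPower m n p κ β ≤ γ := by
  obtain ⟨C, hC⟩ := hγ
  obtain ⟨C₁, hC₁, hapq⟩ := apqConst_powerWeight_le h
  have hκ := h.κ_pos
  have hm : (0 : ℝ) < m := by exact_mod_cast h.m_pos
  set θ := 1 - β / (m * n) with hθ
  set S := ∑ i, (1 - 1 / P i) with hS
  have hθ0 : 0 < θ := h.theta_pos
  have hmθ : m * θ = 1 / κ + S := by have := h.mul_theta; rwa [Fintype.card_fin] at this
  have hSp : S = m - 1 / p := by rw [hS, Finset.sum_sub_distrib, hp]; simp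
  have : Nonempty (Fin m) := ⟨⟨0, h.m_pos⟩⟩
  have hS0 : 0 < S := Finset.sum_pos (fun i _ => h.inv_pos i) Finset.univ_nonempty
  have hp0 : 0 < 1 / p := by
    rw [hp]; exact Finset.sum_pos (fun i _ => one_div_pos.2 (zero_lt_one.trans (h.one_lt i)))
      Finset.univ_nonempty
  -- The upper bound for the characteristic can only be raised to a nonnegative power. The
  -- characteristic is at least 1, so γ may be increased to g; since the bound reached for g is
  -- positive, it also holds for γ.
  set g := max γ 0
  have hn := h.n_pos
  have key : ∀ τ : ℝ, 0 < τ →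
      (ballConst n / 2 ^ (n * θ)) ^ m * (ballConst n / ENNReal.ofReal (κ * (1 / p))) ^ (1 / κ) *
        eexp (τ * (m + 1 / κ)) ≤
      C * C₁ ^ (κ * S * g) * ballConst n ^ (1 / p) * eexp (τ * (κ * S * g + 1 / p)) := by
    intro τ hτ
    -- This substitution turns powers of 1/η into `eexp` of multiples of τ, as
    -- `le_of_forall_eexp_le` requires.
    set η := Real.exp (-τ) with hηdef
    have hη : 0 < η := Real.exp_pos _
    have hη1 : η < 1 := by rw [hηdef, Real.exp_lt_one_iff]; linarith
    have hηe : ENNReal.ofReal η = eexp (-τ) := rfl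
    have hinv : (ENNReal.ofReal η)⁻¹ = eexp τ := by rw [hηe, ← eexp_neg, neg_neg]
    have hA : InApq P κ (wpow (powerWeight (n := n) P η) 1) := by
      refine (hapq η hη hη1).trans_lt (ENNReal.rpow_lt_top_of_nonneg (by positivity) ?_)
      exact ENNReal.div_ne_top hC₁ (by simpa using hη)
    have hω0 : ∀ i : Fin m, ∀ᵐ x : E n, powerWeight P η i x ≠ 0 := fun i => by
      filter_upwards [ae_ne_zero hn] with x hx
      simp [powerWeight, NNReal.rpow_eq_zero_iff, hx]
    have hf : MemWeighted P (powerWeight P η) (powerFun m n η) := fun i =>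
      ⟨(measurable_powerFun i).aestronglyMeasurable, by
        rw [eLpNorm_powerFun h hη hη1]
        have := h.one_lt i
        exact ENNReal.rpow_lt_top_of_nonneg (by positivity)
          (ENNReal.div_ne_top ballConst_ne_top (by simpa using hη))⟩
    have hmain := hC _ aemeasurable_powerWeight hA _ hf
    have hprod : prodNorm P (powerWeight P η) (powerFun m n η) =
        ballConst n ^ (1 / p) * eexp (τ * (1 / p)) := by
      simp_rw [prodNorm, eLpNorm_powerFun h hη hη1]
      rw [prod_rpow_eq_rpow_sum _ _ fun i _ => by have := h.one_lt i; positivity, ← hp,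
        div_eq_mul_inv, hinv, ENNReal.mul_rpow_of_nonneg _ _ hp0.le, eexp_rpow]
    have hpow : apqConst P κ (wpow (powerWeight (n := n) P η) 1) ^ γ ≤
        C₁ ^ (κ * S * g) * eexp (τ * (κ * S * g)) := by
      calc _ ≤ apqConst P κ (wpow (powerWeight (n := n) P η) 1) ^ g :=
            ENNReal.rpow_le_rpow_of_exponent_le
              (one_le_apqConst h aemeasurable_powerWeight hω0 hA) (le_max_left _ _)
        _ ≤ ((C₁ / ENNReal.ofReal η) ^ (κ * S)) ^ g :=
            ENNReal.rpow_le_rpow (hapq η hη hη1) (le_max_right _ _)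
        _ = _ := by
            rw [← ENNReal.rpow_mul, div_eq_mul_inv, hinv, ENNReal.mul_rpow_of_nonneg _ _
              (mul_nonneg (by positivity) (le_max_right _ _)), eexp_rpow]
    have hlow : (ballConst n / 2 ^ (n * θ)) ^ m *
        (ballConst n / ENNReal.ofReal (κ * (1 / p))) ^ (1 / κ) * eexp (τ * (m + 1 / κ)) ≤
        eLpNorm (fracMaximal β (powerFun m n η)) (ENNReal.ofReal κ)
          (nuMeasure (powerWeight P η) κ) := by
      rw [eLpNorm_eq_lintegral_rpow_enorm_toReal (by simpa using hκ) ENNReal.ofReal_ne_top,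
        ENNReal.toReal_ofReal hκ.le]
      set A := ballConst n / ENNReal.ofReal η / 2 ^ (n * θ)
      have hη' : 0 < κ * (1 / p) * η := by positivity
      have hI := lintegral_ball_enorm_rpow hn hη' one_pos
      rw [ENNReal.ofReal_one, ENNReal.one_rpow, mul_one_div (ballConst n)] at hI
      have hmb : Measurable fun x : E n => ‖x‖ₑ ^ (κ * (m * (η - n * θ))) := by fun_prop
      have hstep : (A ^ m) ^ κ * (ballConst n / ENNReal.ofReal (κ * (1 / p) * η)) ≤
          ∫⁻ x, ‖fracMaximal β (powerFun m n η) x‖ₑ ^ κ ∂nuMeasure (powerWeight P η) κ := by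
        calc _ = ∫⁻ x in Metric.ball (0 : E n) 1, (A ^ m) ^ κ * ‖x‖ₑ ^ (κ * (m * (η - n * θ)))
                ∂nuMeasure (powerWeight P η) κ := by
              rw [lintegral_const_mul _ hmb, ← hI]
              congr 1
              rw [nuMeasure]
              change _ = ∫⁻ x in Metric.ball (0 : E n) 1, ‖x‖ₑ ^ (κ * (m * (η - n * θ)))
                ∂(volume.withDensity (nuDensity (powerWeight P η) κ))
              rw [setLIntegral_withDensity_eq_lintegral_mul₀
                (aemeasurable_nuDensity aemeasurable_powerWeight κ) hmb.aemeasurable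
                measurableSet_ball]
              refine lintegral_congr_ae (ae_restrict_of_ae ?_)
              filter_upwards [ae_ne_zero hn] with x hx
              rw [Pi.mul_apply, nuDensity_powerWeight h hη1,
                ← ENNReal.rpow_add _ _ (by simpa using hx) enorm_ne_top]
              congr 1
              have e1 : n * (m * θ) = n * (1 / κ + S) := by rw [hmθ]
              have e2 : κ * (1 / κ) = 1 := by field_simp
              rw [← hS]
              linear_combination κ * e1 + n * e2 + κ * η * hSp
          _ ≤ ∫⁻ x in Metric.ball (0 : E n) 1, ‖fracMaximal β (powerFun m n η) x‖ₑ ^ κ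
                ∂nuMeasure (powerWeight P η) κ := by
              refine lintegral_mono_ae ?_
              have hac : ∀ᵐ x ∂nuMeasure (powerWeight P η) κ, x ≠ (0 : E n) :=
                (withDensity_absolutelyContinuous _ _).ae_le (ae_ne_zero hn)
              filter_upwards [ae_restrict_of_ae hac, ae_restrict_mem measurableSet_ball] with x hx hx1
              rw [enorm_eq_self, mul_comm κ, ENNReal.rpow_mul, ← ENNReal.mul_rpow_of_nonneg _ _ hκ.le]
              exact ENNReal.rpow_le_rpow (fracMaximal_powerFun_ge h hη hx
                (mem_ball_zero_iff.1 hx1)) hκ.le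
          _ ≤ _ := setLIntegral_le_lintegral _ _
      refine le_trans (le_of_eq ?_) (ENNReal.rpow_le_rpow hstep (by positivity : 0 ≤ 1 / κ))
      have e1 : A = ballConst n / 2 ^ (n * θ) * eexp τ := by
        simp only [A, div_eq_mul_inv, hinv]; ring
      have e2 : ballConst n / ENNReal.ofReal (κ * (1 / p) * η) =
          ballConst n / ENNReal.ofReal (κ * (1 / p)) * eexp τ := by
        rw [ENNReal.ofReal_mul (by positivity), div_eq_mul_inv (ballConst n), ENNReal.mul_inv
          (Or.inr (by simp)) (Or.inr (by simpa using hη)), hinv, div_eq_mul_inv (ballConst n),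
          mul_assoc]
      rw [e1, e2, ENNReal.mul_rpow_of_nonneg _ _ (by positivity), ← ENNReal.rpow_mul,
        mul_one_div_cancel hκ.ne', ENNReal.rpow_one, mul_pow,
        ENNReal.mul_rpow_of_nonneg (ballConst n / _) _ (by positivity), mul_add, eexp_add, eexp_rpow,
        ← ENNReal.rpow_natCast (eexp τ), eexp_rpow]
      ring
    refine hlow.trans (hmain.trans ?_)
    rw [hprod]
    calc _ ≤ C * (C₁ ^ (κ * S * g) * eexp (τ * (κ * S * g))) *
          (ballConst n ^ (1 / p) * eexp (τ * (1 / p))) := by gcongr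
      _ = _ := by rw [mul_add, eexp_add]; ring
  have hle := le_of_forall_eexp_le ?_ ?_ key
  · have h1 : m * θ ≤ κ * S * g := by rw [hmθ]; linarith [hSp]
    have h2 : lowerPower m n p κ β = m * θ / (κ * S) := by
      have hp' : p ≠ 0 := by rintro rfl; simp at hp0
      have h3 : m * p - 1 = S * p := by rw [hSp]; field_simp
      rw [lowerPower, h3, ← hθ]
      have := hS0.ne'
      field_simp
    rw [h2]
    have h4 : m * θ / (κ * S) ≤ g := by
      rw [div_le_iff₀ (by positivity)]; linarith
    have h5 : 0 < m * θ / (κ * S) := by positivity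
    rcases le_max_iff.1 h4 with h6 | h6
    · exact h6
    · linarith
  · refine mul_ne_zero (pow_ne_zero _ (ENNReal.div_ne_zero.2 ⟨ballConst_ne_zero hn,
      ENNReal.rpow_ne_top_of_nonneg (by positivity) (by simp)⟩)) ?_
    have : ballConst n / ENNReal.ofReal (κ * (1 / p)) ≠ 0 :=
      ENNReal.div_ne_zero.2 ⟨ballConst_ne_zero hn, ENNReal.ofReal_ne_top⟩
    rw [Ne, ENNReal.rpow_eq_zero_iff]
    exact fun h => h.elim (fun h => this h.1) fun h => (one_div_pos.2 hκ).not_gt h.2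
  · exact ENNReal.mul_ne_top (ENNReal.mul_ne_top (by simp) (ENNReal.rpow_ne_top_of_nonneg
      (mul_nonneg (by positivity) (le_max_right _ _)) hC₁))
      (ENNReal.rpow_ne_top_of_nonneg hp0.le ballConst_ne_top)

end PowerWeight
end RoughFractional

/-! ### Homogeneous kernels: from norms on spheres to norms on balls. -/

namespace RoughFractional
variable {m n : ℕ}

section Polar
open Metric
open scoped Pointwise
variable {V : Type*} [NormedAddCommGroup V] [NormedSpace ℝ V]

/-- The radial projection onto the unit sphere, with value `e` at the origin. -/
def sphereProj (e : sphere (0 : V) 1) (y : V) : sphere (0 : V) 1 :=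
  open Classical in
  ⟨if y = 0 then e else ‖y‖⁻¹ • y, by
    split_ifs with h
    · exact e.2
    · simp [norm_smul, h]⟩

theorem coe_sphereProj (e : sphere (0 : V) 1) {y : V} (hy : y ≠ 0) :
    (sphereProj e y : V) = ‖y‖⁻¹ • y := by
  simp [sphereProj, hy]

variable [MeasurableSpace V] [BorelSpace V] [FiniteDimensional ℝ V]

theorem measurable_sphereProj (e : sphere (0 : V) 1) : Measurable (sphereProj e) := by
  classical
  refine Measurable.subtype_mk ?_
  exact Measurable.ite (measurableSet_singleton 0) measurable_const
    (measurable_norm.inv.smul measurable_id)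

/-- The surface measure of A is d times the volume of the unit cone over A, and the preimage of A in
the ball of radius r is, up to the origin, that cone dilated by r. -/
theorem map_sphereProj (μ : Measure V) [μ.IsAddHaarMeasure] (e : sphere (0 : V) 1) {r : ℝ}
    (hr : 0 < r) :
    (μ.restrict (ball 0 r)).map (sphereProj e) =
      (ENNReal.ofReal r ^ Module.finrank ℝ V / Module.finrank ℝ V) • μ.toSphere := by
  have hnt : Nontrivial V := ⟨⟨e, 0, fun h => by
    have := e.2; rw [h] at this; simp at this⟩⟩
  have hd : (Module.finrank ℝ V : ℝ≥0∞) ≠ 0 := by exact_mod_cast Module.finrank_pos.ne'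
  ext A hA
  rw [Measure.map_apply (measurable_sphereProj e) hA, Measure.smul_apply, smul_eq_mul,
    μ.toSphere_apply' hA, Measure.restrict_apply (measurable_sphereProj e hA), ← mul_assoc,
    ENNReal.div_mul_cancel hd (ENNReal.natCast_ne_top _), ← ENNReal.ofReal_pow hr.le,
    ← μ.addHaar_smul_of_nonneg hr.le]
  refine measure_congr ?_
  have h0 : ∀ᵐ y ∂μ, y ≠ (0 : V) := by simp [ae_iff]
  filter_upwards [h0] with y hy
  have hy' : 0 < ‖y‖ := norm_pos_iff.2 hy
  refine propext ⟨fun h => ?_, fun h => ?_⟩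
  · refine ⟨(r⁻¹ * ‖y‖) • (sphereProj e y : V), ?_, ?_⟩
    · refine Set.smul_mem_smul ⟨by positivity, ?_⟩ ⟨_, h.1, rfl⟩
      rw [inv_mul_lt_one₀ hr]
      exact mem_ball_zero_iff.1 h.2
    · change r • _ = y
      rw [coe_sphereProj e hy, smul_smul, smul_smul]
      have : r * (r⁻¹ * ‖y‖) * ‖y‖⁻¹ = 1 := by field_simp
      rw [this, one_smul]
  · obtain ⟨z, hz, rfl⟩ := h
    obtain ⟨t, ht, w, ⟨θ, hθ, rfl⟩, rfl⟩ := hz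
    have hn : ‖(θ : V)‖ = 1 := by simp
    have hrt : 0 < r * t := mul_pos hr ht.1
    have hnorm : ‖r • t • (θ : V)‖ = r * t := by
      rw [smul_smul, norm_smul, hn, mul_one, Real.norm_of_nonneg hrt.le]
    refine ⟨?_, ?_⟩
    · change sphereProj e _ ∈ A
      convert hθ using 1
      ext1
      rw [coe_sphereProj e hy, hnorm, smul_smul, smul_smul]
      have : (r * t)⁻¹ * (r * t) = 1 := inv_mul_cancel₀ hrt.ne'
      rw [mul_assoc, this, one_smul]
    · rw [mem_ball_zero_iff, hnorm]
      nlinarith [ht.2]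

end Polar

theorem jointNorm_nonneg (y : Fin m → E n) : 0 ≤ jointNorm y := Real.sqrt_nonneg _

theorem continuous_jointNorm : Continuous (jointNorm : (Fin m → E n) → ℝ) := by
  unfold jointNorm; fun_prop

theorem norm_le_jointNorm (y : Fin m → E n) (i : Fin m) : ‖y i‖ ≤ jointNorm y := by
  refine Real.le_sqrt_of_sq_le ?_
  exact Finset.single_le_sum (f := fun i => ‖y i‖ ^ 2) (fun i _ => sq_nonneg _) (Finset.mem_univ i)

theorem jointNorm_unflatten (z : EuclideanSpace ℝ (Fin m × Fin n)) :
    jointNorm (unflatten z) = ‖z‖ := by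
  rw [jointNorm, EuclideanSpace.norm_eq, Fintype.sum_prod_type]
  congr 1
  refine Finset.sum_congr rfl fun i _ => ?_
  rw [EuclideanSpace.norm_sq_eq]
  rfl

/-- `unflatten` as a continuous linear equivalence. -/
def unflattenEquiv (m n : ℕ) : EuclideanSpace ℝ (Fin m × Fin n) ≃L[ℝ] (Fin m → E n) :=
  LinearEquiv.toContinuousLinearEquiv
    { toFun := unflatten
      invFun := fun y => WithLp.toLp 2 fun p => y p.1 p.2
      map_add' := fun _ _ => rfl
      map_smul' := fun _ _ => rfl
      left_inv := fun _ => rfl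
      right_inv := fun _ => rfl }

/-- Uniqueness of Haar measure. The value of the constant is irrelevant: it is absorbed in the
constant of the kernel bound. -/
theorem exists_volume_eq_smul_map (m n : ℕ) : ∃ c : ℝ≥0, c ≠ 0 ∧
    (volume : Measure (Fin m → E n)) =
      c • (volume : Measure (EuclideanSpace ℝ (Fin m × Fin n))).map unflatten := by
  have : (volume.map (unflattenEquiv m n)).IsAddHaarMeasure :=
    (unflattenEquiv m n).isAddHaarMeasure_map volume
  refine ⟨Measure.addHaarScalarFactor volume (volume.map (unflattenEquiv m n)),
    (Measure.addHaarScalarFactor_pos_of_isAddHaarMeasure _ _).ne',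
    Measure.isAddLeftInvariant_eq_smul _ _⟩

/-- The closed balls of `(ℝⁿ)^m`. -/
def jointBall (m n : ℕ) (r : ℝ) : Set (Fin m → E n) := {y | jointNorm y ≤ r}

theorem measurableSet_jointBall (r : ℝ) : MeasurableSet (jointBall m n r) :=
  measurableSet_le continuous_jointNorm.measurable measurable_const

/-- The size condition on the kernel that the estimates use. -/
structure KernelBound (Ω : (Fin m → E n) → ℂ) (s K : ℝ≥0∞) : Prop where
  aestronglyMeasurable : AEStronglyMeasurable Ω volume
  eLpNorm_le : ∀ r : ℝ, 0 < r → eLpNorm Ω s (volume.restrict (jointBall m n r)) ≤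
    K * ENNReal.ofReal r ^ (m * n * (1 / s).toReal)

theorem aestronglyMeasurable_of_jointBall {Ω : (Fin m → E n) → ℂ}
    (h : ∀ r : ℝ, 0 < r → AEStronglyMeasurable Ω (volume.restrict (jointBall m n r))) :
    AEStronglyMeasurable Ω volume := by
  have hU : (⋃ k : ℕ, jointBall m n (k + 1)) = Set.univ := by
    refine Set.eq_univ_of_forall fun y => Set.mem_iUnion.2 ?_
    obtain ⟨k, hk⟩ := exists_nat_ge (jointNorm y)
    exact ⟨k, hk.trans (by linarith)⟩
  rw [← Measure.restrict_univ (μ := volume), ← hU, aestronglyMeasurable_iUnion_iff]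
  exact fun k => h _ (by positivity)

theorem exists_sphere_point (ι : Type*) [Fintype ι] [Nonempty ι] :
    Nonempty (Metric.sphere (0 : EuclideanSpace ℝ ι) 1) :=
  ((NormedSpace.sphere_nonempty (E := EuclideanSpace ℝ ι) (x := 0)).2 zero_le_one).to_subtype

/-- By homogeneity Ω is, off the origin, its trace composed with the radial projection, so its norm
on a ball is a norm for the projected measure; the scaling of that measure produces r^(mn/s), and
for s = ∞ the power is 0. -/
theorem kernelBound_of_isJointKernel (hm : 0 < m) (hn : 0 < n) (s : ℝ≥0∞) : ∃ B : ℝ≥0,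
    ∀ (Ω : (Fin m → E n) → ℂ) (N : ℝ≥0∞), IsJointKernel Ω s N → KernelBound Ω s (B * N) := by
  have : Nonempty (Fin m × Fin n) := ⟨(⟨0, hm⟩, ⟨0, hn⟩)⟩
  obtain ⟨e⟩ := exists_sphere_point (Fin m × Fin n)
  obtain ⟨c, hc, hvol⟩ := exists_volume_eq_smul_map m n
  have hU : MeasurableEmbedding (unflatten : EuclideanSpace ℝ (Fin m × Fin n) → Fin m → E n) :=
    (unflattenEquiv m n).toHomeomorph.measurableEmbedding
  set d : ℕ := Module.finrank ℝ (EuclideanSpace ℝ (Fin m × Fin n)) with hd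
  have hdim : d = m * n := by simp [hd]
  set t := (1 / s).toReal with ht
  have ht0 : 0 ≤ t := ENNReal.toReal_nonneg
  set B : ℝ≥0∞ := (c * (2 ^ d / d)) ^ t with hB
  have hd0 : (d : ℝ≥0∞) ≠ 0 := by
    have := Nat.mul_pos hm hn
    rw [hdim]; exact_mod_cast this.ne'
  have hBt : B ≠ ∞ := ENNReal.rpow_ne_top_of_nonneg ht0
    (ENNReal.mul_ne_top ENNReal.coe_ne_top (ENNReal.div_ne_top (by simp) hd0))
  refine ⟨B.toNNReal, fun Ω N ⟨hhom, hmem, hN⟩ => ?_⟩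
  rw [ENNReal.coe_toNNReal hBt]
  have hae : ∀ ρ : Measure (EuclideanSpace ℝ (Fin m × Fin n)), ρ ≪ volume →
      Ω ∘ unflatten =ᵐ[ρ] jointTrace Ω ∘ sphereProj e := fun ρ hρ => by
    have : Nontrivial (EuclideanSpace ℝ (Fin m × Fin n)) := ⟨⟨e, 0, fun h => by
      have := e.2; rw [h] at this; simp at this⟩⟩
    have h0 : ∀ᵐ z ∂(volume : Measure (EuclideanSpace ℝ (Fin m × Fin n))), z ≠ 0 := by
      simp [ae_iff]
    filter_upwards [hρ.ae_le h0] with z hz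
    have hz' : 0 < ‖z‖⁻¹ := inv_pos.2 (norm_pos_iff.2 hz)
    simp only [Function.comp_apply, jointTrace]
    rw [coe_sphereProj e hz]
    exact (hhom _ hz' _).symm
  -- The balls of `jointBall` are closed while the projection formula concerns open balls; doubling
  -- the radius leaves room.
  have hsub : ∀ r : ℝ, 0 < r → unflatten ⁻¹' (jointBall m n r) ⊆
      Metric.ball (0 : EuclideanSpace ℝ (Fin m × Fin n)) (2 * r) := fun r hr z hz => by
    have : jointNorm (unflatten z) ≤ r := hz
    rw [jointNorm_unflatten] at this
    rw [mem_ball_zero_iff]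
    linarith
  have hmeas : ∀ r : ℝ, 0 < r → AEStronglyMeasurable (jointTrace Ω ∘ sphereProj e)
      (volume.restrict (Metric.ball 0 (2 * r))) := fun r hr => by
    refine AEStronglyMeasurable.comp_aemeasurable ?_ (measurable_sphereProj e).aemeasurable
    rw [map_sphereProj _ e (by positivity)]
    exact hmem.1.smul_measure _
  have hrestr : ∀ r : ℝ, (volume : Measure (Fin m → E n)).restrict (jointBall m n r) =
      (c : ℝ≥0∞) • (volume.restrict (unflatten ⁻¹' (jointBall m n r))).map unflatten := fun r => by
    rw [hvol, ← hU.restrict_map, Measure.restrict_smul]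
    rfl
  refine ⟨aestronglyMeasurable_of_jointBall fun r hr => ?_, fun r hr => ?_⟩
  · rw [hrestr]
    refine AEStronglyMeasurable.smul_measure ?_ _
    rw [hU.aestronglyMeasurable_map_iff]
    exact ((hmeas r hr).mono_measure (Measure.restrict_mono (hsub r hr) le_rfl)).congr
      (hae _ Measure.restrict_le_self.absolutelyContinuous).symm
  · have hc' : (c : ℝ≥0∞) ≠ 0 := by exact_mod_cast hc
    have hr2 : (ENNReal.ofReal (2 * r) ^ d / d : ℝ≥0∞) ≠ 0 :=
      ENNReal.div_ne_zero.2 ⟨by simp [hr], ENNReal.natCast_ne_top _⟩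
    calc eLpNorm Ω s (volume.restrict (jointBall m n r))
        = c ^ t * eLpNorm (Ω ∘ unflatten) s
          (volume.restrict (unflatten ⁻¹' (jointBall m n r))) := by
          rw [hrestr, eLpNorm_smul_measure_of_ne_zero hc', hU.eLpNorm_map_measure, smul_eq_mul]
      _ ≤ c ^ t * eLpNorm (jointTrace Ω ∘ sphereProj e) s
          (volume.restrict (Metric.ball 0 (2 * r))) := by
          rw [eLpNorm_congr_ae (hae _ Measure.restrict_le_self.absolutelyContinuous)]
          exact mul_le_mul' le_rfl
            (eLpNorm_mono_measure _ (Measure.restrict_mono (hsub r hr) le_rfl))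
      _ = c ^ t * ((ENNReal.ofReal (2 * r) ^ d / d) ^ t * N) := by
          have h1 : AEStronglyMeasurable (jointTrace Ω)
              ((volume.restrict (Metric.ball 0 (2 * r))).map (sphereProj e)) := by
            rw [map_sphereProj _ e (by positivity)]
            exact hmem.1.smul_measure _
          rw [← eLpNorm_map_measure h1 (measurable_sphereProj e).aemeasurable,
            map_sphereProj _ e (by positivity), eLpNorm_smul_measure_of_ne_zero hr2, smul_eq_mul,
            ← hN]
      _ = B * N * ENNReal.ofReal r ^ (m * n * t) := by
          have h1 : ENNReal.ofReal r ^ (m * n * t) = (ENNReal.ofReal r ^ d) ^ t := by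
            rw [← ENNReal.rpow_natCast, ← ENNReal.rpow_mul, hdim]
            push_cast; rfl
          rw [h1, hB, ENNReal.ofReal_mul (by norm_num), mul_pow, div_eq_mul_inv, div_eq_mul_inv,
            show ENNReal.ofReal 2 = 2 by simp]
          simp only [ENNReal.mul_rpow_of_nonneg _ _ ht0]
          ring

/-- The joint ball is enlarged to a product of m balls, on which projecting every variable pushes
the volume to a multiple of the product of the surface measures. -/
theorem kernelBound_of_isProductKernel (hn : 0 < n) (s : ℝ≥0∞) : ∃ B : ℝ≥0,
    ∀ (Ω : (Fin m → E n) → ℂ) (N : ℝ≥0∞), IsProductKernel Ω s N → KernelBound Ω s (B * N) := by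
  have : Nonempty (Fin n) := ⟨⟨0, hn⟩⟩
  obtain ⟨e⟩ := exists_sphere_point (Fin n)
  have hnt : Nontrivial (E n) := ⟨⟨e, 0, fun h => by
      have := e.2; rw [h] at this; simp at this⟩⟩
  set t := (1 / s).toReal with ht
  have ht0 : 0 ≤ t := ENNReal.toReal_nonneg
  have hn0 : (n : ℝ≥0∞) ≠ 0 := by exact_mod_cast hn.ne'
  set B : ℝ≥0∞ := ((2 ^ n / n) ^ m) ^ t with hB
  have hBt : B ≠ ∞ := ENNReal.rpow_ne_top_of_nonneg ht0
    (ENNReal.pow_ne_top (ENNReal.div_ne_top (by simp) hn0))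
  refine ⟨B.toNNReal, fun Ω N ⟨hhom, hmem, hN⟩ => ?_⟩
  rw [ENNReal.coe_toNNReal hBt]
  set τ : Measure (Fin m → Metric.sphere (0 : E n) 1) :=
    Measure.pi fun _ => (volume : Measure (E n)).toSphere with hτ
  set π : (Fin m → E n) → Fin m → Metric.sphere (0 : E n) 1 := fun y i => sphereProj e (y i)
  have hπ : Measurable π :=
    measurable_pi_lambda _ fun i => (measurable_sphereProj e).comp (measurable_pi_apply i)
  set D : ℝ → Set (Fin m → E n) := fun r => Set.univ.pi fun _ => Metric.ball 0 (2 * r)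
  have hmap : ∀ r : ℝ, 0 < r → (volume.restrict (D r)).map π =
      ((ENNReal.ofReal (2 * r) ^ n / n) ^ m) • τ := fun r hr => by
    have hfin : ((volume.restrict (Metric.ball (0 : E n) (2 * r))).map
        (sphereProj e)) = (ENNReal.ofReal (2 * r) ^ n / n) • volume.toSphere := by
      rw [map_sphereProj _ e (by positivity), finrank_euclideanSpace_fin]
    have hlt : ENNReal.ofReal (2 * r) ^ n / n ≠ ∞ := ENNReal.div_ne_top
      (ENNReal.pow_ne_top ENNReal.ofReal_ne_top) hn0
    have hf2 : IsFiniteMeasure ((volume.restrict (Metric.ball (0 : E n) (2 * r))).map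
        (sphereProj e)) := by
      rw [map_sphereProj _ e (by positivity), finrank_euclideanSpace_fin]
      exact Measure.smul_finite _ hlt
    rw [volume_pi, Measure.restrict_pi_pi, Measure.pi_map_pi
      fun i => (measurable_sphereProj e).aemeasurable]
    refine Measure.pi_eq fun A hA => ?_
    rw [hfin]
    simp only [Measure.smul_apply, smul_eq_mul, hτ, Measure.pi_pi, Finset.prod_mul_distrib,
      Finset.prod_const, Finset.card_univ, Fintype.card_fin]
  have hae : ∀ ρ : Measure (Fin m → E n), ρ ≪ volume → Ω =ᵐ[ρ] productTrace Ω ∘ π :=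
    fun ρ hρ => by
    have h0 : ∀ᵐ y ∂(volume : Measure (Fin m → E n)), ∀ i, y i ≠ 0 := by
      refine ae_all_iff.2 fun i => ?_
      have h1 : ∀ᵐ z ∂(volume : Measure (E n)), z ≠ 0 := by simp [ae_iff]
      exact (Measure.quasiMeasurePreserving_eval (fun _ : Fin m => (volume : Measure (E n))) i).ae h1
    filter_upwards [hρ.ae_le h0] with y hy
    simp only [Function.comp_apply, productTrace, π]
    have := hhom (fun i => ‖y i‖⁻¹) (fun i => inv_pos.2 (norm_pos_iff.2 (hy i))) y
    rw [← this]
    congr 1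
    ext1 i
    exact (coe_sphereProj e (hy i)).symm
  have hsub : ∀ r : ℝ, 0 < r → jointBall m n r ⊆ D r := fun r hr y hy i _ => by
    rw [mem_ball_zero_iff]
    have : jointNorm y ≤ r := hy
    linarith [norm_le_jointNorm y i]
  have hpos : ∀ r : ℝ, 0 < r → ((ENNReal.ofReal (2 * r) ^ n / n : ℝ≥0∞) ^ m) ≠ 0 := fun r hr =>
    pow_ne_zero _ (ENNReal.div_ne_zero.2 ⟨by simp [hr], ENNReal.natCast_ne_top _⟩)
  have hmeas : ∀ r : ℝ, 0 < r → AEStronglyMeasurable (productTrace Ω)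
      ((volume.restrict (D r)).map π) := fun r hr => by
    rw [hmap r hr]
    exact hmem.1.smul_measure _
  refine ⟨aestronglyMeasurable_of_jointBall fun r hr => ?_, fun r hr => ?_⟩
  · exact (((hmeas r hr).comp_aemeasurable hπ.aemeasurable).mono_measure
      (Measure.restrict_mono (hsub r hr) le_rfl)).congr
      (hae _ Measure.restrict_le_self.absolutelyContinuous).symm
  · calc eLpNorm Ω s (volume.restrict (jointBall m n r))
        ≤ eLpNorm (productTrace Ω ∘ π) s (volume.restrict (D r)) := by
          rw [eLpNorm_congr_ae (hae _ Measure.restrict_le_self.absolutelyContinuous)]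
          exact eLpNorm_mono_measure _ (Measure.restrict_mono (hsub r hr) le_rfl)
      _ = ((ENNReal.ofReal (2 * r) ^ n / n) ^ m) ^ t * N := by
          rw [← eLpNorm_map_measure (hmeas r hr) hπ.aemeasurable, hmap r hr,
            eLpNorm_smul_measure_of_ne_zero (hpos r hr), smul_eq_mul, ← hN]
      _ = B * N * ENNReal.ofReal r ^ (m * n * t) := by
          have h1 : ENNReal.ofReal r ^ (m * n * t) = ((ENNReal.ofReal r ^ n) ^ m) ^ t := by
            rw [← pow_mul, ← ENNReal.rpow_natCast, ← ENNReal.rpow_mul]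
            push_cast; ring_nf
          rw [h1, hB, ENNReal.ofReal_mul (by norm_num), mul_pow, div_eq_mul_inv, div_eq_mul_inv,
            show ENNReal.ofReal 2 = 2 by simp]
          simp only [mul_pow, ENNReal.mul_rpow_of_nonneg _ _ ht0]
          ring

theorem isJointKernel_one (m n : ℕ) : IsJointKernel (fun _ : Fin m → E n => (1 : ℂ)) ∞
    (eLpNorm (jointTrace fun _ : Fin m → E n => (1 : ℂ)) ∞
      (volume : Measure (EuclideanSpace ℝ (Fin m × Fin n))).toSphere) :=
  ⟨fun _ _ _ => rfl, memLp_top_const 1, rfl⟩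

end RoughFractional

/-! ### Welland's pointwise inequality. -/

namespace RoughFractional
variable {m n : ℕ}

theorem lintegral_pi_prod {X : Type*} [MeasurableSpace X] {μ : Measure X} [SigmaFinite μ] {m : ℕ}
    {g : Fin m → X → ℝ≥0∞} (hg : ∀ i, AEMeasurable (g i) μ) :
    ∫⁻ y, ∏ i, g i (y i) ∂(Measure.pi fun _ => μ) = ∏ i, ∫⁻ x, g i x ∂μ := by
  induction m with
  | zero => simp
  | succ m ih =>
    rw [← ((measurePreserving_piFinSuccAbove (fun _ : Fin (m + 1) => μ) 0).symm).lintegral_comp_emb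
      (MeasurableEquiv.measurableEmbedding _)]
    simp_rw [MeasurableEquiv.piFinSuccAbove_symm_apply, Fin.insertNthEquiv,
      Fin.prod_univ_succ, Fin.insertNth_zero, Equiv.coe_fn_mk, Fin.cons_succ, Fin.cons_zero]
    rw [← ih fun i => hg i.succ, ← lintegral_prod_mul (hg 0)]
    · rfl
    refine Finset.aemeasurable_fun_prod _ fun i _ => (hg i.succ).comp_quasiMeasurePreserving
      (Measure.quasiMeasurePreserving_eval (fun _ : Fin m => μ) i)

theorem enorm_finset_prod {ι : Type*} (t : Finset ι) (c : ι → ℂ) :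
    ‖∏ i ∈ t, c i‖ₑ = ∏ i ∈ t, ‖c i‖ₑ := by
  simp only [← ofReal_norm, norm_prod, ENNReal.ofReal_prod_of_nonneg fun _ _ => norm_nonneg _]

section Geometric

/-- The sum of a two-sided geometric series. -/
def geomSum (ε : ℝ) : ℝ≥0∞ := ∑' k : ℤ, eexp (ε - |(k : ℝ)| * ε)

theorem geomSum_ne_top {ε : ℝ} (hε : 0 < ε) : geomSum ε ≠ ∞ := by
  have hgeo : Summable fun k : ℕ => Real.exp ε * Real.exp (-ε) ^ k :=
    (summable_geometric_of_lt_one (Real.exp_pos _).le (by simpa using hε)).mul_left _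
  have e : ∀ k : ℕ, Real.exp ε * Real.exp (-ε) ^ k = Real.exp (ε - k * ε) := fun k => by
    rw [← Real.exp_nat_mul, ← Real.exp_add]; ring_nf
  simp_rw [e] at hgeo
  have : Summable fun k : ℤ => Real.exp (ε - |(k : ℝ)| * ε) :=
    .of_nat_of_neg (by simpa using hgeo) (by simpa using hgeo)
  exact this.tsum_ofReal_ne_top

theorem geomSum_ne_zero (ε : ℝ) : geomSum ε ≠ 0 := by
  rw [geomSum, Ne, ENNReal.tsum_eq_zero, not_forall]
  exact ⟨0, eexp_ne_zero _⟩

/-- For a = e^u and b = e^v the two bounds cross at c = (u - v)/(2ε), where both equal the geometric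
mean, and the better one decays geometrically away from it. Rounding c to an integer costs the
factor e^ε in `geomSum`. -/
theorem tsum_le_sqrt_mul {ε : ℝ} (hε : 0 < ε) {a b : ℝ≥0∞} {t : ℤ → ℝ≥0∞}
    (ha : ∀ k, t k ≤ eexp (-(k * ε)) * a) (hb : ∀ k, t k ≤ eexp (k * ε) * b) :
    ∑' k, t k ≤ geomSum ε * (a * b) ^ (1 / 2 : ℝ) := by
  by_cases ha0 : a = 0
  · have : ∀ k, t k = 0 := fun k => by simpa [ha0] using ha k
    simp [this]
  by_cases hb0 : b = 0
  · have : ∀ k, t k = 0 := fun k => by simpa [hb0] using hb k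
    simp [this]
  by_cases hat : a = ∞
  · rw [hat, ENNReal.top_mul hb0, ENNReal.top_rpow_of_pos (by norm_num),
      ENNReal.mul_top (geomSum_ne_zero ε)]
    exact le_top
  by_cases hbt : b = ∞
  · rw [hbt, ENNReal.mul_top ha0, ENNReal.top_rpow_of_pos (by norm_num),
      ENNReal.mul_top (geomSum_ne_zero ε)]
    exact le_top
  obtain ⟨u, rfl⟩ := exists_eexp ha0 hat
  obtain ⟨v, rfl⟩ := exists_eexp hb0 hbt
  set c := (u - v) / (2 * ε) with hc
  have hce : c * ε = (u - v) / 2 := by rw [hc]; field_simp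
  have hf1 := Int.floor_le c
  have hf2 := Int.lt_floor_add_one c
  have key : ∀ k : ℤ, t k ≤ eexp (ε - |((k - ⌊c⌋ : ℤ) : ℝ)| * ε) * (eexp u * eexp v) ^ (1 / 2 : ℝ) := by
    intro k
    rw [← eexp_add, eexp_rpow, ← eexp_add]
    push_cast
    rcases le_total (k : ℝ) ⌊c⌋ with h | h
    · refine (hb k).trans ?_
      rw [← eexp_add, eexp_le_eexp, abs_of_nonpos (by linarith)]
      nlinarith
    · refine (ha k).trans ?_
      rw [← eexp_add, eexp_le_eexp, abs_of_nonneg (by linarith)]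
      nlinarith
  refine (ENNReal.tsum_le_tsum key).trans ?_
  rw [ENNReal.tsum_mul_right, geomSum,
    ← (Equiv.subRight ⌊c⌋).tsum_eq fun k : ℤ => eexp (ε - |(k : ℝ)| * ε)]
  rfl

end Geometric

/-- The cube with centre `x` and half side `eᵏ`. -/
def centredCube (x : E n) (k : ℤ) : Set (E n) :=
  cube (x - WithLp.toLp 2 fun _ => Real.exp k) (2 * Real.exp k)

theorem mem_centredCube {x y : E n} {k : ℤ} :
    y ∈ centredCube x k ↔ ∀ j, |x j - y j| ≤ Real.exp k := by
  refine forall_congr' fun j => ?_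
  rw [abs_le, Set.mem_Icc, PiLp.sub_apply]
  dsimp only
  constructor <;> rintro ⟨h1, h2⟩ <;> constructor <;> linarith

theorem measurableSet_centredCube (x : E n) (k : ℤ) : MeasurableSet (centredCube x k) :=
  measurableSet_cube _ _

theorem volume_centredCube (x : E n) (k : ℤ) :
    volume (centredCube x k) = eexp (n * (Real.log 2 + k)) := by
  rw [centredCube, volume_cube, ENNReal.ofReal_mul (by norm_num), ← ENNReal.rpow_natCast,
    mul_comm (n : ℝ), ← eexp_rpow, eexp_add]
  congr 2
  rw [eexp, Real.exp_log (by norm_num)]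

/-- The centred multilinear fractional maximal function over cubes of sides `2eᵏ`. -/
def centredMaximal (β : ℝ) (g : Fin m → E n → ℝ≥0∞) (x : E n) : ℝ≥0∞ :=
  ⨆ k : ℤ, ∏ i, (∫⁻ y in centredCube x k, g i y) / volume (centredCube x k) ^ (1 - β / (m * n))

theorem centredMaximal_le (β : ℝ) {g : Fin m → E n → ℝ≥0∞} {f : Fin m → E n → ℂ}
    (hgf : ∀ i x, g i x = ‖f i x‖ₑ) (x : E n) : centredMaximal β g x ≤ fracMaximal β f x := by
  refine iSup_le fun k => ?_
  have hx : x ∈ centredCube x k := mem_centredCube.2 fun j => by simp [(Real.exp_pos _).le]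
  refine le_iSup_of_le _ (le_iSup_of_le (2 * Real.exp k) (le_iSup_of_le (by positivity)
    (le_iSup_of_le hx (le_of_eq ?_))))
  simp_rw [hgf]
  rfl

/-- Only countably many radii occur, and each integral depends measurably on the centre by Tonelli.
Hence the maximal function over all cubes may be replaced by a measurable minorant in the integral
estimates. -/
theorem measurable_centredMaximal (β : ℝ) {g : Fin m → E n → ℝ≥0∞} (hg : ∀ i, AEMeasurable (g i)) :
    Measurable (centredMaximal β g) := by
  refine .iSup fun k => Finset.measurable_fun_prod _ fun i _ => ?_
  simp_rw [volume_centredCube]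
  refine Measurable.div_const ?_ _
  have hset : MeasurableSet {p : E n × E n | p.2 ∈ centredCube p.1 k} := by
    simp_rw [mem_centredCube, Set.ofPred_forall]
    exact .iInter fun j => measurableSet_le (by fun_prop) measurable_const
  have e : (fun x => ∫⁻ y in centredCube x k, g i y) = fun x => ∫⁻ y,
      {p : E n × E n | p.2 ∈ centredCube p.1 k}.indicator (fun p => (hg i).mk _ p.2) (x, y) := by
    funext x
    rw [lintegral_congr_ae (ae_restrict_of_ae (hg i).ae_eq_mk),
      ← lintegral_indicator (measurableSet_centredCube x k)]
    rfl
  rw [e]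
  exact (((hg i).measurable_mk.comp measurable_snd).indicator hset).lintegral_prod_right'

section Welland
variable {Ω : (Fin m → E n) → ℂ} {s K : ℝ≥0∞} {s' α : ℝ} {f : Fin m → E n → ℂ}

theorem quasiMeasurePreserving_sub_eval (x : E n) (i : Fin m) :
    Measure.QuasiMeasurePreserving (fun y : Fin m → E n => x - y i) volume volume :=
  (quasiMeasurePreserving_sub_left volume x).comp
    (Measure.quasiMeasurePreserving_eval (fun _ : Fin m => (volume : Measure (E n))) i)

theorem aestronglyMeasurable_prod_translate (hf : ∀ i, AEStronglyMeasurable (f i)) (x : E n) :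
    AEStronglyMeasurable (fun y : Fin m → E n => ∏ i, f i (x - y i)) volume :=
  Finset.aestronglyMeasurable_fun_prod _ fun i _ =>
    (hf i).comp_quasiMeasurePreserving (quasiMeasurePreserving_sub_eval x i)

/-- If |y| ≤ e^k then every x - y_i lies in the cube centred at x with half side e^k; Tonelli then
factors the enlarged integral. -/
theorem lintegral_jointBall_prod_le (hs' : 0 < s') (hf : ∀ i, AEStronglyMeasurable (f i)) (x : E n)
    (k : ℤ) : ∫⁻ y in jointBall m n (Real.exp k), ‖∏ i, f i (x - y i)‖ₑ ^ s' ≤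
      ∏ i, ∫⁻ y in centredCube x k, ‖f i y‖ₑ ^ s' := by
  set h : Fin m → E n → ℝ≥0∞ := fun i =>
    (centredCube x k).indicator fun z => ‖f i z‖ₑ ^ s' with hh
  have hm : ∀ i, AEMeasurable (fun z => h i (x - z)) := fun i =>
    (((hf i).enorm.pow_const s').indicator (measurableSet_cube _ _)).comp_quasiMeasurePreserving
      (quasiMeasurePreserving_sub_left volume x)
  have hle : ∀ y : Fin m → E n, (jointBall m n (Real.exp k)).indicator
      (fun y => ‖∏ i, f i (x - y i)‖ₑ ^ s') y ≤ ∏ i, h i (x - y i) := fun y => by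
    by_cases hy : y ∈ jointBall m n (Real.exp k)
    swap
    · rw [Set.indicator_of_notMem hy]; exact zero_le
    rw [Set.indicator_of_mem hy]
    rw [enorm_finset_prod, ← ENNReal.prod_rpow_of_nonneg hs'.le]
    refine Finset.prod_le_prod' fun i _ => ?_
    refine (Set.indicator_of_mem (mem_centredCube.2 fun j => ?_) fun z => ‖f i z‖ₑ ^ s').ge
    have h1 := PiLp.norm_apply_le (y i) j
    have h2 : jointNorm y ≤ Real.exp k := hy
    rw [Real.norm_eq_abs] at h1
    rw [PiLp.sub_apply, sub_sub_cancel]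
    exact h1.trans ((norm_le_jointNorm y i).trans h2)
  rw [← lintegral_indicator (measurableSet_jointBall _)]
  refine (lintegral_mono hle).trans (le_of_eq ?_)
  rw [volume_pi, lintegral_pi_prod hm]
  refine Finset.prod_congr rfl fun i _ => ?_
  rw [lintegral_sub_left_eq_self (fun z => h i z) x]
  exact lintegral_indicator (measurableSet_centredCube x k) _

/-- Dyadic shells of `(ℝⁿ)^m`, with ratio `e`. -/
def shell (m n : ℕ) (k : ℤ) : Set (Fin m → E n) :=
  {y | Real.exp (k - 1) < jointNorm y ∧ jointNorm y ≤ Real.exp k}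

theorem measurableSet_shell (k : ℤ) : MeasurableSet (shell m n k) :=
  (measurableSet_lt measurable_const continuous_jointNorm.measurable).inter
    (measurableSet_jointBall _)

theorem mem_iUnion_shell {y : Fin m → E n} (hy : 0 < jointNorm y) : y ∈ ⋃ k, shell m n k := by
  refine Set.mem_iUnion.2 ⟨⌈Real.log (jointNorm y)⌉, ?_, ?_⟩
  · rw [← Real.lt_log_iff_exp_lt hy]
    linarith [Int.ceil_lt_add_one (Real.log (jointNorm y))]
  · rw [← Real.log_le_iff_le_exp hy]
    exact Int.le_ceil _

theorem lintegral_fracIntegrand_le_tsum (hα : α < m * n) (x : E n) :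
    ∫⁻ y, ‖fracIntegrand Ω α f x y‖ₑ ≤
      ∑' k, ∫⁻ y in shell m n k, ‖fracIntegrand Ω α f x y‖ₑ := by
  refine le_trans ?_ (lintegral_iUnion_le _ _)
  rw [← lintegral_indicator (MeasurableSet.iUnion measurableSet_shell)]
  refine lintegral_mono fun y => ?_
  by_cases hy : 0 < jointNorm y
  · rw [Set.indicator_of_mem (mem_iUnion_shell hy)]
  -- The shells miss y = 0. There the denominator is 0 to a positive power, and division by zero
  -- makes the integrand 0.
  · have : jointNorm y = 0 := le_antisymm (not_lt.1 hy) (jointNorm_nonneg y)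
    rw [fracIntegrand, this, Real.zero_rpow (sub_pos.2 hα).ne']
    simp

/-- On the shell the kernel factor is at most its value at the inner radius e^(k-1). What remains is
Hölder with exponents s and s' on the ball of radius e^k. -/
theorem lintegral_shell_le (hs' : 1 ≤ s') (hss' : s⁻¹ + (ENNReal.ofReal s')⁻¹ = 1)
    (hα : α < m * n) (hK : KernelBound Ω s K) (hf : ∀ i, AEStronglyMeasurable (f i)) (x : E n)
    (k : ℤ) :
    ∫⁻ y in shell m n k, ‖fracIntegrand Ω α f x y‖ₑ ≤
      K * eexp (k * (m * n * (1 - 1 / s')) - (k - 1) * (m * n - α)) *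
        (∏ i, ∫⁻ y in centredCube x k, ‖f i y‖ₑ ^ s') ^ (1 / s') := by
  have hs0 : 0 < s' := by linarith
  have hst : (1 / s).toReal = 1 - 1 / s' := by
    have h1 : ((ENNReal.ofReal s')⁻¹).toReal = 1 / s' := by
      rw [ENNReal.toReal_inv, ENNReal.toReal_ofReal hs0.le, one_div]
    have h2 : s⁻¹ ≠ ∞ := fun h => by simp [h] at hss'
    have h3 : (ENNReal.ofReal s')⁻¹ ≠ ∞ := fun h => by simp [h] at hss'
    have h4 := congrArg ENNReal.toReal hss'
    rw [ENNReal.toReal_add h2 h3, h1, ENNReal.toReal_one] at h4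
    rw [one_div]; linarith
  have hexp : 0 < (m : ℝ) * n - α := sub_pos.2 hα
  set G : (Fin m → E n) → ℂ := fun y => ∏ i, f i (x - y i) with hG
  have hpt : ∀ y ∈ shell m n k, ‖fracIntegrand Ω α f x y‖ₑ ≤
      eexp (-((k - 1) * (m * n - α))) * ‖(Ω • G) y‖ₑ := fun y hy => by
    have hy0 : 0 < jointNorm y := (Real.exp_pos _).trans hy.1
    have hpow : 0 < jointNorm y ^ ((m : ℝ) * n - α) := Real.rpow_pos_of_pos hy0 _
    have e : fracIntegrand Ω α f x y =
        (((jointNorm y ^ ((m : ℝ) * n - α))⁻¹ : ℝ) : ℂ) * (Ω • G) y := by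
      simp only [fracIntegrand, Pi.smul_apply', smul_eq_mul, hG]
      push_cast
      rw [div_eq_mul_inv]; ring
    rw [e, enorm_mul]
    gcongr
    rw [← ofReal_norm, Complex.norm_real, Real.norm_of_nonneg (inv_pos.2 hpow).le, eexp]
    refine ENNReal.ofReal_le_ofReal ?_
    rw [Real.exp_neg, Real.exp_mul]
    exact inv_anti₀ (Real.rpow_pos_of_pos (Real.exp_pos _) _)
      (Real.rpow_le_rpow (Real.exp_pos _).le hy.1.le hexp.le)
  have hsub : shell m n k ⊆ jointBall m n (Real.exp k) := fun y hy => hy.2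
  have hT : ENNReal.HolderTriple s (ENNReal.ofReal s') 1 := ⟨by rw [hss', inv_one]⟩
  have hGm : AEStronglyMeasurable G volume := aestronglyMeasurable_prod_translate hf x
  calc ∫⁻ y in shell m n k, ‖fracIntegrand Ω α f x y‖ₑ
      ≤ ∫⁻ y in shell m n k, eexp (-((k - 1) * (m * n - α))) * ‖(Ω • G) y‖ₑ :=
        setLIntegral_mono_ae' (measurableSet_shell k) (.of_forall hpt)
    _ = eexp (-((k - 1) * (m * n - α))) * ∫⁻ y in shell m n k, ‖(Ω • G) y‖ₑ :=
        lintegral_const_mul' _ _ (eexp_ne_top _)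
    _ ≤ eexp (-((k - 1) * (m * n - α))) *
        ∫⁻ y in jointBall m n (Real.exp k), ‖(Ω • G) y‖ₑ := by
        gcongr
    _ ≤ eexp (-((k - 1) * (m * n - α))) *
        ((K * ENNReal.ofReal (Real.exp k) ^ (m * n * (1 / s).toReal)) *
          (∏ i, ∫⁻ y in centredCube x k, ‖f i y‖ₑ ^ s') ^ (1 / s')) := by
        refine mul_le_mul' le_rfl ?_
        rw [← eLpNorm_one_eq_lintegral_enorm]
        refine (eLpNorm_smul_le_mul_eLpNorm (p := s) (q := ENNReal.ofReal s') hGm.restrict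
          hK.aestronglyMeasurable.restrict).trans (mul_le_mul' (hK.eLpNorm_le _ (Real.exp_pos _)) ?_)
        rw [eLpNorm_eq_lintegral_rpow_enorm_toReal (by simpa using hs0) ENNReal.ofReal_ne_top,
          ENNReal.toReal_ofReal hs0.le]
        exact ENNReal.rpow_le_rpow (lintegral_jointBall_prod_le hs0 hf x k) (by positivity)
    _ = _ := by
        change _ * ((K * eexp k ^ _) * _) = _
        rw [hst, eexp_rpow, sub_eq_add_neg (k * (m * n * (1 - 1 / s')) : ℝ), eexp_add]
        ring

theorem prod_lintegral_centredCube_le (hm : 0 < m) (hn : 0 < n) (β : ℝ) (g : Fin m → E n → ℝ≥0∞)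
    (x : E n) (k : ℤ) : ∏ i, ∫⁻ y in centredCube x k, g i y ≤
      eexp ((Real.log 2 + k) * (m * n - β)) * centredMaximal β g x := by
  have h := le_iSup (fun k : ℤ => ∏ i, (∫⁻ y in centredCube x k, g i y) /
    volume (centredCube x k) ^ (1 - β / (m * n))) k
  have hm' : (m : ℝ) ≠ 0 := by exact_mod_cast hm.ne'
  have hn' : (n : ℝ) ≠ 0 := by exact_mod_cast hn.ne'
  refine le_trans (le_of_eq ?_) (mul_le_mul' le_rfl h)
  simp_rw [volume_centredCube, eexp_rpow, ENNReal.div_eq_inv_mul, ← eexp_neg]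
  rw [Finset.prod_mul_distrib, Finset.prod_const, Finset.card_univ, Fintype.card_fin,
    ← ENNReal.rpow_natCast, eexp_rpow, ← mul_assoc, ← eexp_add]
  rw [show (Real.log 2 + k) * (m * n - β) +
    -(n * (Real.log 2 + k) * (1 - β / (m * n))) * m = 0 by field_simp; ring, eexp_zero, one_mul]

/-- Welland's inequality. -/
theorem exists_welland (hm : 0 < m) (hn : 0 < n) {ε : ℝ} (hε : 0 < ε) (hs' : 1 ≤ s')
    (hss' : s⁻¹ + (ENNReal.ofReal s')⁻¹ = 1) (hα : α < m * n) :
    ∃ C : ℝ≥0, ∀ (Ω : (Fin m → E n) → ℂ) (K : ℝ≥0∞), KernelBound Ω s K →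
      ∀ f : Fin m → E n → ℂ, (∀ i, AEStronglyMeasurable (f i)) → ∀ x,
        ∫⁻ y, ‖fracIntegrand Ω α f x y‖ₑ ≤ C * K *
          (centredMaximal (s' * (α + ε)) (fun i y => ‖f i y‖ₑ ^ s') x *
            centredMaximal (s' * (α - ε)) (fun i y => ‖f i y‖ₑ ^ s') x) ^ (1 / (2 * s')) := by
  have hs0 : 0 < s' := by linarith
  set D : ℝ → ℝ := fun β => m * n - α + Real.log 2 * (m * n - β) / s' with hD
  have hC : geomSum ε * (eexp (D (s' * (α + ε))) * eexp (D (s' * (α - ε)))) ^ (1 / 2 : ℝ) ≠ ∞ :=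
    ENNReal.mul_ne_top (geomSum_ne_top hε) (ENNReal.rpow_ne_top_of_nonneg (by norm_num)
      (ENNReal.mul_ne_top (eexp_ne_top _) (eexp_ne_top _)))
  refine ⟨(geomSum ε * (eexp (D (s' * (α + ε))) * eexp (D (s' * (α - ε)))) ^ (1 / 2 : ℝ)).toNNReal,
    fun Ω K hK f hf x => ?_⟩
  rw [ENNReal.coe_toNNReal hC]
  set M : ℝ → ℝ≥0∞ := fun β => centredMaximal β (fun i y => ‖f i y‖ₑ ^ s') x with hM
  -- The same shell estimate is read for an arbitrary order β; the choices β = s'(α ± ε) give the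
  -- factors e^(∓kε) needed for the two-sided summation.
  have hterm : ∀ (β : ℝ) (k : ℤ), ∫⁻ y in shell m n k, ‖fracIntegrand Ω α f x y‖ₑ ≤
      eexp (k * (α - β / s')) * (K * eexp (D β) * M β ^ (1 / s')) := fun β k => by
    refine (lintegral_shell_le hs' hss' hα hK hf x k).trans ?_
    refine (mul_le_mul' le_rfl (ENNReal.rpow_le_rpow (prod_lintegral_centredCube_le hm hn β _ x k)
      (by positivity : 0 ≤ 1 / s'))).trans (le_of_eq ?_)
    rw [ENNReal.mul_rpow_of_nonneg _ _ (by positivity), eexp_rpow]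
    have e : k * (α - β / s') + D β = k * (m * n * (1 - 1 / s')) - (k - 1) * (m * n - α) +
        (Real.log 2 + k) * (m * n - β) * (1 / s') := by
      simp only [hD]; field_simp; ring
    calc _ = K * (eexp (k * (m * n * (1 - 1 / s')) - (k - 1) * (m * n - α)) *
          eexp ((Real.log 2 + k) * (m * n - β) * (1 / s'))) * M β ^ (1 / s') := by ring
      _ = _ := by rw [← eexp_add, ← e, eexp_add]; ring
  refine (lintegral_fracIntegrand_le_tsum hα x).trans ((tsum_le_sqrt_mul hε
    (a := K * eexp (D (s' * (α + ε))) * M (s' * (α + ε)) ^ (1 / s'))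
    (b := K * eexp (D (s' * (α - ε))) * M (s' * (α - ε)) ^ (1 / s'))
    (fun k => ?_) (fun k => ?_)).trans (le_of_eq ?_))
  · convert hterm (s' * (α + ε)) k using 3
    field_simp; ring
  · convert hterm (s' * (α - ε)) k using 3
    field_simp; ring
  · have h2 : (0 : ℝ) ≤ 1 / 2 := by norm_num
    have hK2 : K = K ^ (1 / 2 : ℝ) * K ^ (1 / 2 : ℝ) := by
      rw [← ENNReal.rpow_add_of_nonneg _ _ h2 h2]; norm_num
    have e : 1 / s' * (1 / 2) = 1 / (2 * s') := by field_simp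
    simp only [ENNReal.mul_rpow_of_nonneg _ _ h2,
      ENNReal.mul_rpow_of_nonneg _ _ (by positivity : 0 ≤ 1 / (2 * s')), ← ENNReal.rpow_mul, e]
    conv_rhs => rw [hK2]
    ring

end Welland

end RoughFractional

/-! ### Rescaling by s' and the norm estimate for the integral. -/

namespace RoughFractional
variable {m n : ℕ} {P : Fin m → ℝ} {β κ : ℝ} {ω : Fin m → E n → ℝ≥0}

section Power
variable {s' : ℝ}

/-- The weights `ωᵢ ^ t`. -/
def powWeight (ω : Fin m → E n → ℝ≥0) (t : ℝ) : Fin m → E n → ℝ≥0 := fun i x => ω i x ^ t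

/-- The functions `|fᵢ| ^ t`. -/
def powAbs (f : Fin m → E n → ℂ) (t : ℝ) : Fin m → E n → ℂ := fun i x => ((‖f i x‖ ^ t : ℝ) : ℂ)

theorem enorm_powAbs (hs' : 0 < s') (f : Fin m → E n → ℂ) (i : Fin m) (x : E n) :
    ‖powAbs f s' i x‖ₑ = ‖f i x‖ₑ ^ s' := by
  have h : 0 ≤ ‖f i x‖ ^ s' := Real.rpow_nonneg (norm_nonneg _) _
  rw [powAbs, ← ofReal_norm, Complex.norm_real, Real.norm_of_nonneg h,
    ← ENNReal.ofReal_rpow_of_nonneg (norm_nonneg _) hs'.le, ofReal_norm]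

theorem wpow_powWeight (hs' : 0 < s') (ω : Fin m → E n → ℝ≥0) (t : ℝ) :
    wpow (powWeight ω s') t = wpow ω (s' * t) := by
  funext i x
  rw [wpow, wpow, powWeight, ENNReal.coe_rpow_of_nonneg _ hs'.le, ENNReal.rpow_mul]

theorem nuMeasure_powWeight (hs' : 0 < s') (ω : Fin m → E n → ℝ≥0) (κ : ℝ) :
    nuMeasure (powWeight ω s') (κ / s') = nuMeasure ω κ := by
  simp_rw [nuMeasure, powWeight, ENNReal.coe_rpow_of_nonneg _ hs'.le,
    ENNReal.prod_rpow_of_nonneg hs'.le, ← ENNReal.rpow_mul, mul_div_cancel₀ _ hs'.ne']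

theorem wMeasure_powWeight (hs' : 0 < s') (ω : Fin m → E n → ℝ≥0) (i : Fin m) (r : ℝ) :
    wMeasure (powWeight ω s' i) (r / s') = wMeasure (ω i) r := by
  simp_rw [wMeasure, powWeight, ENNReal.coe_rpow_of_nonneg _ hs'.le, ← ENNReal.rpow_mul,
    mul_div_cancel₀ _ hs'.ne']

theorem eLpNorm_powAbs (hs' : 0 < s') (f : Fin m → E n → ℂ) (i : Fin m) {r : ℝ} (hr : 0 < r)
    (μ : Measure (E n)) : eLpNorm (powAbs f s' i) (ENNReal.ofReal (r / s')) μ =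
      eLpNorm (f i) (ENNReal.ofReal r) μ ^ s' := by
  have hrs : 0 < r / s' := div_pos hr hs'
  rw [eLpNorm_eq_lintegral_rpow_enorm_toReal (by simpa using hrs) ENNReal.ofReal_ne_top,
    eLpNorm_eq_lintegral_rpow_enorm_toReal (by simpa using hr) ENNReal.ofReal_ne_top,
    ENNReal.toReal_ofReal hr.le, ENNReal.toReal_ofReal hrs.le, ← ENNReal.rpow_mul]
  simp_rw [enorm_powAbs hs', ← ENNReal.rpow_mul, mul_div_cancel₀ _ hs'.ne']
  congr 1
  field_simp

theorem MemWeighted.powAbs (hs' : 0 < s') (hP : ∀ i, 0 < P i) {f : Fin m → E n → ℂ}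
    (hf : MemWeighted P ω f) : MemWeighted (fun i => P i / s') (powWeight ω s') (powAbs f s') := by
  intro i
  rw [wMeasure_powWeight hs']
  refine ⟨?_, ?_⟩
  · exact Complex.continuous_ofReal.comp_aestronglyMeasurable
      ((hf i).1.norm.aemeasurable.pow_const s').aestronglyMeasurable
  · rw [eLpNorm_powAbs hs' f i (hP i)]
    exact ENNReal.rpow_lt_top_of_nonneg hs'.le (hf i).2.ne

theorem prodNorm_powAbs (hs' : 0 < s') (hP : ∀ i, 0 < P i) (f : Fin m → E n → ℂ) :
    prodNorm (fun i => P i / s') (powWeight ω s') (powAbs f s') = prodNorm P ω f ^ s' := by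
  simp_rw [prodNorm, wMeasure_powWeight hs', eLpNorm_powAbs hs' f _ (hP _)]
  exact ENNReal.prod_rpow_of_nonneg hs'.le

/-- The relation between the exponents is linear in their reciprocals and the order, so all are
multiplied by s'. This lets the maximal bounds be applied to |f|^s' and ω^s'. -/
theorem FracExponents.of_rpow (hm : 0 < m) (hn : 0 < n) (hs' : 0 < s') (hP : ∀ i, s' < P i)
    (hβ : 0 < β) (hκ : 0 < κ) (h : 1 / κ = ∑ i, 1 / P i - β / n) :
    FracExponents m n (fun i => P i / s') (s' * β) (κ / s') where
  m_pos := hm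
  n_pos := hn
  one_lt i := by rw [one_lt_div hs']; exact hP i
  β_pos := by positivity
  κ_pos := by positivity
  κ_eq := by
    simp_rw [one_div_div, div_eq_mul_one_div s']
    rw [h, ← Finset.mul_sum]
    ring

theorem fracMaximal_congr {f g : Fin m → E n → ℂ} (h : ∀ i x, ‖f i x‖ₑ = ‖g i x‖ₑ) (β : ℝ) :
    fracMaximal β f = fracMaximal β g := by
  funext x
  simp_rw [fracMaximal, h]

end Power

theorem nuMeasure_eq (ω : Fin m → E n → ℝ≥0) (κ : ℝ) :
    nuMeasure ω κ = volume.withDensity (nuDensity ω κ) := rfl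

theorem nuMeasure_eq_zero (hω : ∀ i, AEMeasurable (ω i)) {κ' : ℝ} (hκ : 0 < κ) (hκ' : 0 < κ')
    (h : nuMeasure ω κ = 0) : nuMeasure ω κ' = 0 := by
  rw [nuMeasure_eq, withDensity_eq_zero_iff (aemeasurable_nuDensity hω κ)] at h
  rw [nuMeasure_eq, withDensity_eq_zero_iff (aemeasurable_nuDensity hω κ')]
  filter_upwards [h] with x hx
  rw [Pi.zero_apply, nuDensity, ENNReal.rpow_eq_zero_iff_of_pos hκ] at hx
  rw [nuDensity, hx, ENNReal.zero_rpow_of_pos hκ', Pi.zero_apply]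

/-- Hölder with the weights q/(2qp) and q/(2qm), whose sum is 1, after writing ν^q = ν^(q/2)
ν^(q/2). Measurability is needed only for the minorants u and v. -/
theorem lintegral_geom_mean_le (hω : ∀ i, AEMeasurable (ω i)) {q qp qm s' : ℝ} (hq : 0 < q)
    (hqp : 0 < qp) (hqm : 0 < qm) (hs' : 0 < s') (h : 1 / q = 1 / (2 * qp) + 1 / (2 * qm))
    {u v U V : E n → ℝ≥0∞} (hu : Measurable u) (hv : Measurable v) (huU : ∀ x, u x ≤ U x)
    (hvV : ∀ x, v x ≤ V x) :
    ∫⁻ x, (u x * v x) ^ (q / (2 * s')) ∂nuMeasure ω q ≤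
      (eLpNorm U (ENNReal.ofReal (qp / s')) (nuMeasure ω qp) *
        eLpNorm V (ENNReal.ofReal (qm / s')) (nuMeasure ω qm)) ^ (q / (2 * s')) := by
  have hq2 : 0 ≤ q / (2 * s') := by positivity
  have hpart : ∀ {r : ℝ}, 0 < r → ∀ {w W : E n → ℝ≥0∞}, Measurable w → (∀ x, w x ≤ W x) →
      (∫⁻ x, nuDensity ω r x * w x ^ (r / s')) ^ (q / (2 * r)) ≤
        eLpNorm W (ENNReal.ofReal (r / s')) (nuMeasure ω r) ^ (q / (2 * s')) := by
    intro r hr w W hw hwW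
    have hrs : 0 < r / s' := by positivity
    rw [eLpNorm_eq_lintegral_rpow_enorm_toReal (by simpa using hrs) ENNReal.ofReal_ne_top,
      ENNReal.toReal_ofReal hrs.le, ← ENNReal.rpow_mul,
      show 1 / (r / s') * (q / (2 * s')) = q / (2 * r) by field_simp]
    refine ENNReal.rpow_le_rpow ?_ (by positivity)
    calc ∫⁻ x, nuDensity ω r x * w x ^ (r / s') = ∫⁻ x, w x ^ (r / s') ∂nuMeasure ω r :=
          (lintegral_withDensity_eq_lintegral_mul₀ (aemeasurable_nuDensity hω r)
            (hw.pow_const _).aemeasurable).symm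
      _ ≤ _ := lintegral_mono fun x => by
          rw [enorm_eq_self]; exact ENNReal.rpow_le_rpow (hwW x) hrs.le
  have hsum : q / (2 * qp) + q / (2 * qm) = 1 := by
    have := congrArg (q * ·) h
    simp only [mul_one_div_cancel hq.ne'] at this
    rw [this]; ring
  have hpt : ∀ x, nuDensity ω q x * (u x * v x) ^ (q / (2 * s')) =
      (nuDensity ω qp x * u x ^ (qp / s')) ^ (q / (2 * qp)) *
        (nuDensity ω qm x * v x ^ (qm / s')) ^ (q / (2 * qm)) := fun x => by
    have e1 : qp * (q / (2 * qp)) = q / 2 := by field_simp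
    have e2 : qm * (q / (2 * qm)) = q / 2 := by field_simp
    have e3 : qp / s' * (q / (2 * qp)) = q / (2 * s') := by field_simp
    have e4 : qm / s' * (q / (2 * qm)) = q / (2 * s') := by field_simp
    have e5 : q = q / 2 + q / 2 := by ring
    have hq4 : 0 ≤ q / 2 := by positivity
    simp only [nuDensity]
    rw [ENNReal.mul_rpow_of_nonneg _ _ hq2, ENNReal.mul_rpow_of_nonneg _ _ (by positivity),
      ENNReal.mul_rpow_of_nonneg _ _ (by positivity)]
    simp only [← ENNReal.rpow_mul, e1, e2, e3, e4]
    nth_rewrite 1 [e5]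
    rw [ENNReal.rpow_add_of_nonneg _ _ hq4 hq4]
    ring
  have huv : Measurable fun x => (u x * v x) ^ (q / (2 * s')) := (hu.mul hv).pow_const _
  rw [nuMeasure_eq, lintegral_withDensity_eq_lintegral_mul₀ (aemeasurable_nuDensity hω q)
    huv.aemeasurable]
  change ∫⁻ x, nuDensity ω q x * (u x * v x) ^ (q / (2 * s')) ≤ _
  simp_rw [hpt]
  refine (ENNReal.lintegral_mul_norm_pow_le ((aemeasurable_nuDensity hω qp).mul
    (hu.pow_const _).aemeasurable) ((aemeasurable_nuDensity hω qm).mul (hv.pow_const _).aemeasurable)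
    (by positivity) (by positivity) hsum).trans ?_
  rw [ENNReal.mul_rpow_of_nonneg _ _ hq2]
  exact mul_le_mul' (hpart hqp hu huU) (hpart hqm hv hvV)

section Integral
variable {Ω : (Fin m → E n) → ℂ} {α : ℝ} {f : Fin m → E n → ℂ}

theorem aestronglyMeasurable_fracIntegrand_uncurry (hΩ : AEStronglyMeasurable Ω volume)
    (hf : ∀ i, AEStronglyMeasurable (f i)) :
    AEStronglyMeasurable (fun p : E n × (Fin m → E n) => fracIntegrand Ω α f p.1 p.2)
      (volume.prod volume) := by
  have h1 : AEMeasurable (fun p : E n × (Fin m → E n) => Ω p.2) (volume.prod volume) :=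
    hΩ.aemeasurable.comp_quasiMeasurePreserving Measure.quasiMeasurePreserving_snd
  have h2 : Measurable fun p : E n × (Fin m → E n) =>
      ((jointNorm p.2 ^ ((m : ℝ) * n - α) : ℝ) : ℂ) :=
    Complex.measurable_ofReal.comp
      ((continuous_jointNorm.measurable.comp measurable_snd).pow_const _)
  have h3 : ∀ i, AEMeasurable (fun p : E n × (Fin m → E n) => f i (p.1 - p.2 i))
      (volume.prod volume) := fun i => by
    refine (hf i).aemeasurable.comp_quasiMeasurePreserving ?_
    refine QuasiMeasurePreserving.prod_of_left
      (measurable_fst.sub ((measurable_pi_apply i).comp measurable_snd)) (.of_forall fun y => ?_)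
    exact (measurePreserving_sub_right volume (y i)).quasiMeasurePreserving
  exact ((h1.div h2.aemeasurable).mul
    (Finset.aemeasurable_fun_prod _ fun i _ => h3 i)).aestronglyMeasurable

theorem aestronglyMeasurable_fracIntegrand (hΩ : AEStronglyMeasurable Ω volume)
    (hf : ∀ i, AEStronglyMeasurable (f i)) (x : E n) :
    AEStronglyMeasurable (fracIntegrand Ω α f x) volume := by
  have h2 : Measurable fun y : Fin m → E n => ((jointNorm y ^ ((m : ℝ) * n - α) : ℝ) : ℂ) :=
    Complex.measurable_ofReal.comp (continuous_jointNorm.measurable.pow_const _)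
  exact ((hΩ.aemeasurable.div h2.aemeasurable).mul
    (aestronglyMeasurable_prod_translate hf x).aemeasurable).aestronglyMeasurable

end Integral

theorem upperPower_nonneg (h : FracExponents m n P β κ) : 0 ≤ upperPower n P κ β :=
  mul_nonneg (mul_nonneg (one_div_nonneg.2 h.κ_pos.le) h.theta_pos.le)
    (Real.iSup_nonneg fun i => (h.conj_pos i).le)

theorem eLpNorm_fracMaximal_lt_top (h : FracExponents m n P β κ) (hω : ∀ i, AEMeasurable (ω i))
    (hA : InApq P κ (wpow ω 1)) {f : Fin m → E n → ℂ} (hf : MemWeighted P ω f) :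
    eLpNorm (fracMaximal β f) (ENNReal.ofReal κ) (nuMeasure ω κ) < ∞ := by
  obtain ⟨C, hC⟩ := maximalPower_upperPower h
  refine (hC ω hω hA f hf).trans_lt (ENNReal.mul_lt_top (ENNReal.mul_lt_top ENNReal.coe_lt_top
    (ENNReal.rpow_lt_top_of_nonneg (upperPower_nonneg h) hA.ne)) ?_)
  exact ENNReal.prod_lt_top fun i _ => (hf i).2

/-- Welland's inequality is integrated against ν^q using the geometric mean estimate; the reciprocal
exponents match because α is the midpoint of α ± ε. The maximal norms are left in the bound, so that
either the mixed estimate or any admissible powers can be inserted. -/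
theorem exists_fracIntegralBound (hm : 0 < m) (hn : 0 < n) {α ε s' q qp qm : ℝ} {s : ℝ≥0∞}
    (hαmn : α < m * n) (hε : 0 < ε) (hεα : ε < α) (hs' : 1 ≤ s')
    (hss' : s⁻¹ + (ENNReal.ofReal s')⁻¹ = 1) (hP : ∀ i, s' < P i)
    (hq0 : 0 < q) (hq : 1 / q = ∑ i, 1 / P i - α / n)
    (hqp0 : 0 < qp) (hqp : 1 / qp = ∑ i, 1 / P i - (α + ε) / n)
    (hqm0 : 0 < qm) (hqm : 1 / qm = ∑ i, 1 / P i - (α - ε) / n) :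
    ∃ C : ℝ≥0, ∀ (Ω : (Fin m → E n) → ℂ) (K : ℝ≥0∞), KernelBound Ω s K → K ≠ ∞ →
      ∀ ω : Fin m → E n → ℝ≥0, (∀ i, AEMeasurable (ω i)) →
        InApq (fun i => P i / s') (qp / s') (wpow ω s') →
        InApq (fun i => P i / s') (qm / s') (wpow ω s') →
        ∀ f : Fin m → E n → ℂ, MemWeighted P ω f →
          FracIntegralBound Ω α q ω f (C * K *
            (eLpNorm (fracMaximal (s' * (α + ε)) (powAbs f s')) (ENNReal.ofReal (qp / s'))
              (nuMeasure ω qp) *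
            eLpNorm (fracMaximal (s' * (α - ε)) (powAbs f s')) (ENNReal.ofReal (qm / s'))
              (nuMeasure ω qm)) ^ (1 / (2 * s'))) := by
  have hs0 : 0 < s' := by linarith
  have hP0 : ∀ i, 0 < P i := fun i => hs0.trans (hP i)
  have hFp := FracExponents.of_rpow hm hn hs0 hP (by linarith) hqp0 hqp
  have hFm := FracExponents.of_rpow hm hn hs0 hP (by linarith) hqm0 hqm
  obtain ⟨C, hC⟩ := exists_welland hm hn hε hs' hss' hαmn
  refine ⟨C, fun Ω K hK hKt ω hω hAp hAm f hf => ?_⟩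
  set A := eLpNorm (fracMaximal (s' * (α + ε)) (powAbs f s')) (ENNReal.ofReal (qp / s'))
    (nuMeasure ω qp) with hA
  set B := eLpNorm (fracMaximal (s' * (α - ε)) (powAbs f s')) (ENNReal.ofReal (qm / s'))
    (nuMeasure ω qm) with hB
  have hω' : ∀ i, AEMeasurable (powWeight ω s' i) := fun i => (hω i).pow_const _
  have hw1 : wpow (powWeight ω s') 1 = wpow ω s' := by rw [wpow_powWeight hs0, mul_one]
  rw [← hw1] at hAp hAm
  have hf' := hf.powAbs hs0 hP0
  rcases nu_dichotomy hFp hω' hAp with h0 | ⟨hne, -⟩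
  -- For a trivial weight ν vanishes almost everywhere whatever the exponent, so all claims are
  -- about the zero measure.
  · rw [nuMeasure_powWeight hs0] at h0
    have h1 : nuMeasure ω q = 0 := nuMeasure_eq_zero hω hqp0 hq0 h0
    rw [FracIntegralBound, h1]
    simp [MemLp]
  have hω0 : ∀ i, ∀ᵐ x, ω i x ≠ 0 := fun i => by
    filter_upwards [hne i] with x hx h0
    exact hx (by rw [powWeight, h0, NNReal.zero_rpow hs0.ne'])
  have hfm := fun i => aemeasurable_of_memWeighted hω hω0 hf i
  -- Finiteness of the two maximal norms, known from the upper bound, is what yields absolute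
  -- convergence almost everywhere.
  have hAt : A ≠ ∞ := by
    have := eLpNorm_fracMaximal_lt_top hFp hω' hAp hf'
    rw [nuMeasure_powWeight hs0] at this
    exact this.ne
  have hBt : B ≠ ∞ := by
    have := eLpNorm_fracMaximal_lt_top hFm hω' hAm hf'
    rw [nuMeasure_powWeight hs0] at this
    exact this.ne
  set g : Fin m → E n → ℝ≥0∞ := fun i y => ‖f i y‖ₑ ^ s'
  have hg : ∀ i, AEMeasurable (g i) := fun i => (hfm i).enorm.pow_const _
  set u := centredMaximal (s' * (α + ε)) g
  set v := centredMaximal (s' * (α - ε)) g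
  have hu : Measurable u := measurable_centredMaximal _ hg
  have hv : Measurable v := measurable_centredMaximal _ hg
  have hpt : ∀ x, ∫⁻ y, ‖fracIntegrand Ω α f x y‖ₑ ≤ C * K * (u x * v x) ^ (1 / (2 * s')) :=
    hC Ω K hK f hfm
  have hgm : ∫⁻ x, (u x * v x) ^ (q / (2 * s')) ∂nuMeasure ω q ≤ (A * B) ^ (q / (2 * s')) :=
    lintegral_geom_mean_le hω hq0 hqp0 hqm0 hs0
      (by
        have e : ∀ t : ℝ, 1 / (2 * t) = 1 / t / 2 := fun t => by field_simp
        rw [e, e, hqp, hqm, hq]; ring) hu hv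
      (fun x => centredMaximal_le _ (fun i x => (enorm_powAbs hs0 f i x).symm) x)
      (fun x => centredMaximal_le _ (fun i x => (enorm_powAbs hs0 f i x).symm) x)
  have hABt : (A * B) ^ (q / (2 * s')) ≠ ∞ :=
    ENNReal.rpow_ne_top_of_nonneg (by positivity) (ENNReal.mul_ne_top hAt hBt)
  have huv : Measurable fun x => (u x * v x) ^ (q / (2 * s')) := (hu.mul hv).pow_const _
  have hae : ∀ᵐ x ∂nuMeasure ω q, (u x * v x) ^ (q / (2 * s')) < ∞ :=
    ae_lt_top huv (hgm.trans_lt hABt.lt_top).ne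
  have hnorm : eLpNorm (fracIntegral Ω α f) (ENNReal.ofReal q) (nuMeasure ω q) ≤
      C * K * (A * B) ^ (1 / (2 * s')) := by
    rw [eLpNorm_eq_lintegral_rpow_enorm_toReal (by simpa using hq0) ENNReal.ofReal_ne_top,
      ENNReal.toReal_ofReal hq0.le]
    have e : 1 / (2 * s') * q = q / (2 * s') := by ring
    calc (∫⁻ x, ‖fracIntegral Ω α f x‖ₑ ^ q ∂nuMeasure ω q) ^ (1 / q)
        ≤ (∫⁻ x, (C * K) ^ q * (u x * v x) ^ (q / (2 * s')) ∂nuMeasure ω q) ^ (1 / q) := by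
          gcongr with x
          rw [← e, ENNReal.rpow_mul, ← ENNReal.mul_rpow_of_nonneg _ _ hq0.le]
          exact ENNReal.rpow_le_rpow ((enorm_integral_le_lintegral_enorm _).trans (hpt x)) hq0.le
      _ ≤ ((C * K) ^ q * (A * B) ^ (q / (2 * s'))) ^ (1 / q) := by
          rw [lintegral_const_mul _ huv]
          gcongr
      _ = _ := by
          rw [← e, ENNReal.rpow_mul, ← ENNReal.mul_rpow_of_nonneg _ _ hq0.le, ← ENNReal.rpow_mul,
            mul_one_div_cancel hq0.ne', ENNReal.rpow_one]
  refine ⟨?_, ⟨?_, hnorm.trans_lt ?_⟩, hnorm⟩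
  · filter_upwards [hae] with x hx
    refine ⟨aestronglyMeasurable_fracIntegrand hK.aestronglyMeasurable hfm x, (hpt x).trans_lt ?_⟩
    refine ENNReal.mul_lt_top (ENNReal.mul_lt_top ENNReal.coe_lt_top hKt.lt_top) ?_
    refine ENNReal.rpow_lt_top_of_nonneg (by positivity) fun htop => ?_
    rw [htop, ENNReal.top_rpow_of_pos (by positivity)] at hx
    exact lt_irrefl _ hx
  · exact ((aestronglyMeasurable_fracIntegrand_uncurry hK.aestronglyMeasurable
      hfm).integral_prod_right').mono_ac (withDensity_absolutelyContinuous _ _)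
  · exact ENNReal.mul_lt_top (ENNReal.mul_lt_top ENNReal.coe_lt_top hKt.lt_top)
      (ENNReal.rpow_lt_top_of_nonneg (by positivity) (ENNReal.mul_ne_top hAt hBt))

theorem FracIntegralBound.mono {Ω : (Fin m → E n) → ℂ} {α q : ℝ} {f : Fin m → E n → ℂ}
    {B B' : ℝ≥0∞} (h : FracIntegralBound Ω α q ω f B) (hB : B ≤ B') :
    FracIntegralBound Ω α q ω f B' :=
  ⟨h.1, h.2.1, h.2.2.trans hB⟩

theorem exists_kernelBound (hm : 0 < m) (hn : 0 < n) (s : ℝ≥0∞) : ∃ B : ℝ≥0,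
    ∀ (Ω : (Fin m → E n) → ℂ) (N : ℝ≥0∞), IsJointKernel Ω s N ∨ IsProductKernel Ω s N →
      KernelBound Ω s (B * N) ∧ N ≠ ∞ := by
  obtain ⟨B₁, h₁⟩ := kernelBound_of_isJointKernel hm hn s
  obtain ⟨B₂, h₂⟩ := kernelBound_of_isProductKernel (m := m) hn s
  have hmono : ∀ {Ω : (Fin m → E n) → ℂ} {K K' : ℝ≥0∞}, K ≤ K' → KernelBound Ω s K →
      KernelBound Ω s K' := fun hKK h =>
    ⟨h.1, fun r hr => (h.2 r hr).trans (mul_le_mul' hKK le_rfl)⟩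
  refine ⟨max B₁ B₂, fun Ω N h => ?_⟩
  rcases h with h | h
  · refine ⟨hmono (mul_le_mul' ?_ le_rfl) (h₁ Ω N h), h.2.2 ▸ h.2.1.2.ne⟩
    exact_mod_cast le_max_left _ _
  · refine ⟨hmono (mul_le_mul' ?_ le_rfl) (h₂ Ω N h), h.2.2 ▸ h.2.1.2.ne⟩
    exact_mod_cast le_max_right _ _

theorem sqrt_mul_self_rpow {s' : ℝ} (hs' : 0 < s') (a : ℝ≥0∞) :
    (a ^ s' * a ^ s') ^ (1 / (2 * s')) = a := by
  rw [← ENNReal.rpow_add_of_nonneg _ _ hs'.le hs'.le, ← ENNReal.rpow_mul,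
    show (s' + s') * (1 / (2 * s')) = 1 by field_simp; norm_num, ENNReal.rpow_one]

theorem upperPower_const (hm : 0 < m) {r : ℝ} (hPr : ∀ i, P i = r) (q β : ℝ) :
    upperPower n P q β = r.conjExponent / q * (1 - β / (m * n)) := by
  have : Nonempty (Fin m) := ⟨⟨0, hm⟩⟩
  simp_rw [upperPower, hPr]
  rw [ciSup_const]; ring

/-- Equal exponents give mp = r, so mp/(mp - 1) is r', and the value is the one in
`upperPower_const`. -/
theorem lowerPower_const (hm : 0 < m) {r p q : ℝ} (hr : 1 < r) (hPr : ∀ i, P i = r)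
    (hp : 1 / p = ∑ i, 1 / P i) (β : ℝ) :
    lowerPower m n p q β = r.conjExponent / q * (1 - β / (m * n)) := by
  have hm' : (m : ℝ) ≠ 0 := by exact_mod_cast hm.ne'
  have hr0 : r ≠ 0 := by linarith
  have hmp : m * p = r := by
    simp_rw [hPr] at hp
    rw [Finset.sum_const, Finset.card_univ, Fintype.card_fin, nsmul_eq_mul] at hp
    have : p ≠ 0 := by
      rintro rfl
      simp only [div_zero] at hp
      exact (mul_ne_zero hm' (one_div_ne_zero hr0)) hp.symm
    field_simp at hp
    linarith
  rw [lowerPower, hmp, Real.conjExponent, div_div, mul_comm q]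

end RoughFractional

end

/-! ### The corollary. -/

open RoughFractional
theorem corollary1p7 (m n : ℕ) (hm : 2 ≤ m) (hn : 1 ≤ n)
    (α ε : ℝ) (hα : 0 < α) (hαmn : α < m * n) (hε : 0 < ε) (hεα : ε < α)
    (s : ℝ≥0∞) (s' : ℝ) (hs' : 1 ≤ s') (hss' : s⁻¹ + (ENNReal.ofReal s')⁻¹ = 1)
    (P : Fin m → ℝ) (hP : ∀ i, s' < P i)
    (p q qp qm : ℝ) (hp : 1 / p = ∑ i, 1 / P i)
    (hq0 : 0 < q) (hq : 1 / q = 1 / p - α / n)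
    (hqp0 : 0 < qp) (hqp : 1 / qp = 1 / p - (α + ε) / n)
    (hqm0 : 0 < qm) (hqm : 1 / qm = 1 / p - (α - ε) / n) :
    -- the estimate for the rough operator
    (∃ C : ℝ≥0, ∀ (Ω : (Fin m → E n) → ℂ) (N : ℝ≥0∞),
      IsJointKernel Ω s N ∨ IsProductKernel Ω s N →
      ∀ ω : Fin m → E n → ℝ≥0, (∀ i, AEMeasurable (ω i)) →
        InApq (fun i => P i / s') (q / s') (wpow ω s') →
        InApq (fun i => P i / s') (qp / s') (wpow ω s') →
        InApq (fun i => P i / s') (qm / s') (wpow ω s') →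
        ∀ f : Fin m → E n → ℂ, MemWeighted P ω f →
          FracIntegralBound Ω α q ω f
            (C * N *
              (apqConst (fun i => P i / s') (qp / s') (wpow ω s') ^ (1 / (2 * qp)) *
                apqConst (fun i => P i / s') (qm / s') (wpow ω s') ^ (1 / (2 * qm)) *
                ∏ i, aInfty (wpow ω (-(s' * (P i / s').conjExponent)) i) ^ (1 / P i)) *
              prodNorm P ω f)) ∧
    -- the case `Ω ≡ 1`: the estimate with the powers for the maximal operators of orders `α ± ε`
    (∀ γ₁ γ₂ : ℝ, MaximalPower n P (α + ε) qp γ₁ → MaximalPower n P (α - ε) qm γ₂ →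
      ∃ C : ℝ≥0, ∀ ω : Fin m → E n → ℝ≥0, (∀ i, AEMeasurable (ω i)) →
        InApq P q (wpow ω 1) → InApq P qp (wpow ω 1) → InApq P qm (wpow ω 1) →
        ∀ f : Fin m → E n → ℂ, MemWeighted P ω f →
          FracIntegralBound (fun _ => 1) α q ω f
            (C * (apqConst P qp (wpow ω 1) ^ γ₁ * apqConst P qm (wpow ω 1) ^ γ₂) ^ (1 / 2 : ℝ) *
              prodNorm P ω f)) ∧
    -- the bounds for the best such powers
    ((∀ γ₁ : ℝ, MaximalPower n P (α + ε) qp γ₁ → lowerPower m n p qp (α + ε) ≤ γ₁) ∧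
      MaximalPower n P (α + ε) qp (upperPower n P qp (α + ε))) ∧
    ((∀ γ₂ : ℝ, MaximalPower n P (α - ε) qm γ₂ → lowerPower m n p qm (α - ε) ≤ γ₂) ∧
      MaximalPower n P (α - ε) qm (upperPower n P qm (α - ε))) ∧
    -- the exact best powers when all the `Pᵢ` are equal
    (∀ r : ℝ, (∀ i, P i = r) →
      IsLeast {γ₁ : ℝ | MaximalPower n P (α + ε) qp γ₁}
        (r.conjExponent / qp * (1 - (α + ε) / (m * n))) ∧
      IsLeast {γ₂ : ℝ | MaximalPower n P (α - ε) qm γ₂}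
        (r.conjExponent / qm * (1 - (α - ε) / (m * n)))) := by
  have hm0 : 0 < m := by omega
  have hn0 : 0 < n := hn
  have hs0 : 0 < s' := by linarith
  have hP1 : ∀ i, 1 < P i := fun i => hs'.trans_lt (hP i)
  have hP0 : ∀ i, 0 < P i := fun i => hs0.trans (hP i)
  have hq' := hq; have hqp' := hqp; have hqm' := hqm
  rw [hp] at hq' hqp' hqm'
  have hFp : FracExponents m n P (α + ε) qp := ⟨hm0, hn0, hP1, by linarith, hqp0, hqp'⟩
  have hFm : FracExponents m n P (α - ε) qm := ⟨hm0, hn0, hP1, by linarith, hqm0, hqm'⟩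
  refine ⟨?_, ?_, ⟨fun γ h => lowerPower_le hFp hp h, maximalPower_upperPower hFp⟩,
    ⟨fun γ h => lowerPower_le hFm hp h, maximalPower_upperPower hFm⟩, fun r hr => ?_⟩
  · obtain ⟨C, hC⟩ := exists_fracIntegralBound hm0 hn0 hαmn hε hεα hs' hss' hP hq0 hq' hqp0 hqp'
      hqm0 hqm'
    obtain ⟨B, hB⟩ := exists_kernelBound (m := m) hm0 hn0 s
    have hGp := FracExponents.of_rpow hm0 hn0 hs0 hP (by linarith) hqp0 hqp'
    have hGm := FracExponents.of_rpow hm0 hn0 hs0 hP (by linarith) hqm0 hqm'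
    obtain ⟨Cp, hCp⟩ := eLpNorm_fracMaximal_le_mixed hGp
    obtain ⟨Cm, hCm⟩ := eLpNorm_fracMaximal_le_mixed hGm
    have he : 0 ≤ 1 / (2 * s') := by positivity
    refine ⟨C * B * (Cp * Cm) ^ (1 / (2 * s')), fun Ω N hΩ ω hω _ hAp hAm f hf => ?_⟩
    obtain ⟨hK, hN⟩ := hB Ω N hΩ
    refine (hC Ω _ hK (ENNReal.mul_ne_top ENNReal.coe_ne_top hN) ω hω hAp hAm f hf).mono ?_
    have hω' : ∀ i, AEMeasurable (powWeight ω s' i) := fun i => (hω i).pow_const _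
    have hw1 : wpow (powWeight ω s') 1 = wpow ω s' := by rw [wpow_powWeight hs0, mul_one]
    have hdual : ∀ i, dualWeight (fun i => P i / s') (powWeight ω s') i =
        wpow ω (-(s' * (P i / s').conjExponent)) i := fun i => by
      rw [dualWeight, wpow_powWeight hs0, mul_neg]
    have hp1 := hCp (powWeight ω s') hω' (by rwa [hw1]) _ (hf.powAbs hs0 hP0)
    have hm1 := hCm (powWeight ω s') hω' (by rwa [hw1]) _ (hf.powAbs hs0 hP0)
    rw [nuMeasure_powWeight hs0, prodNorm_powAbs hs0 hP0, hw1] at hp1 hm1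
    simp_rw [hdual] at hp1 hm1
    have haI : ∏ i, aInfty (wpow ω (-(s' * (P i / s').conjExponent)) i) ^ (1 / (P i / s')) =
        (∏ i, aInfty (wpow ω (-(s' * (P i / s').conjExponent)) i) ^ (1 / P i)) ^ s' := by
      rw [← ENNReal.prod_rpow_of_nonneg hs0.le]
      refine Finset.prod_congr rfl fun i _ => ?_
      rw [← ENNReal.rpow_mul]
      congr 1
      have := hP0 i
      field_simp
    rw [haI] at hp1 hm1
    set T := ∏ i, aInfty (wpow ω (-(s' * (P i / s').conjExponent)) i) ^ (1 / P i)
    set Ap := apqConst (fun i => P i / s') (qp / s') (wpow ω s')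
    set Am := apqConst (fun i => P i / s') (qm / s') (wpow ω s')
    -- The outer power 1/(2s') halves the exponent of each characteristic, while the A_∞ product and
    -- the norms occur once in each factor to the power s' and so return to the first power.
    have ep : ∀ {a : ℝ≥0∞} {t : ℝ}, 0 < t → (a ^ (1 / (t / s'))) ^ (1 / (2 * s')) =
        a ^ (1 / (2 * t)) := fun {a t} ht => by
      rw [← ENNReal.rpow_mul]
      congr 1
      field_simp
    calc _ ≤ C * (B * N) * ((Cp * (Ap ^ (1 / (qp / s')) * T ^ s') * prodNorm P ω f ^ s') *
          (Cm * (Am ^ (1 / (qm / s')) * T ^ s') * prodNorm P ω f ^ s')) ^ (1 / (2 * s')) := by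
          gcongr
      _ = C * (B * N) * ((Cp * Cm) ^ (1 / (2 * s')) * ((Ap ^ (1 / (qp / s'))) ^ (1 / (2 * s')) *
          (Am ^ (1 / (qm / s'))) ^ (1 / (2 * s'))) * (T ^ s' * T ^ s') ^ (1 / (2 * s')) *
          (prodNorm P ω f ^ s' * prodNorm P ω f ^ s') ^ (1 / (2 * s'))) := by
          simp only [ENNReal.mul_rpow_of_nonneg _ _ he]
          ring
      _ = _ := by
          rw [ep hqp0, ep hqm0, sqrt_mul_self_rpow hs0, sqrt_mul_self_rpow hs0]
          push_cast
          rw [ENNReal.coe_rpow_of_nonneg _ he]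
          push_cast
          ring
  · rintro γ₁ γ₂ ⟨Cp, hCp⟩ ⟨Cm, hCm⟩
    -- The constant kernel is bounded, so s' = 1 and s = ∞ are used here irrespective of the given
    -- exponents.
    obtain ⟨C, hC⟩ := exists_fracIntegralBound (s := ∞) (s' := 1) hm0 hn0 hαmn hε hεα le_rfl
      (by simp) hP1 hq0 hq' hqp0 hqp' hqm0 hqm'
    obtain ⟨B, hB⟩ := exists_kernelBound (m := m) hm0 hn0 ∞
    obtain ⟨hK, hN⟩ := hB _ _ (Or.inl (isJointKernel_one m n))
    set N := eLpNorm (jointTrace fun _ : Fin m → E n => (1 : ℂ)) ∞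
      (volume : Measure (EuclideanSpace ℝ (Fin m × Fin n))).toSphere
    have he : (0 : ℝ) ≤ 1 / 2 := by norm_num
    refine ⟨C * (B * N.toNNReal) * (Cp * Cm) ^ (1 / 2 : ℝ), fun ω hω _ hAp hAm f hf => ?_⟩
    have hfa : ∀ β, fracMaximal (1 * β) (powAbs f 1) = fracMaximal β f := fun β => by
      rw [one_mul]
      exact fracMaximal_congr (fun i x => by rw [enorm_powAbs one_pos, ENNReal.rpow_one]) β
    have hmain := hC _ _ hK (ENNReal.mul_ne_top ENNReal.coe_ne_top hN) ω hω (by simpa using hAp)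
      (by simpa using hAm) f hf
    rw [hfa, hfa, div_one, div_one, mul_one] at hmain
    refine hmain.mono ?_
    set Ap := apqConst P qp (wpow ω 1)
    set Am := apqConst P qm (wpow ω 1)
    have hpn := sqrt_mul_self_rpow one_pos (prodNorm P ω f)
    rw [ENNReal.rpow_one, mul_one] at hpn
    calc _ ≤ C * (B * N) * ((Cp * Ap ^ γ₁ * prodNorm P ω f) *
          (Cm * Am ^ γ₂ * prodNorm P ω f)) ^ (1 / 2 : ℝ) := by
          gcongr
          · exact hCp ω hω hAp f hf
          · exact hCm ω hω hAm f hf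
      _ = C * (B * N) * ((Cp * Cm) ^ (1 / 2 : ℝ) * (Ap ^ γ₁ * Am ^ γ₂) ^ (1 / 2 : ℝ) *
          (prodNorm P ω f * prodNorm P ω f) ^ (1 / 2 : ℝ)) := by
          simp only [ENNReal.mul_rpow_of_nonneg _ _ he]
          ring
      _ = _ := by
          rw [hpn]
          push_cast
          rw [ENNReal.coe_rpow_of_nonneg _ he, ENNReal.coe_toNNReal hN]
          push_cast
          ring
  · have hr1 : 1 < r := hr ⟨0, hm0⟩ ▸ hP1 ⟨0, hm0⟩
    refine ⟨⟨?_, fun γ h => ?_⟩, ⟨?_, fun γ h => ?_⟩⟩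
    · rw [← upperPower_const hm0 hr]
      exact maximalPower_upperPower hFp
    · rw [← lowerPower_const hm0 hr1 hr hp]
      exact lowerPower_le hFp hp h
    · rw [← upperPower_const hm0 hr]
      exact maximalPower_upperPower hFm
    · rw [← lowerPower_const hm0 hr1 hr hp]
      exact lowerPower_le hFm hp h
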